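/- All matrices are complex. (1) Let $n\ge 2$ and $w$ be integers with $2\le 2w\le n-1$, and put $\alpha=\lfloor w/(n-2w)\rfloor$, $s=w \bmod (n-2w)$. For $k\ge 0$ let $F_k$ and $G_k$ be the $k\times(k+1)$ matrices with ones exactly at the positions $(i,i+1)$, respectively $(i,i)$, and zeros elsewhere, and let $$\mathcal M_k=\lambda\begin{bmatrix}0&G_k\\-G_k^T&0\end{bmatrix}-\begin{bmatrix}0&F_k\\-F_k^T&0\end{bmatrix}.$$ Let $\mathcal W=\operatorname{diag}(\mathcal M_{\alpha+1},\dots,\mathcal M_{\alpha+1},\mathcal M_\alpha,\dots,\mathcal M_\alpha)$ with $s$ blocks $\mathcal M_{\alpha+1}$ and $n-2w-s$ blocks $\mathcal M_\alpha$, an $n\times n$ skew-symmetric pencil. For a skew-symmetric pencil $\lambda A-B$, the codimension $\operatorname{cod} O^c(\lambda A-B)$ of its congruence orbit $O^c(\lambda A-B)=\{S^T(\lambda A-B)S: S\in GL_n(\mathbb C)\}$ is the dimension of the normal space, i.e. of the orthogonal complement, with respect to the Frobenius inner product on the space of $n\times n$ skew-symmetric pencils, of the tangent space $\{\lambda(X^TA+AX)-(X^TB+BX):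 X\in\mathbb C^{n\times n}\}$. Then $$\operatorname{cod} O^c(\mathcal W)=(n-2w-1)(n-w).$$ (2) Let $m\ge 2$, $r$ and $d$ be integers such that $d\ge 1$ is odd and $2\le 2r\le m-1$, and put $\beta=\lfloor rd/(m-2r)\rfloor$, $t=rd \bmod (m-2r)$. Let $W=\lambda^dA_d+\dots+\lambda A_1+A_0$ be any $m\times m$ skew-symmetric matrix polynomial of degree exactly $d$ and rank exactly $2r$ without finite or infinite elementary divisors, with $t$ left minimal indices equal to $\beta+1$ and $m-2r-t$ left minimal indices equal to $\beta$, and with the same right minimal indices. Let $O(W)$ be the set of all $m\times m$ skew-symmetric matrix polynomials of grade $d$ (that is, of degree at most $d$) with the same complete eigenstructure as $W$ (finite and infinite elementary divisors with respect to the grade $d$, left and right minimal indices). Let $$c=\tfrac12\,(m-2r-1)\,(m(d+1)-2r).$$ Then $O(W)$ is a complex submanifold of codimension $c$ of the vector space of $m\times m$ skew-symmetric matrix polynomials of grade $d$. Moreover $\operatorname{cod} O^c(\mathcal L_W)=c$, where $\mathcal L_W$ is the $md\times md$ skew-symmetric pencil with $d\times d$ blocks of size $m\times m$ whose block $(i,i)$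 is $\lambda A_{d-i+1}+A_{d-i}$ for odd $i$ and $0$ for even $i$, whose blocks $(i,i+1)$ and $(i+1,i)$ are $-I_m$ and $I_m$ for odd $i$ and $-\lambda I_m$ and $\lambda I_m$ for even $i$, and whose other blocks are zero. -/

import Mathlib

open Polynomial

/- Matrices carry the entrywise sup norm. Only the topology and differentiability on
finite-dimensional spaces matter below, so the choice of norm is irrelevant. -/
attribute [local instance] Matrix.normedAddCommGroup Matrix.normedSpace

noncomputable section

namespace SkewGeneric

/-! ### Skew-symmetric matrix pencils and congruence orbits -/

/-- The space of skew-symmetric matrix pencils `λ A - B` with rows and columns indexed by `ι`;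
the pencil `λ A - B` is the pair `(A, B)`. -/
def SkewPencil (ι : Type) [Fintype ι] : Submodule ℂ (Matrix ι ι ℂ × Matrix ι ι ℂ) where
  carrier := {P | P.1.transpose = -P.1 ∧ P.2.transpose = -P.2}
  add_mem' := by
    rintro P Q ⟨h1, h2⟩ ⟨h3, h4⟩
    constructor
    · simp [h1, h3, add_comm]
    · simp [h2, h4, add_comm]
  zero_mem' := by simp
  smul_mem' := by
    rintro c P ⟨h1, h2⟩
    constructor
    · simp [h1]
    · simp [h2]

/-- The linear map `X ↦ λ (Xᵀ A + A X) - (Xᵀ B + B X)`. -/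
def congDifferential {ι : Type} [Fintype ι] (P : SkewPencil ι) :
    Matrix ι ι ℂ →ₗ[ℂ] SkewPencil ι where
  toFun X := ⟨(X.transpose * P.1.1 + P.1.1 * X, X.transpose * P.1.2 + P.1.2 * X), by
    obtain ⟨h1, h2⟩ := P.2
    constructor
    · simp [Matrix.transpose_mul, h1, add_comm]
    · simp [Matrix.transpose_mul, h2, add_comm]⟩
  map_add' X Y := by
    apply Subtype.ext
    apply Prod.ext
    · simp [Matrix.add_mul, Matrix.mul_add]; abel
    · simp [Matrix.add_mul, Matrix.mul_add]; abel
  map_smul' c X := by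
    apply Subtype.ext
    apply Prod.ext
    · simp
    · simp

/-- The tangent space at `λ A - B` to its congruence orbit `{Sᵀ (λ A - B) S : S ∈ GL}`. -/
def congTangentSpace {ι : Type} [Fintype ι] (P : SkewPencil ι) : Submodule ℂ (SkewPencil ι) :=
  LinearMap.range (congDifferential P)

/-- The Frobenius inner product of two pencils, linear in the first argument. -/
def frobeniusInner {ι : Type} [Fintype ι] (P Q : SkewPencil ι) : ℂ :=
  (P.1.1 * Q.1.1.conjTranspose).trace + (P.1.2 * Q.1.2.conjTranspose).trace

/-- The normal space at `λ A - B` to its congruence orbit: the orthogonal complement of the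
tangent space inside the space of skew-symmetric pencils. -/
def congNormalSpace {ι : Type} [Fintype ι] (P : SkewPencil ι) : Submodule ℂ (SkewPencil ι) where
  carrier := {Q | ∀ R ∈ congTangentSpace P, frobeniusInner R Q = 0}
  add_mem' := by
    intro Q Q' h h' R hR
    have e : frobeniusInner R (Q + Q') = frobeniusInner R Q + frobeniusInner R Q' := by
      simp [frobeniusInner, Matrix.mul_add]; ring
    rw [e, h R hR, h' R hR, add_zero]
  zero_mem' := by
    intro R _
    simp [frobeniusInner]
  smul_mem' := by
    intro c Q h R hR
    have e : frobeniusInner R (c • Q) = star c * frobeniusInner R Q := by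
      simp [frobeniusInner, Matrix.conjTranspose_smul, mul_add]
    rw [e, h R hR, mul_zero]

/-- The codimension of the congruence orbit of a skew-symmetric pencil: the dimension of the
normal space. -/
def congCodim {ι : Type} [Fintype ι] (P : SkewPencil ι) : ℕ :=
  Module.finrank ℂ (congNormalSpace P)

/-! ### The generic pencil -/

/-- The `k × (k+1)` matrix with ones at the positions `(i, i+1)`. -/
def matF (k : ℕ) : Matrix (Fin k) (Fin (k + 1)) ℂ :=
  Matrix.of fun i j => if (j : ℕ) = i + 1 then 1 else 0

/-- The `k × (k+1)` matrix with ones at the positions `(i, i)`. -/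
def matG (k : ℕ) : Matrix (Fin k) (Fin (k + 1)) ℂ :=
  Matrix.of fun i j => if (j : ℕ) = i then 1 else 0

/-- `[0, K; -Kᵀ, 0]`. -/
def skewBlock {k l : ℕ} (K : Matrix (Fin k) (Fin l) ℂ) :
    Matrix (Fin k ⊕ Fin l) (Fin k ⊕ Fin l) ℂ :=
  Matrix.fromBlocks 0 K (-K.transpose) 0

theorem skewBlock_transpose {k l : ℕ} (K : Matrix (Fin k) (Fin l) ℂ) :
    (skewBlock K).transpose = -skewBlock K := by
  simp [skewBlock, Matrix.fromBlocks_transpose, Matrix.fromBlocks_neg]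

/-- The index of the `i`-th canonical block of the generic pencil: `α + 1` for the first `s`
blocks and `α` for the others, where `α = ⌊w / (n - 2w)⌋` and `s = w mod (n - 2w)`. -/
def blockIndex (n w : ℕ) (i : Fin (n - 2 * w)) : ℕ :=
  if (i : ℕ) < w % (n - 2 * w) then w / (n - 2 * w) + 1 else w / (n - 2 * w)

theorem sum_ite_lt (N s a : ℕ) (hs : s ≤ N) :
    ∑ i : Fin N, (if (i : ℕ) < s then a + 1 else a) = N * a + s := by
  have h : ∀ i : Fin N, (if (i : ℕ) < s then a + 1 else a) = a + (if (i : ℕ) < s then 1 else 0) := by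
    intro i; split_ifs <;> rfl
  simp_rw [h]
  rw [Finset.sum_add_distrib, Fin.sum_univ_eq_sum_range (fun i => if i < s then 1 else 0) N]
  have h2 : (Finset.range N).filter (fun i => i < s) = Finset.range s := by
    ext i; simp; omega
  simp [h2]

theorem sum_blockIndex (n w : ℕ) (h : 2 * w < n) :
    ∑ i : Fin (n - 2 * w), (blockIndex n w i + (blockIndex n w i + 1)) = n := by
  have hpos : 0 < n - 2 * w := by omega
  have h1 : ∑ i : Fin (n - 2 * w), blockIndex n w i = w := by
    unfold blockIndex
    rw [sum_ite_lt _ _ _ (Nat.mod_lt w hpos).le]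
    exact Nat.div_add_mod w (n - 2 * w)
  simp only [Finset.sum_add_distrib, h1, Finset.sum_const, Finset.card_univ, Fintype.card_fin,
    smul_eq_mul, mul_one]
  omega

/-- The order of the rows and columns of the block-diagonal generic pencil: block after block. -/
def blockOrder (n w : ℕ) (h : 2 * w < n) :
    (Σ i : Fin (n - 2 * w), Fin (blockIndex n w i) ⊕ Fin (blockIndex n w i + 1)) ≃ Fin n :=
  ((Equiv.sigmaCongrRight fun _ => finSumFinEquiv).trans finSigmaFinEquiv).trans
    (finCongr (sum_blockIndex n w h))

/-- The generic `n × n` skew-symmetric pencil of rank `2w`, the block-diagonal pencil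
`diag(M_{α+1}, …, M_{α+1}, M_α, …, M_α)` with `s` blocks `M_{α+1}` and `n - 2w - s` blocks `M_α`,
where `M_k = λ [0, G_k; -G_kᵀ, 0] - [0, F_k; -F_kᵀ, 0]`. -/
def genericPencil (n w : ℕ) (h : 2 * w < n) : SkewPencil (Fin n) :=
  ⟨(Matrix.reindex (blockOrder n w h) (blockOrder n w h)
      (Matrix.blockDiagonal' fun i => skewBlock (matG (blockIndex n w i))),
    Matrix.reindex (blockOrder n w h) (blockOrder n w h)
      (Matrix.blockDiagonal' fun i => skewBlock (matF (blockIndex n w i)))), by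
    constructor
    · simp only [Matrix.transpose_reindex, Matrix.blockDiagonal'_transpose, skewBlock_transpose]
      ext i j
      simp [Matrix.blockDiagonal'_apply]
      split_ifs <;> simp
    · simp only [Matrix.transpose_reindex, Matrix.blockDiagonal'_transpose, skewBlock_transpose]
      ext i j
      simp [Matrix.blockDiagonal'_apply]
      split_ifs <;> simp⟩

/-! ### Skew-symmetric matrix polynomials -/

/-- The space of `m × m` skew-symmetric matrix polynomials `∑ λ ^ i A_i` of grade `d`, given by
their coefficients `A_0, …, A_d`. -/
def SkewPoly (d m : ℕ) : Submodule ℂ (Fin (d + 1) → Matrix (Fin m) (Fin m) ℂ) where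
  carrier := {P | ∀ i, (P i).transpose = -P i}
  add_mem' := by
    intro P Q h1 h2 i
    simp [h1 i, h2 i, add_comm]
  zero_mem' := by intro i; simp
  smul_mem' := by
    intro c P h i
    simp [h i]

/-- The matrix over `ℂ[λ]` with given coefficients. -/
def polyMatrix {d m : ℕ} (P : Fin (d + 1) → Matrix (Fin m) (Fin m) ℂ) :
    Matrix (Fin m) (Fin m) ℂ[X] :=
  Matrix.of fun a b => ∑ i : Fin (d + 1), C (P i a b) * X ^ (i : ℕ)

/-- The reversal `λ ^ d P(1/λ)`. -/
def revMatrix {d m : ℕ} (P : Fin (d + 1) → Matrix (Fin m) (Fin m) ℂ) :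
    Matrix (Fin m) (Fin m) ℂ[X] :=
  polyMatrix fun i => P i.rev

/-- The matrix seen over the field of rational functions. -/
def ratMatrix {m : ℕ} (M : Matrix (Fin m) (Fin m) ℂ[X]) : Matrix (Fin m) (Fin m) (RatFunc ℂ) :=
  M.map (algebraMap ℂ[X] (RatFunc ℂ))

/-- The skew-symmetric Smith form
`[0, g₁; -g₁, 0] ⊕ ⋯ ⊕ [0, g_r; -g_r, 0] ⊕ 0_{m - 2r}`. -/
def skewSmithForm (m : ℕ) {r : ℕ} (g : Fin r → ℂ[X]) : Matrix (Fin m) (Fin m) ℂ[X] :=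
  Matrix.of fun a b => ∑ j : Fin r,
    if (a : ℕ) = 2 * j ∧ (b : ℕ) = 2 * j + 1 then g j
    else if (a : ℕ) = 2 * j + 1 ∧ (b : ℕ) = 2 * j then -g j
    else 0

/-- `g₁ ∣ ⋯ ∣ g_r` are the invariant polynomials of the skew-symmetric matrix polynomial `M`:
they are monic and `M` is unimodularly congruent to the Smith form which they define. -/
def IsInvariantPolys {m : ℕ} (M : Matrix (Fin m) (Fin m) ℂ[X]) {r : ℕ} (g : Fin r → ℂ[X]) :
    Prop :=
  2 * r ≤ m ∧ (∀ j, (g j).Monic) ∧ (∀ i j, i ≤ j → g i ∣ g j) ∧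
    ∃ F : Matrix (Fin m) (Fin m) ℂ[X], IsUnit F.det ∧ F.transpose * M * F = skewSmithForm m g

/-- The exponents of the elementary divisors `(λ - μ) ^ δ`, `δ > 0`, at `μ`, with repetitions. -/
def elemDivExponents {r : ℕ} (g : Fin r → ℂ[X]) (μ : ℂ) : Multiset ℕ :=
  (Finset.univ.val.map fun j => (g j).rootMultiplicity μ).filter fun δ => 0 < δ

/-- The degree of a vector polynomial. -/
def vecDegree {m : ℕ} (x : Fin m → ℂ[X]) : ℕ :=
  Finset.univ.sup fun a => (x a).natDegree

/-- The vector polynomials `x₁, …, x_k` form a basis of the subspace `V` of `ℂ(λ)^m`. -/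
def IsPolyBasis {m : ℕ} (V : Submodule (RatFunc ℂ) (Fin m → RatFunc ℂ)) {k : ℕ}
    (x : Fin k → Fin m → ℂ[X]) : Prop :=
  LinearIndependent (RatFunc ℂ) (fun i a => algebraMap ℂ[X] (RatFunc ℂ) (x i a)) ∧
    Submodule.span (RatFunc ℂ)
      (Set.range fun i a => algebraMap ℂ[X] (RatFunc ℂ) (x i a)) = V

/-- A polynomial basis is minimal if the sum of its degrees is minimal. -/
def IsMinimalBasis {m : ℕ} (V : Submodule (RatFunc ℂ) (Fin m → RatFunc ℂ)) {k : ℕ}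
    (x : Fin k → Fin m → ℂ[X]) : Prop :=
  IsPolyBasis V x ∧ ∀ y : Fin k → Fin m → ℂ[X], IsPolyBasis V y →
    ∑ i, vecDegree (x i) ≤ ∑ i, vecDegree (y i)

/-- The multiset `ε` consists of the minimal indices of `V`: the degrees of a minimal basis. -/
def HasMinimalIndices {m : ℕ} (V : Submodule (RatFunc ℂ) (Fin m → RatFunc ℂ))
    (ε : Multiset ℕ) : Prop :=
  ∃ (k : ℕ) (x : Fin k → Fin m → ℂ[X]),
    IsMinimalBasis V x ∧ ε = Finset.univ.val.map fun i => vecDegree (x i)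

/-- The left null-space `{y : yᵀ M = 0}` over `ℂ(λ)`. -/
def leftNullSpace {m : ℕ} (M : Matrix (Fin m) (Fin m) ℂ[X]) :
    Submodule (RatFunc ℂ) (Fin m → RatFunc ℂ) :=
  LinearMap.ker (ratMatrix M).vecMulLinear

/-- The right null-space `{x : M x = 0}` over `ℂ(λ)`. -/
def rightNullSpace {m : ℕ} (M : Matrix (Fin m) (Fin m) ℂ[X]) :
    Submodule (RatFunc ℂ) (Fin m → RatFunc ℂ) :=
  LinearMap.ker (ratMatrix M).mulVecLin

/-- Data of a complete eigenstructure: the exponents of the elementary divisors at every finite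
`μ` (the empty multiset if `μ` is not an eigenvalue), those at infinity, and the left and right
minimal indices. -/
structure Eigenstructure where
  finiteDivisors : ℂ → Multiset ℕ
  infiniteDivisors : Multiset ℕ
  leftIndices : Multiset ℕ
  rightIndices : Multiset ℕ

/-- `E` is the complete eigenstructure of the skew-symmetric matrix polynomial `P` of grade `d`. -/
def HasEigenstructure {d m : ℕ} (P : SkewPoly d m) (E : Eigenstructure) : Prop :=
  (∃ (r : ℕ) (g : Fin r → ℂ[X]), IsInvariantPolys (polyMatrix P.1) g ∧
    ∀ μ, E.finiteDivisors μ = elemDivExponents g μ) ∧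
  (∃ (r : ℕ) (g : Fin r → ℂ[X]), IsInvariantPolys (revMatrix P.1) g ∧
    E.infiniteDivisors = elemDivExponents g 0) ∧
  HasMinimalIndices (leftNullSpace (polyMatrix P.1)) E.leftIndices ∧
  HasMinimalIndices (rightNullSpace (polyMatrix P.1)) E.rightIndices

/-- The orbit of `P`: all skew-symmetric matrix polynomials of the same size and grade with the
same complete eigenstructure as `P`. -/
def polyOrbit {d m : ℕ} (P : SkewPoly d m) : Set (SkewPoly d m) :=
  {Q | ∃ E, HasEigenstructure P E ∧ HasEigenstructure Q E}

/-- The generic complete eigenstructure: no elementary divisors, left and right minimal indices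
`β + 1` (`t` times) and `β` (`m - 2r - t` times), where `β = ⌊rd / (m - 2r)⌋` and
`t = rd mod (m - 2r)`. -/
def genericEigenstructure (d m r : ℕ) : Eigenstructure where
  finiteDivisors := fun _ => 0
  infiniteDivisors := 0
  leftIndices :=
    Multiset.replicate (r * d % (m - 2 * r)) (r * d / (m - 2 * r) + 1) +
      Multiset.replicate (m - 2 * r - r * d % (m - 2 * r)) (r * d / (m - 2 * r))
  rightIndices :=
    Multiset.replicate (r * d % (m - 2 * r)) (r * d / (m - 2 * r) + 1) +
      Multiset.replicate (m - 2 * r - r * d % (m - 2 * r)) (r * d / (m - 2 * r))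

/-- `W` is a generic skew-symmetric matrix polynomial of grade `d` and rank `2r`: it has degree
exactly `d`, rank exactly `2r` and the generic complete eigenstructure. -/
def IsGenericPoly {d m : ℕ} (r : ℕ) (W : SkewPoly d m) : Prop :=
  W.1 (Fin.last d) ≠ 0 ∧ (ratMatrix (polyMatrix W.1)).rank = 2 * r ∧
    HasEigenstructure W (genericEigenstructure d m r)

/-- The set `S` is a complex submanifold of codimension `c` of the complex vector space `E`: near
each of its points it is the zero set of a holomorphic map to `ℂ^c` which is a submersion. -/
def IsSubmanifoldOfCodim {E : Type*} [NormedAddCommGroup E] [NormedSpace ℂ E]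
    (S : Set E) (c : ℕ) : Prop :=
  ∀ x ∈ S, ∃ (U : Set E) (g : E → Fin c → ℂ), IsOpen U ∧ x ∈ U ∧ AnalyticOnNhd ℂ g U ∧
    (∀ y ∈ U, Function.Surjective (fderiv ℂ g y)) ∧ S ∩ U = {y | y ∈ U ∧ g y = 0}

/-! ### The skew-symmetric linearization -/

/-- The `(a, b)` block of the leading coefficient of the linearization (indices from `0`). -/
def linLead {d m : ℕ} (P : Fin (d + 1) → Matrix (Fin m) (Fin m) ℂ) (a b : Fin d) :
    Matrix (Fin m) (Fin m) ℂ :=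
  if a = b then (if Even (a : ℕ) then P ⟨d - a, by omega⟩ else 0)
  else if (b : ℕ) = a + 1 then (if Even (a : ℕ) then 0 else -1)
  else if (a : ℕ) = b + 1 then (if Even (b : ℕ) then 0 else 1)
  else 0

/-- The `(a, b)` block of the constant coefficient of the linearization (indices from `0`). -/
def linConst {d m : ℕ} (P : Fin (d + 1) → Matrix (Fin m) (Fin m) ℂ) (a b : Fin d) :
    Matrix (Fin m) (Fin m) ℂ :=
  if a = b then (if Even (a : ℕ) then P ⟨d - a - 1, by omega⟩ else 0)
  else if (b : ℕ) = a + 1 then (if Even (a : ℕ) then -1 else 0)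
  else if (a : ℕ) = b + 1 then (if Even (b : ℕ) then 1 else 0)
  else 0

theorem linLead_transpose {d m : ℕ} (P : SkewPoly d m) (a b : Fin d) :
    (linLead P.1 b a).transpose = -linLead P.1 a b := by
  have hP := P.2
  unfold linLead
  by_cases h : a = b
  · subst h
    by_cases he : Even (a : ℕ)
    · simpa [he] using hP _
    · simp [he]
  · have h' : b ≠ a := fun e => h e.symm
    simp only [h, h', if_false]
    split_ifs <;> first | omega | simp

theorem linConst_transpose {d m : ℕ} (P : SkewPoly d m) (a b : Fin d) :
    (linConst P.1 b a).transpose = -linConst P.1 a b := by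
  have hP := P.2
  unfold linConst
  by_cases h : a = b
  · subst h
    by_cases he : Even (a : ℕ)
    · simpa [he] using hP _
    · simp [he]
  · have h' : b ≠ a := fun e => h e.symm
    simp only [h, h', if_false]
    split_ifs <;> first | omega | simp

/-- The skew-symmetric strong linearization of `P` (for odd `d`): the `md × md` pencil
`λ (linLead P) + linConst P`, with `d × d` blocks of size `m × m`. -/
def linearization {d m : ℕ} (P : SkewPoly d m) : SkewPencil (Fin d × Fin m) :=
  ⟨(Matrix.of fun p q => linLead P.1 p.1 q.1 p.2 q.2,
    -Matrix.of fun p q => linConst P.1 p.1 q.1 p.2 q.2), by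
    constructor
    · ext p q
      exact congrFun (congrFun (linLead_transpose P p.1 q.1) p.2) q.2
    · ext p q
      have := congrFun (congrFun (linConst_transpose P p.1 q.1) p.2) q.2
      simpa using congrArg (fun z : ℂ => -z) this⟩

end SkewGeneric

end

/-! Both codimensions count the same parameters: the coefficients of a skew-symmetric form on a
kernel with minimal indices `ε j`, the entry `(i, j)` being a polynomial of degree at most `d + ε i
+ ε j`.

Let `M` be skew-symmetric of grade `d` without elementary divisors, with minimal basis `x j` of its
kernel. Its rank is then constant on the projective line, infinity included, so `0 → ⊕ O(-ε j) → O^m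
→ O(d)^m → ⊕ O(d + ε j) → 0` is exact, the last map being `y ↦ (x j ⬝ᵥ y)`. `GoodKernel` records
this fibre by fibre; `exists_dotProduct_eq_of_mem_polyLT` and `exists_mulVec_eq_of_mem_polyLT` turn
it into statements about polynomials of bounded degree, in place of the vanishing of first
cohomology groups. `HasEigenstructure.goodKernel` and `GoodKernel.hasEigenstructure` translate
between this and eigenstructures.

Submanifold. Near a point `P` of the orbit the kernel basis extends to an analytic family `ξ Q`
(`exists_local_kernel`). Because the indices differ by at most one, `ξ Q` is a kernel basis of the
same type as soon as the skew matrix of the polynomials `ξ Q i ⬝ᵥ (Q *ᵥ ξ Q j)` vanishes. So the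
orbit is cut out by the `d + 1 + ε i + ε j` coefficients of each entry with `i < j`. Since `P` kills
`x`, the derivative at `P` in the direction `E` is `x i ⬝ᵥ (E *ᵥ x j)` (`hasFDerivAt_restriction`),
which takes all values (`exists_skew_restriction_eq`): the equations are a submersion. With `k = m -
2r` and `∑ ε j = rd` their number is `(k - 1)(k(d + 1) + 2rd) / 2 = c`.

Pencils. The normal space of a canonical pencil consists of the skew pairs `(C, D)` satisfying
linear shift relations. If the indices differ by at most one, these leave only Hankel blocks, with
`ε i + ε j + 2` free parameters for each pair `i < j` (`congCodim_canonicalPencil`): this is the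
same count for `d = 1`, and it gives (1).

Linearization. For `d = 2h + 1` the kernel of the linearization is parametrized by that of `W`, with
degrees raised by `h`. The coefficients of its basis vectors form singular chains, and
`SingularChains.congCodim_eq` completes these to a congruence with the canonical pencil of indices
`ε j + h`. The parameter count becomes `∑_{i<j} (2 + ε i + ε j + 2h)`, which is again `c`. -/

noncomputable section

namespace SkewGeneric

open Matrix

set_option linter.unusedSectionVars false

section

/-! ### Vector polynomials -/

/-- A submodule of a finite `ℂ[X]`-module which is everything modulo each `X - μ` is everything. -/
theorem eq_top_of_forall_X_sub_C {N : Type*} [AddCommGroup N] [Module ℂ[X] N]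
    [Module.Finite ℂ[X] N] (A : Submodule ℂ[X] N)
    (h : ∀ (μ : ℂ) (y : N), ∃ a ∈ A, ∃ z : N, y = a + (X - C μ) • z) : A = ⊤ := by
  by_contra hA
  obtain ⟨B, hB, hAB⟩ := (eq_top_or_exists_le_coatom A).resolve_left hA
  obtain ⟨I, hI, ⟨e⟩⟩ := isSimpleModule_iff_quot_maximal.1 (isSimpleModule_iff_isCoatom.2 hB)
  -- The simple quotient by the coatom is `ℂ[X] / I` with `I` maximal. As `ℂ[X]` is not a field, `I`
  -- is nonzero, and its irreducible generator has a root `μ`. Hence `X - μ` annihilates the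
  -- quotient.
  obtain ⟨μ, hμ⟩ : ∃ μ : ℂ, X - C μ ∈ I := by
    have hne : I ≠ ⊥ := by
      rintro rfl
      exact Polynomial.not_isField ℂ (Ring.isField_iff_maximal_bot.2 hI)
    have hp := (Submodule.IsPrincipal.prime_generator_of_isPrime I hne).irreducible
    obtain ⟨μ, hμ⟩ := IsAlgClosed.exists_root _
      (by rw [IsAlgClosed.degree_eq_one_of_irreducible ℂ hp]; exact one_ne_zero)
    refine ⟨μ, ?_⟩
    have hdvd := dvd_iff_isRoot.2 hμ
    have := ((Irreducible.dvd_iff hp).1 hdvd).resolve_left (irreducible_X_sub_C μ).not_isUnit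
    rw [Submodule.IsPrincipal.mem_iff_generator_dvd]
    exact this.dvd
  have key : ∀ z : N, (X - C μ) • z ∈ B := by
    intro z
    rw [← Submodule.Quotient.mk_eq_zero, Submodule.Quotient.mk_smul]
    apply e.injective
    rw [map_smul, map_zero]
    obtain ⟨q, hq⟩ := Ideal.Quotient.mk_surjective (e (Submodule.Quotient.mk z))
    rw [← hq, ← Ideal.Quotient.mk_eq_mk, ← Submodule.Quotient.mk_smul,
      Submodule.Quotient.mk_eq_zero, smul_eq_mul]
    exact I.mul_mem_right _ hμ
  apply hB.1
  rw [eq_top_iff]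
  intro y _
  obtain ⟨a, ha, z, rfl⟩ := h μ y
  exact B.add_mem (hAB ha) (key z)

variable {ι κ : Type} [Fintype ι] [Fintype κ]

/-- The vector polynomials whose `a`-th entry has degree less than `n a`. -/
def polyLT (n : ι → ℕ) : Submodule ℂ (ι → ℂ[X]) where
  carrier := {y | ∀ a s, n a ≤ s → (y a).coeff s = 0}
  add_mem' := by
    intro y z hy hz a s hs
    simp [hy a s hs, hz a s hs]
  zero_mem' := by intro a s _; simp
  smul_mem' := by
    intro c y hy a s hs
    simp [hy a s hs]

theorem exists_mem_polyLT_const (y : ι → ℂ[X]) : ∃ N : ℕ, y ∈ polyLT (fun _ : ι => N) := by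
  refine ⟨(Finset.univ.sup fun a => (y a).natDegree) + 1, fun a s hs => ?_⟩
  apply coeff_eq_zero_of_natDegree_lt
  have := Finset.le_sup (f := fun a => (y a).natDegree) (Finset.mem_univ a)
  exact this.trans_lt (Nat.lt_of_succ_le hs)

theorem coeff_eq_zero_of_natDegree_le {f : ℂ[X]} {n s : ℕ} (h : f.natDegree ≤ n) (hs : n < s) :
    f.coeff s = 0 := coeff_eq_zero_of_natDegree_lt (h.trans_lt hs)

theorem natDegree_le_of_mem_polyLT {n : ℕ} {y : ι → ℂ[X]}
    (hy : y ∈ polyLT (fun _ : ι => n + 1)) (a : ι) : (y a).natDegree ≤ n :=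
  natDegree_le_iff_coeff_eq_zero.2 fun s hs => hy a s hs

theorem coeff_mul_add {f g : ℂ[X]} {m n : ℕ} (hf : f.natDegree ≤ m) (hg : g.natDegree ≤ n) :
    (f * g).coeff (m + n) = f.coeff m * g.coeff n :=
  coeff_mul_add_eq_of_natDegree_le hf hg

theorem coeff_mul_eq_zero {f g : ℂ[X]} {m n s : ℕ} (hf : f.natDegree ≤ m)
    (hg : ∀ s, n ≤ s → g.coeff s = 0) (hs : m + n ≤ s) : (f * g).coeff s = 0 := by
  rw [coeff_mul]
  refine Finset.sum_eq_zero fun p hp => ?_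
  rw [Finset.HasAntidiagonal.mem_antidiagonal] at hp
  by_cases h : n ≤ p.2
  · rw [hg _ h, mul_zero]
  · rw [coeff_eq_zero_of_natDegree_le hf (by omega), zero_mul]

/-- The value of a matrix polynomial at a point. -/
def evalMatrix (M : Matrix ι ι ℂ[X]) (μ : ℂ) : Matrix ι ι ℂ := M.map (eval μ)

/-- The matrix of the coefficients of `X ^ s`. -/
def coeffMatrix (M : Matrix ι ι ℂ[X]) (s : ℕ) : Matrix ι ι ℂ := M.map fun p => p.coeff s

theorem eval_mulVec (M : Matrix ι ι ℂ[X]) (y : ι → ℂ[X]) (μ : ℂ) :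
    (fun a => ((M *ᵥ y) a).eval μ) = evalMatrix M μ *ᵥ fun a => (y a).eval μ := by
  ext a
  simp [mulVec, dotProduct, evalMatrix, eval_finsetSum]

theorem eval_dotProduct (x y : ι → ℂ[X]) (μ : ℂ) :
    (x ⬝ᵥ y).eval μ = (fun a => (x a).eval μ) ⬝ᵥ fun a => (y a).eval μ := by
  simp [dotProduct, eval_finsetSum]

/-- `x` is a basis of the kernel of the skew-symmetric matrix polynomial `M` of grade `d` which is
a basis of the kernel at each finite point and at infinity. -/
structure GoodKernel (M : Matrix ι ι ℂ[X]) (d : ℕ) (ε : κ → ℕ) (x : κ → ι → ℂ[X]) : Prop where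
  skew : Mᵀ = -M
  deg : ∀ a b, (M a b).natDegree ≤ d
  ker : ∀ j, M *ᵥ x j = 0
  deg_basis : ∀ j a, (x j a).natDegree ≤ ε j
  indep_eval : ∀ μ : ℂ, LinearIndependent ℂ fun j a => (x j a).eval μ
  indep_lead : LinearIndependent ℂ fun j a => (x j a).coeff (ε j)
  exact_eval : ∀ (μ : ℂ) (v : ι → ℂ), (∀ j, (fun a => (x j a).eval μ) ⬝ᵥ v = 0) →
    ∃ u, evalMatrix M μ *ᵥ u = v
  exact_lead : ∀ v : ι → ℂ, (∀ j, (fun a => (x j a).coeff (ε j)) ⬝ᵥ v = 0) →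
    ∃ u, coeffMatrix M d *ᵥ u = v

/-- Linearly independent vectors have a dual family. -/
theorem exists_dual_family [DecidableEq κ] {v : κ → ι → ℂ} (hv : LinearIndependent ℂ v) :
    ∃ w : κ → ι → ℂ, ∀ i j, v i ⬝ᵥ w j = if i = j then 1 else 0 := by
  have : ∀ j, ∃ w : ι → ℂ, ∀ i, v i ⬝ᵥ w = if i = j then 1 else 0 := by
    intro j
    obtain ⟨f, hf⟩ := LinearMap.exists_leftInverse_of_injective (Fintype.linearCombination ℂ v)
      (LinearMap.ker_eq_bot'.2 fun c hc => funext (Fintype.linearIndependent_iff.1 hv c hc))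
    classical
    refine ⟨fun a => f (Pi.single a 1) j, fun i => ?_⟩
    have h1 := congrArg (fun g => g j) (LinearMap.congr_fun hf (Pi.single i 1))
    simp only [LinearMap.comp_apply, Fintype.linearCombination_apply_single, one_smul,
      LinearMap.id_apply] at h1
    have h2 : v i = ∑ a, v i a • (Pi.single a (1 : ℂ) : ι → ℂ) := by
      ext b; simp [Finset.sum_apply, Pi.single_apply]
    rw [h2] at h1
    simp only [map_sum, map_smul, Finset.sum_apply, Pi.smul_apply, smul_eq_mul] at h1
    simp only [dotProduct, h1]
    simp [Pi.single_apply, eq_comm]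
  choose w hw using this
  exact ⟨w, fun i j => hw j i⟩

theorem exists_dotProduct_eq {v : κ → ι → ℂ} (hv : LinearIndependent ℂ v) (c : κ → ℂ) :
    ∃ w : ι → ℂ, ∀ i, v i ⬝ᵥ w = c i := by
  classical
  obtain ⟨w, hw⟩ := exists_dual_family hv
  refine ⟨∑ j, c j • w j, fun i => ?_⟩
  simp [dotProduct_sum, hw]

/-- A vector polynomial vanishing at `μ` is divisible by `X - μ`. -/
theorem exists_eq_X_sub_C_smul {y : ι → ℂ[X]} {μ : ℂ} (h : ∀ a, (y a).eval μ = 0) :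
    ∃ z : ι → ℂ[X], y = (X - C μ) • z := by
  have : ∀ a, ∃ z, y a = (X - C μ) * z := fun a => dvd_iff_isRoot.2 (h a)
  choose z hz using this
  exact ⟨z, funext hz⟩

/-- At each `μ` a constant vector realizes the prescribed values, so the pairing map is onto modulo
`X - μ`; by `eq_top_of_forall_X_sub_C` it is onto. -/
theorem exists_dotProduct_poly_eq {x : κ → ι → ℂ[X]}
    (hx : ∀ μ : ℂ, LinearIndependent ℂ fun j a => (x j a).eval μ) (p : κ → ℂ[X]) :
    ∃ y : ι → ℂ[X], ∀ j, x j ⬝ᵥ y = p j := by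
  have htop := eq_top_of_forall_X_sub_C (LinearMap.range (Matrix.mulVecLin (Matrix.of x)))
    (by
      intro μ q
      obtain ⟨w, hw⟩ := exists_dotProduct_eq (hx μ) fun j => (q j).eval μ
      refine ⟨_, ⟨fun a => C (w a), rfl⟩, ?_⟩
      have : ∀ j, ((q - Matrix.mulVecLin (Matrix.of x) fun a => C (w a)) j).eval μ = 0 := by
        intro j
        have h := hw j
        simp only [dotProduct] at h
        simp [mulVec, dotProduct, eval_finsetSum, h]
      obtain ⟨z, hz⟩ := exists_eq_X_sub_C_smul this
      exact ⟨z, by rw [← hz]; abel⟩)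
  have : p ∈ LinearMap.range (Matrix.mulVecLin (Matrix.of x)) := htop ▸ Submodule.mem_top
  obtain ⟨y, hy⟩ := this
  exact ⟨y, fun j => congrFun hy j⟩

theorem exists_leftInverse_basis [DecidableEq κ] {x : κ → ι → ℂ[X]}
    (hx : ∀ μ : ℂ, LinearIndependent ℂ fun j a => (x j a).eval μ) :
    ∃ y : κ → ι → ℂ[X], ∀ i j, y i ⬝ᵥ x j = if i = j then 1 else 0 := by
  have := fun i => exists_dotProduct_poly_eq hx (fun j => if i = j then 1 else 0)
  choose y hy using this
  exact ⟨y, fun i j => by rw [dotProduct_comm]; exact hy i j⟩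

theorem dotProduct_mulVec_skew {R : Type*} [CommRing R] {M : Matrix ι ι R} (h : Mᵀ = -M)
    (x y : ι → R) : x ⬝ᵥ (M *ᵥ y) = -((M *ᵥ x) ⬝ᵥ y) := by
  rw [dotProduct_mulVec, ← mulVec_transpose, h, neg_mulVec, neg_dotProduct]

theorem sum_smul_dotProduct {R : Type*} [CommRing R] (u : κ → R) (x : κ → ι → R) (y : ι → R) :
    (∑ j, u j • x j) ⬝ᵥ y = ∑ j, u j * (x j ⬝ᵥ y) := by
  simp [sum_dotProduct]

/-- If the leading vectors are independent, the degree of a combination is predictable. -/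
theorem coeff_eq_zero_of_sum_smul {ε : κ → ℕ} {x : κ → ι → ℂ[X]}
    (hdeg : ∀ j a, (x j a).natDegree ≤ ε j)
    (hlead : LinearIndependent ℂ fun j a => (x j a).coeff (ε j)) (u : κ → ℂ[X]) (N : ℕ)
    (h : ∀ a s, N ≤ s → ((∑ j, u j • x j) a).coeff s = 0) (j : κ) (s : ℕ) (hs : N ≤ s + ε j) :
    (u j).coeff s = 0 := by
  -- Descending induction on the weighted degree `s + ε j`: once all coefficients of weight above `T
  -- + e` vanish, the coefficient of `X ^ (T + e)` in the combination is a linear relation between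
  -- the leading vectors, so the coefficients of that weight vanish too.
  have main : ∀ (e T : ℕ), N ≤ T → (∀ j s, T + e ≤ s + ε j → (u j).coeff s = 0) →
      ∀ j s, T ≤ s + ε j → (u j).coeff s = 0 := by
    intro e
    induction e with
    | zero => intro T _ h; exact h
    | succ e ih =>
      intro T hT hu
      refine ih T hT fun j s hs => ?_
      rcases hs.lt_or_eq with hs | hs
      · exact hu j s (by omega)
      · have hc : ∀ i, ((if ε i ≤ T + e then (u i).coeff (T + e - ε i) else 0) : ℂ) = 0 := by
          refine Fintype.linearIndependent_iff.1 hlead _ ?_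
          ext a
          have h0 := h a (T + e) (by omega)
          rw [Finset.sum_apply, finsetSum_coeff] at h0
          rw [Finset.sum_apply, Pi.zero_apply]
          refine Eq.trans (Finset.sum_congr rfl fun i _ => ?_) h0
          simp only [Pi.smul_apply, smul_eq_mul]
          split_ifs with hi
          · have hui : (u i).natDegree ≤ T + e - ε i :=
              natDegree_le_iff_coeff_eq_zero.2 fun s hs => hu i s (by omega)
            have := coeff_mul_add hui (hdeg i a)
            rw [Nat.sub_add_cancel hi] at this
            exact this.symm
          · have : u i = 0 := by
              ext s; exact hu i s (by omega)
            simp [this]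
        have := hc j
        rw [if_pos (by omega)] at this
        rwa [show s = T + e - ε j by omega]
  obtain ⟨B, hB⟩ := exists_mem_polyLT_const u
  refine main (B + ∑ i, ε i) N le_rfl (fun i s hs => hB i s ?_) j s hs
  have := Finset.single_le_sum (f := ε) (fun _ _ => Nat.zero_le _) (Finset.mem_univ i)
  change B ≤ s
  omega

/-! ### Exactness over the polynomial ring and in bounded degree -/

namespace GoodKernel

variable {M : Matrix ι ι ℂ[X]} {d : ℕ} {ε : κ → ℕ} {x : κ → ι → ℂ[X]}

theorem dotProduct_mulVec_eq_zero (h : GoodKernel M d ε x) (j : κ) (y : ι → ℂ[X]) :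
    x j ⬝ᵥ (M *ᵥ y) = 0 := by
  rw [dotProduct_mulVec_skew h.skew, h.ker, zero_dotProduct, neg_zero]

/-- `eq_top_of_forall_X_sub_C` is applied inside the orthogonal complement of the basis. Exactness
at `μ` makes an orthogonal `z` congruent to an image modulo `X - μ`, and the quotient of the
difference is again orthogonal because `ℂ[X]` has no zero divisors. -/
theorem exists_mulVec_eq (h : GoodKernel M d ε x) {y : ι → ℂ[X]} (hy : ∀ j, x j ⬝ᵥ y = 0) :
    ∃ v, M *ᵥ v = y := by
  let H : Submodule ℂ[X] (ι → ℂ[X]) := LinearMap.ker (Matrix.mulVecLin (Matrix.of x))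
  have hH : ∀ z : ι → ℂ[X], z ∈ H ↔ ∀ j, x j ⬝ᵥ z = 0 := by
    intro z
    simp only [H, LinearMap.mem_ker, mulVecLin_apply, funext_iff]
    rfl
  have htop := eq_top_of_forall_X_sub_C ((LinearMap.range (Matrix.mulVecLin M)).comap H.subtype)
    (by
      rintro μ ⟨z, hz⟩
      rw [hH] at hz
      obtain ⟨u, hu⟩ := h.exact_eval μ (fun a => (z a).eval μ) fun j => by
        rw [← eval_dotProduct, hz, eval_zero]
      have h0 : ∀ a, ((z - M *ᵥ fun a => C (u a)) a).eval μ = 0 := by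
        intro a
        have h1 := congrFun (eval_mulVec M (fun a => C (u a)) μ) a
        simp only [eval_C] at h1
        rw [hu] at h1
        simp [h1]
      obtain ⟨t, ht⟩ := exists_eq_X_sub_C_smul h0
      have hM : (M *ᵥ fun a => C (u a)) ∈ H := (hH _).2 fun j => h.dotProduct_mulVec_eq_zero j _
      refine ⟨⟨_, hM⟩, ⟨_, rfl⟩, ⟨t, (hH _).2 fun j => ?_⟩, ?_⟩
      · have h2 : x j ⬝ᵥ ((X - C μ) • t) = 0 := by
          rw [← ht, dotProduct_sub, hz, h.dotProduct_mulVec_eq_zero, sub_zero]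
        rw [dotProduct_smul, smul_eq_mul] at h2
        exact (mul_eq_zero.1 h2).resolve_left (X_sub_C_ne_zero μ)
      · apply Subtype.ext
        change z = (M *ᵥ fun a => C (u a)) + (X - C μ) • t
        rw [← ht]; abel)
  have hy' : (⟨y, (hH y).2 hy⟩ : H) ∈ (LinearMap.range (Matrix.mulVecLin M)).comap H.subtype :=
    htop ▸ Submodule.mem_top
  obtain ⟨v, hv⟩ := hy'
  exact ⟨v, hv⟩

/-- The range of `M(μ)` contains the orthogonal complement of `card κ` vectors, so its codimension
is at most `card κ`. -/
theorem finrank_ker_eval_le (h : GoodKernel M d ε x) (μ : ℂ) :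
    Module.finrank ℂ (LinearMap.ker (evalMatrix M μ).mulVecLin) ≤ Fintype.card κ := by
  let f := Matrix.mulVecLin (Matrix.of fun j a => (x j a).eval μ)
  have h1 : LinearMap.ker f ≤ LinearMap.range (evalMatrix M μ).mulVecLin := by
    intro v hv
    obtain ⟨u, hu⟩ := h.exact_eval μ v fun j => congrFun (LinearMap.mem_ker.1 hv) j
    exact ⟨u, hu⟩
  have h2 := Submodule.finrank_mono h1
  have h3 := f.finrank_range_add_finrank_ker
  have h4 := (evalMatrix M μ).mulVecLin.finrank_range_add_finrank_ker
  have h5 := (LinearMap.range f).finrank_le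
  rw [Module.finrank_fintype_fun_eq_card] at h5
  omega

/-- At each `μ` the independent vectors `x j (μ)` fill the kernel of `M(μ)`, whose dimension is at
most their number. The local-to-global criterion, applied inside the kernel module, then gives
polynomial coefficients. -/
theorem exists_eq_sum_smul (h : GoodKernel M d ε x) {y : ι → ℂ[X]} (hy : M *ᵥ y = 0) :
    ∃ u : κ → ℂ[X], y = ∑ j, u j • x j := by
  let H : Submodule ℂ[X] (ι → ℂ[X]) := LinearMap.ker (Matrix.mulVecLin M)
  have hx : ∀ j, x j ∈ H := h.ker
  have htop := eq_top_of_forall_X_sub_C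
    ((LinearMap.range (Fintype.linearCombination ℂ[X] x)).comap H.subtype)
    (by
      rintro μ ⟨z, hz⟩
      have hz' : M *ᵥ z = 0 := hz
      have hspan : Submodule.span ℂ (Set.range fun j a => (x j a).eval μ) =
          LinearMap.ker (evalMatrix M μ).mulVecLin := by
        apply Submodule.eq_of_le_of_finrank_le
        · rw [Submodule.span_le]
          rintro _ ⟨j, rfl⟩
          simp only [SetLike.mem_coe, LinearMap.mem_ker, mulVecLin_apply]
          rw [← eval_mulVec, h.ker]
          simp; rfl
        · rw [finrank_span_eq_card (h.indep_eval μ)]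
          exact h.finrank_ker_eval_le μ
      have hmem : (fun a => (z a).eval μ) ∈
          Submodule.span ℂ (Set.range fun j a => (x j a).eval μ) := by
        rw [hspan, LinearMap.mem_ker, mulVecLin_apply, ← eval_mulVec, hz']
        simp; rfl
      obtain ⟨c, hc⟩ := (Submodule.mem_span_range_iff_exists_fun ℂ).1 hmem
      have h0 : ∀ a, ((z - ∑ j, C (c j) • x j) a).eval μ = 0 := by
        intro a
        have := congrFun hc a
        simp only [Finset.sum_apply, Pi.smul_apply, smul_eq_mul] at this
        simp [eval_finsetSum, ← this]
      obtain ⟨t, ht⟩ := exists_eq_X_sub_C_smul h0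
      have hs : (∑ j, C (c j) • x j) ∈ H :=
        Submodule.sum_mem _ fun j _ => H.smul_mem _ (hx j)
      refine ⟨⟨_, hs⟩, ⟨fun j => C (c j), rfl⟩, ⟨t, ?_⟩, ?_⟩
      · have h2 : M *ᵥ ((X - C μ) • t) = 0 := by
          rw [← ht, mulVec_sub, hz', show M *ᵥ (∑ j, C (c j) • x j) = 0 from hs, sub_zero]
        rw [mulVec_smul] at h2
        exact (smul_eq_zero.1 h2).resolve_left (X_sub_C_ne_zero μ)
      · apply Subtype.ext
        change z = (∑ j, C (c j) • x j) + (X - C μ) • t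
        rw [← ht]; abel)
  have hy' : (⟨y, hy⟩ : H) ∈
      (LinearMap.range (Fintype.linearCombination ℂ[X] x)).comap H.subtype :=
    htop ▸ Submodule.mem_top
  obtain ⟨u, hu⟩ := hy'
  exact ⟨u, hu.symm⟩

/-- The coefficients of a combination of an everywhere independent family are unique. -/
theorem eq_zero_of_sum_smul_eq_zero (h : GoodKernel M d ε x) {u : κ → ℂ[X]}
    (hu : ∑ j, u j • x j = 0) : u = 0 := by
  funext j
  ext s
  exact coeff_eq_zero_of_sum_smul h.deg_basis h.indep_lead u 0
    (fun a s _ => by rw [hu]; simp) j s (Nat.zero_le _)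

/-- The coefficient of `X ^ (d + e)` of `M v` if `v` has degree at most `e`. -/
theorem coeff_mulVec (h : GoodKernel M d ε x) {v : ι → ℂ[X]} {e : ℕ}
    (hv : v ∈ polyLT (fun _ : ι => e + 1)) :
    (fun a => ((M *ᵥ v) a).coeff (d + e)) = coeffMatrix M d *ᵥ fun a => (v a).coeff e := by
  ext a
  simp only [mulVec, dotProduct, finsetSum_coeff, coeffMatrix, map_apply]
  exact Finset.sum_congr rfl fun b _ =>
    coeff_mul_add (h.deg a b) (natDegree_le_of_mem_polyLT hv b)

theorem mulVec_mem_polyLT (h : GoodKernel M d ε x) {v : ι → ℂ[X]} {n : ℕ}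
    (hv : v ∈ polyLT (fun _ : ι => n)) : M *ᵥ v ∈ polyLT (fun _ : ι => d + n) := by
  intro a s hs
  simp only [mulVec, dotProduct, finsetSum_coeff]
  exact Finset.sum_eq_zero fun b _ => coeff_mul_eq_zero (h.deg a b) (hv b) hs

theorem X_pow_smul_mem_polyLT {y : ι → ℂ[X]} {n e : ℕ} (hy : y ∈ polyLT (fun _ : ι => n)) :
    ((X : ℂ[X]) ^ e • y) ∈ polyLT (fun _ : ι => n + e) := by
  intro a s hs
  simp only [Pi.smul_apply, smul_eq_mul, coeff_X_pow_mul']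
  split_ifs with h
  · exact hy a _ (Nat.le_sub_of_add_le hs)
  · rfl

theorem C_mem_polyLT (u : ι → ℂ) : (fun a => C (u a)) ∈ polyLT (fun _ : ι => 1) := by
  intro a s hs
  rw [coeff_C, if_neg (Nat.pos_iff_ne_zero.1 hs)]

/-- Every family of polynomials of degrees less than `N + ε j` is of the form `x j ⬝ᵥ y` with
`y` of degree less than `N`. -/
theorem exists_dotProduct_eq_of_mem_polyLT (h : GoodKernel M d ε x) {N : ℕ} (hN : d ≤ N)
    {p : κ → ℂ[X]} (hp : p ∈ polyLT fun j => N + ε j) :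
    ∃ y ∈ polyLT (fun _ : ι => N), ∀ j, x j ⬝ᵥ y = p j := by
  have main : ∀ (e : ℕ) (y : ι → ℂ[X]), y ∈ polyLT (fun _ : ι => N + e) →
      (∀ j, x j ⬝ᵥ y = p j) → ∃ y ∈ polyLT (fun _ : ι => N), ∀ j, x j ⬝ᵥ y = p j := by
    intro e
    induction e with
    | zero => intro y hy h; exact ⟨y, hy, h⟩
    | succ e ih =>
      intro y hy hyp
      -- The degree bound on `p j` makes the top coefficient of `y` orthogonal to the leading
      -- vectors, so exactness at infinity writes it as `M_d u`. Subtracting `X ^ (N + e - d) • M u`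
      -- lowers the degree and leaves all pairings with `x` unchanged; this needs `d ≤ N`.
      obtain ⟨u, hu⟩ := h.exact_lead (fun a => (y a).coeff (N + e)) fun j => by
        have h1 := hp j (ε j + (N + e)) (by simp only; omega)
        rw [← hyp j] at h1
        simp only [dotProduct, finsetSum_coeff] at h1 ⊢
        rw [← h1]
        exact Finset.sum_congr rfl fun a _ =>
          (coeff_mul_add (h.deg_basis j a) (natDegree_le_of_mem_polyLT hy a)).symm
      refine ih (y - (X : ℂ[X]) ^ (N + e - d) • (M *ᵥ fun a => C (u a))) ?_ fun j => ?_
      · intro a s hs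
        rcases Nat.lt_or_ge (N + e) s with hs' | hs'
        · refine (Submodule.sub_mem _ hy ?_) a s hs'
          have := X_pow_smul_mem_polyLT (e := N + e - d) (h.mulVec_mem_polyLT (C_mem_polyLT u))
          rwa [show d + 1 + (N + e - d) = N + (e + 1) by omega] at this
        · obtain rfl : s = N + e := le_antisymm hs' hs
          have h2 := congrFun (h.coeff_mulVec (e := 0) (C_mem_polyLT u)) a
          simp only [add_zero, coeff_C_zero] at h2
          rw [hu] at h2
          simp only [Pi.sub_apply, Pi.smul_apply, smul_eq_mul, coeff_sub, coeff_X_pow_mul']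
          rw [if_pos (by omega), show N + e - (N + e - d) = d by omega, h2, sub_self]
      · rw [dotProduct_sub, dotProduct_smul, h.dotProduct_mulVec_eq_zero, smul_zero, sub_zero, hyp]
  obtain ⟨y, hy⟩ := exists_dotProduct_poly_eq h.indep_eval p
  obtain ⟨e, he⟩ := exists_mem_polyLT_const y
  exact main e y (fun a s hs => he a s (by simp only at hs ⊢; omega)) hy

/-- A vector polynomial of degree less than `d + N` which is orthogonal to the kernel is the image
of one of degree less than `N`, if `N` is at least the minimal indices. -/
theorem exists_mulVec_eq_of_mem_polyLT (h : GoodKernel M d ε x) {N : ℕ} (hN : ∀ j, ε j ≤ N)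
    {y : ι → ℂ[X]} (hy : y ∈ polyLT (fun _ : ι => d + N)) (hxy : ∀ j, x j ⬝ᵥ y = 0) :
    ∃ v ∈ polyLT (fun _ : ι => N), M *ᵥ v = y := by
  have main : ∀ (e : ℕ) (v : ι → ℂ[X]), v ∈ polyLT (fun _ : ι => N + e) →
      M *ᵥ v = y → ∃ v ∈ polyLT (fun _ : ι => N), M *ᵥ v = y := by
    intro e
    induction e with
    | zero => intro v hv h; exact ⟨v, hv, h⟩
    | succ e ih =>
      intro v hv hvy
      have h1 := h.coeff_mulVec (e := N + e) hv
      rw [hvy] at h1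
      have h2 : coeffMatrix M d *ᵥ (fun a => (v a).coeff (N + e)) = 0 := by
        rw [← h1]; ext a; exact hy a _ (by simp only; omega)
      -- The top coefficient of `v` lies in the kernel of `M_d`, which the leading vectors span by a
      -- dimension count. It is removed by subtracting multiples `X ^ (N + e - ε j) • x j`, which
      -- exist because `ε j ≤ N`.
      obtain ⟨c, hc⟩ : ∃ c : κ → ℂ, ∑ j, c j • (fun a => (x j a).coeff (ε j)) =
          fun a => (v a).coeff (N + e) := by
        rw [← Submodule.mem_span_range_iff_exists_fun]
        have hspan : Submodule.span ℂ (Set.range fun j a => (x j a).coeff (ε j)) =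
            LinearMap.ker (coeffMatrix M d).mulVecLin := by
          apply Submodule.eq_of_le_of_finrank_le
          · rw [Submodule.span_le]
            rintro _ ⟨j, rfl⟩
            simp only [SetLike.mem_coe, LinearMap.mem_ker, mulVecLin_apply]
            rw [← h.coeff_mulVec (e := ε j), h.ker]
            · simp; rfl
            · exact fun a s hs => coeff_eq_zero_of_natDegree_le (h.deg_basis j a) hs
          · rw [finrank_span_eq_card h.indep_lead]
            let f := Matrix.mulVecLin (Matrix.of fun j a => (x j a).coeff (ε j))
            have h1 : LinearMap.ker f ≤ LinearMap.range (coeffMatrix M d).mulVecLin := by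
              intro v hv
              obtain ⟨u, hu⟩ := h.exact_lead v fun j => congrFun (LinearMap.mem_ker.1 hv) j
              exact ⟨u, hu⟩
            have h2 := Submodule.finrank_mono h1
            have h3 := f.finrank_range_add_finrank_ker
            have h4 := (coeffMatrix M d).mulVecLin.finrank_range_add_finrank_ker
            have h5 := (LinearMap.range f).finrank_le
            rw [Module.finrank_fintype_fun_eq_card] at h5
            omega
        rw [hspan]
        exact h2
      refine ih (v - ∑ j, (C (c j) * X ^ (N + e - ε j)) • x j) ?_ ?_
      · have hle : ∀ j, ε j ≤ N + e := fun j => (hN j).trans (Nat.le_add_right _ _)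
        intro a s hs
        simp only [Pi.sub_apply, Finset.sum_apply, Pi.smul_apply, smul_eq_mul, coeff_sub,
          finsetSum_coeff, mul_assoc, coeff_C_mul, coeff_X_pow_mul']
        rcases Nat.lt_or_ge (N + e) s with hs' | hs'
        · rw [hv a s hs', Finset.sum_eq_zero, sub_zero]
          intro j _
          rw [if_pos (by have := hle j; omega),
            coeff_eq_zero_of_natDegree_le (h.deg_basis j a) (by have := hle j; omega), mul_zero]
        · obtain rfl : s = N + e := le_antisymm hs' hs
          have h3 := congrFun hc a
          simp only [Finset.sum_apply, Pi.smul_apply, smul_eq_mul] at h3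
          rw [← h3, sub_eq_zero]
          refine Finset.sum_congr rfl fun j _ => ?_
          rw [if_pos (by omega), show N + e - (N + e - ε j) = ε j by have := hle j; omega]
      · rw [mulVec_sub, mulVec_sum]
        simp [mulVec_smul, h.ker, hvy]
  obtain ⟨v, hv⟩ := h.exists_mulVec_eq hxy
  obtain ⟨e, he⟩ := exists_mem_polyLT_const v
  exact main e v (fun a s hs => he a s (by simp only at hs ⊢; omega)) hv

end GoodKernel

end

/-! ### Dimensions of bounded-degree kernels and restriction of forms to the kernel -/

section

variable {ι κ : Type} [Fintype ι] [Fintype κ]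

/-- The coefficients of a vector polynomial. -/
def vecCoeff (n : ι → ℕ) : (ι → ℂ[X]) →ₗ[ℂ] ((Σ a, Fin (n a)) → ℂ) where
  toFun y p := (y p.1).coeff p.2
  map_add' y z := by ext p; simp
  map_smul' c y := by ext p; simp

/-- A vector polynomial of bounded degree is given by its coefficients. -/
def polyLTEquiv (n : ι → ℕ) : polyLT n ≃ₗ[ℂ] ((Σ a, Fin (n a)) → ℂ) :=
  LinearEquiv.ofBijective ((vecCoeff n).comp (polyLT n).subtype) (by
    constructor
    · rw [injective_iff_map_eq_zero]
      rintro ⟨y, hy⟩ h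
      apply Subtype.ext
      funext a
      ext s
      by_cases hs : s < n a
      · exact congrFun h ⟨a, ⟨s, hs⟩⟩
      · exact hy a s (not_lt.1 hs)
    · intro c
      refine ⟨⟨fun a => ∑ s : Fin (n a), monomial (s : ℕ) (c ⟨a, s⟩), fun a s hs => ?_⟩, ?_⟩
      · rw [finsetSum_coeff]
        refine Finset.sum_eq_zero fun t _ => ?_
        rw [coeff_monomial, if_neg (by have := t.2; omega)]
      · ext ⟨a, s⟩
        simp only [LinearMap.comp_apply, Submodule.subtype_apply, vecCoeff, LinearMap.coe_mk,
          AddHom.coe_mk, finsetSum_coeff, coeff_monomial]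
        rw [Finset.sum_eq_single s]
        · simp
        · intro b _ hb
          rw [if_neg (fun h => hb (Fin.ext h))]
        · simp)

instance (n : ι → ℕ) : FiniteDimensional ℂ (polyLT n) :=
  Module.Finite.equiv (polyLTEquiv n).symm

theorem finrank_polyLT (n : ι → ℕ) : Module.finrank ℂ (polyLT n) = ∑ a, n a := by
  rw [(polyLTEquiv n).finrank_eq, Module.finrank_fintype_fun_eq_card, Fintype.card_sigma]
  simp

/-- The vector polynomials of degree less than `n` in the kernel of `M`. -/
def kerLT (M : Matrix ι ι ℂ[X]) (n : ℕ) : Submodule ℂ (ι → ℂ[X]) :=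
  polyLT (fun _ => n) ⊓ (LinearMap.ker M.mulVecLin).restrictScalars ℂ

theorem mem_kerLT {M : Matrix ι ι ℂ[X]} {n : ℕ} {y : ι → ℂ[X]} :
    y ∈ kerLT M n ↔ y ∈ polyLT (fun _ : ι => n) ∧ M *ᵥ y = 0 := Iff.rfl

namespace GoodKernel
variable {M : Matrix ι ι ℂ[X]} {d : ℕ} {ε : κ → ℕ} {x : κ → ι → ℂ[X]}

/-- By the predictable degree property, `∑ u j • x j` has degree less than `n` exactly when every `u
j` has degree less than `n - ε j`. Truncated subtraction correctly gives `0` when `n ≤ ε j`. -/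
theorem finrank_kerLT (h : GoodKernel M d ε x) (n : ℕ) :
    Module.finrank ℂ (kerLT M n) = ∑ j, (n - ε j) := by
  rw [← finrank_polyLT]
  symm
  let f : polyLT (fun j => n - ε j) →ₗ[ℂ] (ι → ℂ[X]) :=
    ((Fintype.linearCombination ℂ[X] x).restrictScalars ℂ).comp (Submodule.subtype _)
  have hf : ∀ u, f u = ∑ j, u.1 j • x j := fun u => rfl
  have hinj : Function.Injective f := by
    rw [injective_iff_map_eq_zero]
    intro u hu
    exact Subtype.ext (h.eq_zero_of_sum_smul_eq_zero hu)
  have hrange : LinearMap.range f = kerLT M n := by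
    apply le_antisymm
    · rintro _ ⟨u, rfl⟩
      rw [mem_kerLT, hf]
      constructor
      · refine Submodule.sum_mem _ fun j _ a s hs => ?_
        simp only [Pi.smul_apply, smul_eq_mul]
        rw [mul_comm]
        rcases Nat.lt_or_ge (ε j) n with hj | hj
        · exact coeff_mul_eq_zero (h.deg_basis j a) (u.2 j) (by simp only at hs ⊢; omega)
        · have : u.1 j = 0 := by
            ext s
            exact u.2 j s (by simp only; omega)
          simp [this]
      · simp [mulVec_sum, mulVec_smul, h.ker]
    · rintro y hy
      rw [mem_kerLT] at hy
      obtain ⟨u, rfl⟩ := h.exists_eq_sum_smul hy.2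
      refine ⟨⟨u, fun j s hs => ?_⟩, rfl⟩
      exact coeff_eq_zero_of_sum_smul h.deg_basis h.indep_lead u n (fun a s hs => hy.1 a s hs) j s
        (by simp only at hs; omega)
  rw [← hrange]
  exact (LinearEquiv.ofInjective f hinj).finrank_eq

/-- Every skew-symmetric matrix of polynomials of degrees at most `d + ε i + ε j` is the
restriction to the kernel of a skew-symmetric matrix polynomial of grade `d`. -/
theorem exists_skew_restriction_eq (h : GoodKernel M d ε x) {p : κ → κ → ℂ[X]}
    (hp : ∀ i j s, d + 1 + ε i + ε j ≤ s → (p i j).coeff s = 0) (hskew : ∀ i j, p j i = -p i j) :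
    ∃ E : Matrix ι ι ℂ[X], Eᵀ = -E ∧ (∀ a b s, d + 1 ≤ s → (E a b).coeff s = 0) ∧
      ∀ i j, x i ⬝ᵥ (E *ᵥ x j) = p i j := by
  -- The bounded-degree surjectivity is used twice, once for each side of the bilinear form. The
  -- first use leaves degrees less than `d + 1 + ε i`, which is just what the second one needs to
  -- end below `d + 1`.
  have h1 : ∀ i, ∃ y ∈ polyLT (fun _ : ι => d + 1 + ε i), ∀ j, x j ⬝ᵥ y = p i j := fun i =>
    h.exists_dotProduct_eq_of_mem_polyLT (by omega) (fun j s hs => hp i j s hs)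
  choose y hy hxy using h1
  have h2 : ∀ a, ∃ z ∈ polyLT (fun _ : ι => d + 1), ∀ i, x i ⬝ᵥ z = y i a := fun a =>
    h.exists_dotProduct_eq_of_mem_polyLT (by omega) (fun i s hs => hy i a s hs)
  choose z hz hxz using h2
  let E : Matrix ι ι ℂ[X] := (Matrix.of z)ᵀ
  have hE : ∀ i j, x i ⬝ᵥ (E *ᵥ x j) = p i j := by
    intro i j
    rw [dotProduct_mulVec, ← hxy i j, dotProduct_comm]
    congr 1
    ext1 a
    exact hxz a i
  -- Antisymmetrizing does not change the values on the basis, since `p` is already skew.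
  refine ⟨C (1 / 2 : ℂ) • (E - Eᵀ), ?_, ?_, ?_⟩
  · rw [transpose_smul, transpose_sub, transpose_transpose, ← smul_neg, neg_sub]
  · intro a b s hs
    have e1 : (E a b).coeff s = 0 := hz b a s hs
    have e2 : (E b a).coeff s = 0 := hz a b s hs
    change (C (1 / 2 : ℂ) * (E a b - E b a)).coeff s = 0
    rw [coeff_C_mul, coeff_sub, e1, e2, sub_zero, mul_zero]
  · intro i j
    have : x i ⬝ᵥ (Eᵀ *ᵥ x j) = p j i := by
      rw [mulVec_transpose, dotProduct_comm, ← dotProduct_mulVec, hE]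
    rw [smul_mulVec, sub_mulVec, dotProduct_smul, dotProduct_sub, hE, this, hskew i j, smul_eq_mul,
      sub_neg_eq_add, ← two_mul, ← mul_assoc, ← C_ofNat, ← C_mul]
    norm_num

end GoodKernel

/-! ### Minimal bases -/

/-- A vector polynomial seen over the field of rational functions. -/
def ratVec (x : ι → ℂ[X]) : ι → RatFunc ℂ := fun a => algebraMap ℂ[X] (RatFunc ℂ) (x a)

theorem ratVec_sum_smul (u : κ → ℂ[X]) (x : κ → ι → ℂ[X]) :
    ratVec (∑ j, u j • x j) = ∑ j, algebraMap ℂ[X] (RatFunc ℂ) (u j) • ratVec (x j) := by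
  ext a
  simp [ratVec, Algebra.smul_def]

theorem ratVec_injective : Function.Injective (ratVec : (ι → ℂ[X]) → ι → RatFunc ℂ) := by
  intro x y h
  funext a
  exact RatFunc.algebraMap_injective ℂ (congrFun h a)

theorem ratVec_zero : ratVec (0 : ι → ℂ[X]) = 0 := by ext a; simp [ratVec]

theorem vecDegree_le_iff {m n : ℕ} {x : Fin m → ℂ[X]} :
    vecDegree x ≤ n ↔ ∀ a, (x a).natDegree ≤ n := by
  simp [vecDegree]

variable {m k : ℕ} {V : Submodule (RatFunc ℂ) (Fin m → RatFunc ℂ)}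

theorem isPolyBasis_iff {x : Fin k → Fin m → ℂ[X]} :
    IsPolyBasis V x ↔ LinearIndependent (RatFunc ℂ) (fun i => ratVec (x i)) ∧
      Submodule.span (RatFunc ℂ) (Set.range fun i => ratVec (x i)) = V := Iff.rfl

theorem IsPolyBasis.finrank_eq {x : Fin k → Fin m → ℂ[X]} (h : IsPolyBasis V x) :
    Module.finrank (RatFunc ℂ) V = k := by
  rw [isPolyBasis_iff] at h
  rw [← h.2, finrank_span_eq_card h.1, Fintype.card_fin]

theorem IsPolyBasis.eq_zero {x : Fin k → Fin m → ℂ[X]} (h : IsPolyBasis V x) {u : Fin k → ℂ[X]}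
    (hu : ∑ j, u j • x j = 0) (j : Fin k) : u j = 0 := by
  rw [isPolyBasis_iff] at h
  have := congrArg ratVec hu
  rw [ratVec_sum_smul, ratVec_zero] at this
  have := Fintype.linearIndependent_iff.1 h.1 _ this j
  exact (map_eq_zero_iff _ (RatFunc.algebraMap_injective ℂ)).1 this

theorem isPolyBasis_of_span_eq {x : Fin k → Fin m → ℂ[X]}
    (hk : Module.finrank (RatFunc ℂ) V = k)
    (h : Submodule.span (RatFunc ℂ) (Set.range fun i => ratVec (x i)) = V) : IsPolyBasis V x := by
  rw [isPolyBasis_iff]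
  refine ⟨?_, h⟩
  rw [linearIndependent_iff_card_eq_finrank_span, Set.finrank, h, hk, Fintype.card_fin]

/-- Steinitz exchange over `ℂ(λ)`. The factor `q` allows the combination to be divided by a common
polynomial divisor before it enters the basis. -/
theorem IsPolyBasis.update {x : Fin k → Fin m → ℂ[X]} (h : IsPolyBasis V x) {u : Fin k → ℂ[X]}
    {i : Fin k} (hu : u i ≠ 0) {q : ℂ[X]} (hq : q ≠ 0) {y : Fin m → ℂ[X]}
    (hy : q • y = ∑ j, u j • x j) : IsPolyBasis V (Function.update x i y) := by
  apply isPolyBasis_of_span_eq h.finrank_eq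
  have hV := (isPolyBasis_iff.1 h).2
  have hq' : algebraMap ℂ[X] (RatFunc ℂ) q ≠ 0 := fun e =>
    hq ((map_eq_zero_iff _ (RatFunc.algebraMap_injective ℂ)).1 e)
  have hu' : algebraMap ℂ[X] (RatFunc ℂ) (u i) ≠ 0 := fun e =>
    hu ((map_eq_zero_iff _ (RatFunc.algebraMap_injective ℂ)).1 e)
  have hrel : algebraMap ℂ[X] (RatFunc ℂ) q • ratVec y =
      ∑ j, algebraMap ℂ[X] (RatFunc ℂ) (u j) • ratVec (x j) := by
    rw [← ratVec_sum_smul, ← hy]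
    ext a; simp [ratVec]
  apply le_antisymm
  · rw [Submodule.span_le]
    rintro _ ⟨j, rfl⟩
    by_cases hj : j = i
    · subst hj
      simp only [Function.update_self, SetLike.mem_coe]
      rw [← Submodule.smul_mem_iff _ hq', hrel, ← hV]
      exact Submodule.sum_mem _ fun l _ => Submodule.smul_mem _ _ (Submodule.subset_span ⟨l, rfl⟩)
    · simp only [Function.update_of_ne hj, SetLike.mem_coe]
      rw [← hV]
      exact Submodule.subset_span ⟨j, rfl⟩
  · rw [← hV, Submodule.span_le]
    have hmem : ∀ j, j ≠ i → ratVec (x j) ∈ Submodule.span (RatFunc ℂ)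
        (Set.range fun l => ratVec (Function.update x i y l)) := by
      intro j hj
      exact Submodule.subset_span ⟨j, by simp [Function.update_of_ne hj]⟩
    rintro _ ⟨j, rfl⟩
    by_cases hj : j = i
    · subst hj
      simp only [SetLike.mem_coe]
      rw [← Submodule.smul_mem_iff _ hu']
      have : algebraMap ℂ[X] (RatFunc ℂ) (u j) • ratVec (x j) =
          algebraMap ℂ[X] (RatFunc ℂ) q • ratVec y - ∑ l ∈ Finset.univ.erase j,
            algebraMap ℂ[X] (RatFunc ℂ) (u l) • ratVec (x l) := by
        rw [hrel, ← Finset.add_sum_erase _ _ (Finset.mem_univ j)]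
        abel
      rw [this]
      refine Submodule.sub_mem _ (Submodule.smul_mem _ _ (Submodule.subset_span ⟨j, by simp⟩)) ?_
      exact Submodule.sum_mem _ fun l hl =>
        Submodule.smul_mem _ _ (hmem l (Finset.ne_of_mem_erase hl))
    · exact hmem j hj

theorem IsMinimalBasis.vecDegree_le {x : Fin k → Fin m → ℂ[X]} (h : IsMinimalBasis V x)
    {u : Fin k → ℂ[X]} {i : Fin k} (hu : u i ≠ 0) {q : ℂ[X]} (hq : q ≠ 0) {y : Fin m → ℂ[X]}
    (hy : q • y = ∑ j, u j • x j) : vecDegree (x i) ≤ vecDegree y := by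
  have := h.2 _ (h.1.update hu hq hy)
  rw [← Finset.add_sum_erase _ _ (Finset.mem_univ i),
    ← Finset.add_sum_erase (a := i) _ (fun l => vecDegree (Function.update x i y l))
      (Finset.mem_univ i)] at this
  have e : ∑ l ∈ Finset.univ.erase i, vecDegree (Function.update x i y l) =
      ∑ l ∈ Finset.univ.erase i, vecDegree (x l) :=
    Finset.sum_congr rfl fun l hl => by rw [Function.update_of_ne (Finset.ne_of_mem_erase hl)]
  rw [e, Function.update_self] at this
  omega

theorem natDegree_le_vecDegree (x : Fin m → ℂ[X]) (a : Fin m) :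
    (x a).natDegree ≤ vecDegree x := vecDegree_le_iff.1 le_rfl a

/-- A relation at `μ` makes a constant combination divisible by `X - μ`. Its quotient could replace
the member of largest degree among those involved and would lower the sum of degrees. -/
theorem IsMinimalBasis.indep_eval {x : Fin k → Fin m → ℂ[X]} (h : IsMinimalBasis V x) (μ : ℂ) :
    LinearIndependent ℂ fun j a => (x j a).eval μ := by
  rw [Fintype.linearIndependent_iff]
  intro c hc
  by_contra hne
  simp only [not_forall] at hne
  obtain ⟨i, hi, hmax⟩ := Finset.exists_max_image (Finset.univ.filter fun i => c i ≠ 0)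
    (fun i => vecDegree (x i)) (by obtain ⟨i, hi⟩ := hne; exact ⟨i, by simpa using hi⟩)
  simp only [Finset.mem_filter, Finset.mem_univ, true_and] at hi hmax
  obtain ⟨z, hz⟩ := exists_eq_X_sub_C_smul (y := ∑ j, C (c j) • x j) (μ := μ) (by
    intro a
    have := congrFun hc a
    simpa [eval_finsetSum] using this)
  have hCi : C (c i) ≠ 0 := by simpa using hi
  have hle := h.vecDegree_le (u := fun j => C (c j)) hCi (X_sub_C_ne_zero μ) hz.symm
  have hz0 : z ≠ 0 := by
    rintro rfl
    rw [smul_zero] at hz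
    exact hCi (h.1.eq_zero hz i)
  have hdeg : ∀ a, z a ≠ 0 → (z a).natDegree + 1 ≤ vecDegree (x i) := by
    intro a ha
    have e := congrFun hz a
    simp only [Pi.smul_apply, smul_eq_mul, Finset.sum_apply] at e
    have e2 : ((X - C μ) * z a).natDegree = (z a).natDegree + 1 := by
      rw [natDegree_mul (X_sub_C_ne_zero μ) ha, natDegree_X_sub_C, add_comm]
    rw [← e2, ← e]
    refine natDegree_sum_le_of_forall_le _ _ fun j _ => ?_
    by_cases hj : c j = 0
    · simp [hj]
    · exact (natDegree_C_mul_le _ _).trans ((natDegree_le_vecDegree _ _).trans (hmax j hj))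
  obtain ⟨a, ha⟩ := Function.ne_iff.1 hz0
  have h1 := hdeg a ha
  have h2 : vecDegree z ≤ vecDegree (x i) - 1 := by
    rw [vecDegree_le_iff]
    intro b
    by_cases hb : z b = 0
    · simp [hb]
    · have := hdeg b hb; omega
  omega

/-- The analogue at infinity: powers of `X` align the degrees, a relation between leading vectors
cancels the top coefficient, and the combination could replace the member of largest degree `D`. If
`D = 0`, the combination would be zero. -/
theorem IsMinimalBasis.indep_lead {x : Fin k → Fin m → ℂ[X]} (h : IsMinimalBasis V x) :
    LinearIndependent ℂ fun j a => (x j a).coeff (vecDegree (x j)) := by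
  rw [Fintype.linearIndependent_iff]
  intro c hc
  by_contra hne
  simp only [not_forall] at hne
  obtain ⟨i, hi, hmax⟩ := Finset.exists_max_image (Finset.univ.filter fun i => c i ≠ 0)
    (fun i => vecDegree (x i)) (by obtain ⟨i, hi⟩ := hne; exact ⟨i, by simpa using hi⟩)
  simp only [Finset.mem_filter, Finset.mem_univ, true_and] at hi hmax
  set D := vecDegree (x i) with hD
  set u : Fin k → ℂ[X] := fun j => C (c j) * X ^ (D - vecDegree (x j)) with hu
  set z := ∑ j, u j • x j with hz
  have hui : u i ≠ 0 := by simp [hu, hi]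
  have hle := h.vecDegree_le (y := z) hui one_ne_zero (one_smul _ _)
  have hz0 : z ≠ 0 := fun e => hui (h.1.eq_zero e i)
  have hcoeff : ∀ a s, D ≤ s → (z a).coeff s = 0 := by
    intro a s hs
    simp only [hz, hu, Finset.sum_apply, Pi.smul_apply, smul_eq_mul, finsetSum_coeff, mul_assoc,
      coeff_C_mul, coeff_X_pow_mul']
    rcases hs.lt_or_eq with hs | rfl
    · refine Finset.sum_eq_zero fun j _ => ?_
      by_cases hj : c j = 0
      · simp [hj]
      · have := hmax j hj
        rw [if_pos (by omega),
          coeff_eq_zero_of_natDegree_le (natDegree_le_vecDegree (x j) a) (by omega), mul_zero]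
    · have e := congrFun hc a
      simp only [Finset.sum_apply, Pi.smul_apply, smul_eq_mul, Pi.zero_apply] at e
      rw [← e]
      refine Finset.sum_congr rfl fun j _ => ?_
      by_cases hj : c j = 0
      · simp [hj]
      · have := hmax j hj
        rw [if_pos (by omega), show D - (D - vecDegree (x j)) = vecDegree (x j) by omega]
  rcases Nat.eq_zero_or_pos D with h0 | h0
  · apply hz0
    funext a
    ext s
    exact hcoeff a s (by omega)
  · have : vecDegree z ≤ D - 1 := by
      rw [vecDegree_le_iff]
      intro a
      exact natDegree_le_iff_coeff_eq_zero.2 fun s hs => hcoeff a s (by omega)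
    omega

/-- The left inverse of `x` makes the matrix `U` expressing `y` through `x` polynomial. Its
determinant is nonzero, so some permutation has all `U (σ l) l ≠ 0`, and the predictable degree
property bounds the degree of `y (σ l)` below by `ε l`. -/
theorem exists_perm_le_vecDegree {x y : Fin k → Fin m → ℂ[X]} (hx : IsPolyBasis V x)
    (hy : IsPolyBasis V y) {ε : Fin k → ℕ} (hdeg : ∀ j a, (x j a).natDegree ≤ ε j)
    (heval : ∀ μ : ℂ, LinearIndependent ℂ fun j a => (x j a).eval μ)
    (hlead : LinearIndependent ℂ fun j a => (x j a).coeff (ε j)) :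
    ∃ σ : Equiv.Perm (Fin k), ∀ l, ε l ≤ vecDegree (y (σ l)) := by
  obtain ⟨L, hL⟩ := exists_leftInverse_basis heval
  let U : Matrix (Fin k) (Fin k) ℂ[X] := Matrix.of fun l j => L j ⬝ᵥ y l
  have hU : ∀ l, y l = ∑ j, U l j • x j := by
    intro l
    have hmem : ratVec (y l) ∈ Submodule.span (RatFunc ℂ) (Set.range fun i => ratVec (x i)) := by
      rw [(isPolyBasis_iff.1 hx).2, ← (isPolyBasis_iff.1 hy).2]
      exact Submodule.subset_span ⟨l, rfl⟩
    obtain ⟨c, hc⟩ := (Submodule.mem_span_range_iff_exists_fun _).1 hmem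
    have hdot : ∀ v w : Fin m → ℂ[X],
        algebraMap ℂ[X] (RatFunc ℂ) (v ⬝ᵥ w) = ratVec v ⬝ᵥ ratVec w := by
      intro v w; simp [dotProduct, ratVec]
    have hcj : ∀ j, algebraMap ℂ[X] (RatFunc ℂ) (U l j) = c j := by
      intro j
      simp only [U, of_apply, hdot]
      rw [← hc, dotProduct_sum]
      simp only [dotProduct_smul, ← hdot, hL, smul_eq_mul]
      simp
    apply ratVec_injective
    rw [ratVec_sum_smul, ← hc]
    simp only [hcj]
  have hdet : U.det ≠ 0 := by
    intro h0
    obtain ⟨v, hv, hvU⟩ := Matrix.exists_vecMul_eq_zero_iff.2 h0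
    apply hv
    funext l
    refine hy.eq_zero (u := v) ?_ l
    have : ∑ l, v l • y l = ∑ j, (v ᵥ* U) j • x j := by
      simp only [vecMul, dotProduct, Finset.sum_smul]
      rw [Finset.sum_comm]
      refine Finset.sum_congr rfl fun l _ => ?_
      rw [hU l, Finset.smul_sum]
      simp [smul_smul]
    rw [this, hvU]
    simp
  rw [Matrix.det_apply] at hdet
  obtain ⟨σ, -, hσ⟩ := Finset.exists_ne_zero_of_sum_ne_zero hdet
  refine ⟨σ, fun l => ?_⟩
  have hne : U (σ l) l ≠ 0 := by
    intro h0
    apply hσ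
    rw [Finset.prod_eq_zero (f := fun i => U (σ i) i) (Finset.mem_univ l) h0, smul_zero]
  by_contra hlt
  apply hne
  ext s
  refine coeff_eq_zero_of_sum_smul hdeg hlead (U (σ l)) (vecDegree (y (σ l)) + 1) ?_ l s (by omega)
  intro a s hs
  rw [← hU]
  exact coeff_eq_zero_of_natDegree_le (natDegree_le_vecDegree _ a) hs

theorem vecDegree_eq {x : Fin k → Fin m → ℂ[X]} {ε : Fin k → ℕ}
    (hdeg : ∀ j a, (x j a).natDegree ≤ ε j)
    (hlead : LinearIndependent ℂ fun j a => (x j a).coeff (ε j)) (j : Fin k) :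
    vecDegree (x j) = ε j := by
  apply le_antisymm (vecDegree_le_iff.2 (hdeg j))
  by_contra h
  apply hlead.ne_zero j
  funext a
  exact coeff_eq_zero_of_natDegree_le (natDegree_le_vecDegree (x j) a) (not_le.1 h)

theorem isMinimalBasis_of_indep {x : Fin k → Fin m → ℂ[X]} (hx : IsPolyBasis V x)
    {ε : Fin k → ℕ} (hdeg : ∀ j a, (x j a).natDegree ≤ ε j)
    (heval : ∀ μ : ℂ, LinearIndependent ℂ fun j a => (x j a).eval μ)
    (hlead : LinearIndependent ℂ fun j a => (x j a).coeff (ε j)) : IsMinimalBasis V x := by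
  refine ⟨hx, fun y hy => ?_⟩
  obtain ⟨σ, hσ⟩ := exists_perm_le_vecDegree hx hy hdeg heval hlead
  rw [← Equiv.sum_comp σ fun l => vecDegree (y l)]
  refine Finset.sum_le_sum fun l _ => ?_
  rw [vecDegree_eq hdeg hlead]
  exact hσ l

/-- Two minimal bases have equal degree sums, so the termwise inequality along the permutation is an
equality. -/
theorem HasMinimalIndices.unique {ε ε' : Multiset ℕ} (h : HasMinimalIndices V ε)
    (h' : HasMinimalIndices V ε') : ε = ε' := by
  obtain ⟨k, x, hx, rfl⟩ := h
  obtain ⟨k', y, hy, rfl⟩ := h'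
  obtain rfl : k = k' := by rw [← hx.1.finrank_eq, hy.1.finrank_eq]
  obtain ⟨σ, hσ⟩ := exists_perm_le_vecDegree hx.1 hy.1
    (fun j a => natDegree_le_vecDegree (x j) a) hx.indep_eval hx.indep_lead
  have hsum : ∑ l, vecDegree (x l) = ∑ l, vecDegree (y (σ l)) := by
    rw [Equiv.sum_comp σ fun l => vecDegree (y l)]
    exact le_antisymm (hx.2 _ hy.1) (hy.2 _ hx.1)
  have heq := (Finset.sum_eq_sum_iff_of_le fun l _ => hσ l).1 hsum
  have e : (fun i => vecDegree (x i)) = (fun i => vecDegree (y i)) ∘ σ :=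
    funext fun l => heq l (Finset.mem_univ l)
  have hm : (Finset.univ.val : Multiset (Fin k)).map σ = Finset.univ.val := by
    exact congrArg Finset.val (Finset.map_univ_equiv σ)
  rw [e, ← Multiset.map_map, hm]

end

section

variable {ι κ : Type} [Fintype ι] [Fintype κ]

/-! ### Unimodular congruence to the Smith form -/

/-- A perfect alternating form over a principal ideal domain has a symplectic basis. -/
theorem exists_symplectic {R : Type*} [CommRing R] [IsDomain R] [IsPrincipalIdealRing R] (n : ℕ) :
    ∀ (N : Type) [AddCommGroup N] [Module R N] [Module.Free R N] [Module.Finite R N]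
      (ω : N →ₗ[R] N →ₗ[R] R), (∀ v, ω v v = 0) → Function.Surjective ω →
      Module.finrank R N = n →
      ∃ (r : ℕ) (e f : Fin r → N), n = 2 * r ∧ (∀ i j, ω (e i) (e j) = 0) ∧
        (∀ i j, ω (f i) (f j) = 0) ∧ (∀ i j, ω (e i) (f j) = if i = j then 1 else 0) ∧
        ∀ v, v ∈ Submodule.span R (Set.range e ∪ Set.range f) := by
  induction n using Nat.strong_induction_on with
  | _ n ih =>
  intro N _ _ _ _ ω halt hsurj hn
  have hskew : ∀ v w, ω v w = -ω w v := by
    intro v w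
    have := halt (v + w)
    simp only [map_add, LinearMap.add_apply, halt, zero_add, add_zero] at this
    exact eq_neg_of_add_eq_zero_right this
  rcases Nat.eq_zero_or_pos n with h0 | hpos
  · refine ⟨0, Fin.elim0, Fin.elim0, by omega, fun i => i.elim0, fun i => i.elim0,
      fun i => i.elim0, fun v => ?_⟩
    have : IsEmpty (Fin (Module.finrank R N)) := by rw [hn, h0]; infer_instance
    have hv : v = 0 := by
      rw [← (Module.finBasis R N).sum_repr v]
      exact Finset.sum_of_isEmpty _
    rw [hv]
    exact Submodule.zero_mem _
  · let b := Module.finBasis R N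
    let i₀ : Fin (Module.finrank R N) := ⟨0, by omega⟩
    -- Perfectness represents a coordinate functional, which takes the value `1` on its basis
    -- vector: this is a hyperbolic pair. It splits off, and the rank drops by two.
    obtain ⟨u, hu⟩ := hsurj (b.coord i₀)
    obtain ⟨e₀, f₀, hef⟩ : ∃ e₀ f₀ : N, ω e₀ f₀ = 1 := by
      refine ⟨u, b i₀, ?_⟩
      rw [hu]
      simp
    have hfe : ω f₀ e₀ = -1 := by rw [hskew, hef]
    let N' : Submodule R N := LinearMap.ker (ω e₀) ⊓ LinearMap.ker (ω f₀)
    have hN' : ∀ w : N', ω e₀ w = 0 ∧ ω f₀ w = 0 := fun w => ⟨w.2.1, w.2.2⟩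
    -- The projection onto the orthogonal complement of the hyperbolic pair, along their span.
    let p : N →ₗ[R] N' := LinearMap.codRestrict N'
      (LinearMap.id - (ω f₀).smulRight (-e₀) - (ω e₀).smulRight f₀) (by
        intro v
        simp only [N', Submodule.mem_inf, LinearMap.mem_ker, LinearMap.sub_apply,
          LinearMap.smulRight_apply, LinearMap.id_apply, map_sub, map_smul, map_neg, smul_eq_mul,
          halt, hef, hfe]
        constructor <;> ring)
    have hp : ∀ v, (p v : N) = v + ω f₀ v • e₀ - ω e₀ v • f₀ := by
      intro v
      change v - ω f₀ v • (-e₀) - ω e₀ v • f₀ = _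
      rw [smul_neg, sub_neg_eq_add]
    have hp' : ∀ w : N', p w = w := by
      intro w
      apply Subtype.ext
      rw [hp, (hN' w).1, (hN' w).2]
      simp
    let Φ : N ≃ₗ[R] N' × (R × R) := LinearEquiv.ofBijective
      (p.prod ((ω f₀).prod (ω e₀))) (by
        constructor
        · rw [injective_iff_map_eq_zero]
          intro v hv
          have e1 : p v = 0 := congrArg Prod.fst hv
          have e2 : ω f₀ v = 0 := congrArg (fun z => z.2.1) hv
          have e3 : ω e₀ v = 0 := congrArg (fun z => z.2.2) hv
          have := hp v
          rw [e1, e2, e3] at this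
          simpa using this.symm
        · rintro ⟨w, a, c⟩
          refine ⟨w - a • e₀ + c • f₀, ?_⟩
          have h1 : ω f₀ (w - a • e₀ + c • f₀) = a := by
            simp [(hN' w).2, hfe, halt]
          have h2 : ω e₀ (w - a • e₀ + c • f₀) = c := by
            simp [(hN' w).1, hef, halt]
          refine Prod.ext (Subtype.ext ?_) (Prod.ext h1 h2)
          change (p _ : N) = w
          rw [hp, h1, h2]
          abel)
    have hfin : Module.finrank R N' + 2 = n := by
      have := Φ.finrank_eq
      rw [hn, Module.finrank_prod, Module.finrank_prod, Module.finrank_self] at this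
      omega
    let ω' : N' →ₗ[R] N' →ₗ[R] R := ω.domRestrict₁₂ N' N'
    have hω' : ∀ v w : N', ω' v w = ω v w := fun v w => rfl
    have hsurj' : Function.Surjective ω' := by
      intro φ
      obtain ⟨u, hu⟩ := hsurj (φ.comp p)
      refine ⟨p u, ?_⟩
      ext w
      rw [hω', hp]
      simp only [map_sub, map_add, map_smul, LinearMap.sub_apply, LinearMap.add_apply,
        LinearMap.smul_apply, (hN' w).1, (hN' w).2, hu, LinearMap.comp_apply, hp']
      simp
    obtain ⟨r, e, f, hr, hee, hff, hef', hspan⟩ :=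
      ih (Module.finrank R N') (by omega) N' ω' (fun v => halt v) hsurj' rfl
    refine ⟨r + 1, Fin.cons e₀ (fun i => e i), Fin.cons f₀ (fun i => f i), by omega, ?_, ?_, ?_, ?_⟩
    · intro i j
      refine Fin.cases ?_ (fun i => ?_) i <;> refine Fin.cases ?_ (fun j => ?_) j
      · simp [halt]
      · simpa using (hN' _).1
      · simp only [Fin.cons_succ, Fin.cons_zero]; rw [hskew]; simpa using (hN' _).1
      · exact hee i j
    · intro i j
      refine Fin.cases ?_ (fun i => ?_) i <;> refine Fin.cases ?_ (fun j => ?_) j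
      · simp [halt]
      · simpa using (hN' _).2
      · simp only [Fin.cons_succ, Fin.cons_zero]; rw [hskew]; simpa using (hN' _).2
      · exact hff i j
    · intro i j
      refine Fin.cases ?_ (fun i => ?_) i <;> refine Fin.cases ?_ (fun j => ?_) j
      · simp [hef]
      · simpa [Fin.succ_ne_zero, (Fin.succ_ne_zero _).symm] using (hN' _).1
      · simp only [Fin.cons_succ, Fin.cons_zero, Fin.succ_ne_zero, if_false]
        rw [hskew]; simpa using (hN' _).2
      · simpa [hω'] using hef' i j
    · intro v
      set S := Submodule.span R (Set.range (Fin.cons e₀ (fun i => (e i : N)) : Fin (r + 1) → N) ∪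
        Set.range (Fin.cons f₀ (fun i => (f i : N)) : Fin (r + 1) → N)) with hS
      have he0 : e₀ ∈ S := Submodule.subset_span (Or.inl ⟨0, by simp⟩)
      have hf0 : f₀ ∈ S := Submodule.subset_span (Or.inr ⟨0, by simp⟩)
      have hpv : (p v : N) ∈ S := by
        have h1 := hspan (p v)
        have h2 : Submodule.span R (Set.range e ∪ Set.range f) ≤ S.comap N'.subtype := by
          rw [Submodule.span_le]
          rintro _ (⟨i, rfl⟩ | ⟨i, rfl⟩)
          · exact Submodule.subset_span (Or.inl ⟨i.succ, by simp⟩)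
          · exact Submodule.subset_span (Or.inr ⟨i.succ, by simp⟩)
        exact h2 h1
      have : v = p v - ω f₀ v • e₀ + ω e₀ v • f₀ := by rw [hp]; abel
      rw [this]
      exact S.add_mem (S.sub_mem hpv (S.smul_mem _ he0)) (S.smul_mem _ hf0)

section Smith
variable {m r : ℕ} (g : Fin r → ℂ[X])

theorem skewSmithForm_even (i : Fin r) (a b : Fin m) (ha : (a : ℕ) = 2 * i) :
    skewSmithForm m g a b = if (b : ℕ) = 2 * i + 1 then g i else 0 := by
  simp only [skewSmithForm, of_apply]
  rw [Finset.sum_eq_single i]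
  · simp only [ha, true_and]
    split_ifs with h1 h2 <;> first | rfl | omega
  · intro j _ hj
    have : (j : ℕ) ≠ i := fun e => hj (Fin.ext e)
    rw [if_neg (by omega), if_neg (by omega)]
  · simp

theorem skewSmithForm_odd (i : Fin r) (a b : Fin m) (ha : (a : ℕ) = 2 * i + 1) :
    skewSmithForm m g a b = if (b : ℕ) = 2 * i then -g i else 0 := by
  simp only [skewSmithForm, of_apply]
  rw [Finset.sum_eq_single i]
  · rw [if_neg (by omega)]
    simp [ha]
  · intro j _ hj
    have : (j : ℕ) ≠ i := fun e => hj (Fin.ext e)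
    rw [if_neg (by omega), if_neg (by omega)]
  · simp

theorem skewSmithForm_ge (a b : Fin m) (ha : 2 * r ≤ (a : ℕ)) : skewSmithForm m g a b = 0 := by
  simp only [skewSmithForm, of_apply]
  refine Finset.sum_eq_zero fun j _ => ?_
  have := j.2
  rw [if_neg (by omega), if_neg (by omega)]

theorem skewSmithForm_ge_right (a b : Fin m) (hb : 2 * r ≤ (b : ℕ)) :
    skewSmithForm m g a b = 0 := by
  simp only [skewSmithForm, of_apply]
  refine Finset.sum_eq_zero fun j _ => ?_
  have := j.2
  rw [if_neg (by omega), if_neg (by omega)]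

end Smith

theorem dotProduct_mulVec_self {M : Matrix ι ι ℂ[X]} (h : Mᵀ = -M) (v : ι → ℂ[X]) :
    v ⬝ᵥ (M *ᵥ v) = 0 := by
  have h1 := dotProduct_mulVec_skew h v v
  rw [dotProduct_comm (M *ᵥ v) v] at h1
  have h2 : (2 : ℂ[X]) * (v ⬝ᵥ (M *ᵥ v)) = 0 := by linear_combination h1
  exact (mul_eq_zero.1 h2).resolve_left two_ne_zero

/-- The kernel module has a free complement `N`, the kernel of a left inverse of the basis. On `N`
the form of `M` is perfect, so `N` has a symplectic basis; together with `x` it gives the columns of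
a unimodular congruence whose invariant polynomials are all `1`. -/
theorem GoodKernel.exists_smith {m k : ℕ} {M : Matrix (Fin m) (Fin m) ℂ[X]} {d : ℕ}
    {ε : Fin k → ℕ} {x : Fin k → Fin m → ℂ[X]} (h : GoodKernel M d ε x) :
    ∃ r, 2 * r + k = m ∧ IsInvariantPolys M (fun _ : Fin r => 1) := by
  obtain ⟨y, hy⟩ := exists_leftInverse_basis h.indep_eval
  let L : (Fin m → ℂ[X]) →ₗ[ℂ[X]] (Fin k → ℂ[X]) := Matrix.mulVecLin (Matrix.of y)
  have hL : ∀ v i, L v i = y i ⬝ᵥ v := fun v i => rfl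
  let N : Submodule ℂ[X] (Fin m → ℂ[X]) := LinearMap.ker L
  have hNL : ∀ (w : N) i, y i ⬝ᵥ (w : Fin m → ℂ[X]) = 0 := fun w i => congrFun w.2 i
  have hLsum : ∀ c : Fin k → ℂ[X], L (∑ j, c j • x j) = c := by
    intro c
    ext1 i
    simp [hL, dotProduct_sum, hy]
  let p : (Fin m → ℂ[X]) →ₗ[ℂ[X]] N := LinearMap.codRestrict N
    (LinearMap.id - (Fintype.linearCombination ℂ[X] x).comp L) (by
      intro v
      simp only [N, LinearMap.mem_ker, LinearMap.sub_apply, LinearMap.comp_apply,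
        LinearMap.id_apply, map_sub, Fintype.linearCombination_apply, hLsum, sub_self])
  have hp : ∀ v, (p v : Fin m → ℂ[X]) = v - ∑ j, L v j • x j := fun v => rfl
  have hpx : ∀ j, p (x j) = 0 := by
    intro j
    apply Subtype.ext
    rw [hp]
    simp [hL, hy]
  have hpN : ∀ w : N, p w = w := by
    intro w
    apply Subtype.ext
    rw [hp, show L w = 0 from w.2]
    simp
  have hMp : ∀ v, M *ᵥ (p v : Fin m → ℂ[X]) = M *ᵥ v := by
    intro v
    rw [hp, mulVec_sub, mulVec_sum]
    simp [mulVec_smul, h.ker]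
  let ω : N →ₗ[ℂ[X]] N →ₗ[ℂ[X]] ℂ[X] := LinearMap.mk₂ ℂ[X]
    (fun v w => (v : Fin m → ℂ[X]) ⬝ᵥ (M *ᵥ (w : Fin m → ℂ[X])))
    (by intros; simp [add_dotProduct]) (by intros; simp)
    (by intros; simp [mulVec_add, dotProduct_add]) (by intros; simp [mulVec_smul])
  have hω : ∀ v w : N, ω v w = (v : Fin m → ℂ[X]) ⬝ᵥ (M *ᵥ (w : Fin m → ℂ[X])) :=
    fun v w => rfl
  have hsurj : Function.Surjective ω := by
    intro φ
    -- The vector `z` represents `φ` extended by zero on the basis `x`. It is therefore orthogonal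
    -- to `x`, hence in the image of `M`; the sign of the preimage comes from skew-symmetry.
    let z : Fin m → ℂ[X] := fun a => φ (p (Pi.single a 1))
    have hz : ∀ v, z ⬝ᵥ v = φ (p v) := by
      intro v
      have : v = ∑ a, v a • (Pi.single a (1 : ℂ[X]) : Fin m → ℂ[X]) := by
        ext1 b; simp [Finset.sum_apply, Pi.single_apply]
      conv_rhs => rw [this]
      simp only [map_sum, map_smul, smul_eq_mul, dotProduct, z]
      exact Finset.sum_congr rfl fun a _ => mul_comm _ _
    obtain ⟨u, hu⟩ := h.exists_mulVec_eq (y := z) fun j => by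
      rw [dotProduct_comm, hz, hpx, map_zero]
    refine ⟨-p u, ?_⟩
    ext1 w
    rw [map_neg, LinearMap.neg_apply, hω, dotProduct_mulVec_skew h.skew, hMp, hu, hz, hpN, neg_neg]
  have hLsurj : LinearMap.range L = ⊤ := by
    rw [LinearMap.range_eq_top]
    intro c
    exact ⟨_, hLsum c⟩
  have hfin : k + Module.finrank ℂ[X] N = m := by
    have := Submodule.finrank_quotient_add_finrank N
    rw [(L.quotKerEquivOfSurjective (LinearMap.range_eq_top.1 hLsurj)).finrank_eq,
      Module.finrank_fintype_fun_eq_card,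
      Module.finrank_fintype_fun_eq_card, Fintype.card_fin, Fintype.card_fin] at this
    exact this
  obtain ⟨r, e, f, hr, hee, hff, hef, hspan⟩ := exists_symplectic (Module.finrank ℂ[X] N) N ω
    (fun v => dotProduct_mulVec_self h.skew _) hsurj rfl
  simp only [hω] at hee hff hef
  have hfe : ∀ i j, (f i : Fin m → ℂ[X]) ⬝ᵥ (M *ᵥ (e j : Fin m → ℂ[X])) =
      if i = j then -1 else 0 := by
    intro i j
    rw [dotProduct_mulVec_skew h.skew, dotProduct_comm, hef]
    by_cases hij : i = j <;> simp [hij, eq_comm]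
  have hm : 2 * r + k = m := by omega
  refine ⟨r, hm, by omega, fun _ => monic_one, fun _ _ _ => dvd_rfl, ?_⟩
  let col : Fin m → Fin m → ℂ[X] := fun b =>
    if hb : (b : ℕ) < 2 * r then
      (if (b : ℕ) % 2 = 0 then (e ⟨b / 2, by omega⟩ : Fin m → ℂ[X]) else f ⟨b / 2, by omega⟩)
    else x ⟨b - 2 * r, by omega⟩
  have col_even : ∀ (b : Fin m) (i : Fin r), (b : ℕ) = 2 * i → col b = e i := by
    intro b i hb
    have := i.2
    simp only [col]
    rw [dif_pos (by omega), if_pos (by omega)]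
    congr 2
    exact Fin.ext (by simp only; omega)
  have col_odd : ∀ (b : Fin m) (i : Fin r), (b : ℕ) = 2 * i + 1 → col b = f i := by
    intro b i hb
    have := i.2
    simp only [col]
    rw [dif_pos (by omega), if_neg (by omega)]
    congr 2
    exact Fin.ext (by simp only; omega)
  have col_ge : ∀ (b : Fin m) (j : Fin k), (b : ℕ) = 2 * r + j → col b = x j := by
    intro b j hb
    simp only [col]
    rw [dif_neg (by omega)]
    congr 1
    exact Fin.ext (by simp only; omega)
  let F : Matrix (Fin m) (Fin m) ℂ[X] := (Matrix.of col)ᵀ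
  refine ⟨F, ?_, ?_⟩
  · rw [← Matrix.isUnit_iff_isUnit_det, ← Matrix.mulVec_surjective_iff_isUnit]
    have hcol : ∀ b, col b ∈ LinearMap.range F.mulVecLin := fun b =>
      ⟨Pi.single b 1, by ext1 a; simp [F]⟩
    intro v
    suffices hv : v ∈ LinearMap.range F.mulVecLin by
      obtain ⟨c, hc⟩ := hv
      exact ⟨c, hc⟩
    have : v = p v + ∑ j, L v j • x j := by rw [hp]; abel
    rw [this]
    refine Submodule.add_mem _ ?_ (Submodule.sum_mem _ fun j _ => Submodule.smul_mem _ _ ?_)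
    · have hle : Submodule.span ℂ[X] (Set.range e ∪ Set.range f) ≤
          (LinearMap.range F.mulVecLin).comap N.subtype := by
        rw [Submodule.span_le]
        rintro _ (⟨i, rfl⟩ | ⟨i, rfl⟩)
        · have := hcol ⟨2 * i, by have := i.2; omega⟩
          rwa [col_even _ i rfl] at this
        · have := hcol ⟨2 * i + 1, by have := i.2; omega⟩
          rwa [col_odd _ i rfl] at this
      exact hle (hspan (p v))
    · have := hcol ⟨2 * r + j, by have := j.2; omega⟩
      rwa [col_ge _ j rfl] at this
  · ext1 a b
    have hab : (Fᵀ * M * F) a b = col a ⬝ᵥ (M *ᵥ col b) := by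
      rw [Matrix.mul_assoc, Matrix.mul_apply]
      rfl
    rw [hab]
    have hcases : ∀ b : Fin m, (∃ i : Fin r, (b : ℕ) = 2 * i) ∨
        (∃ i : Fin r, (b : ℕ) = 2 * i + 1) ∨ ∃ j : Fin k, (b : ℕ) = 2 * r + j := by
      intro b
      have := b.2
      by_cases hb : (b : ℕ) < 2 * r
      · rcases Nat.mod_two_eq_zero_or_one b with h2 | h2
        · exact Or.inl ⟨⟨b / 2, by omega⟩, by simp only; omega⟩
        · exact Or.inr (Or.inl ⟨⟨b / 2, by omega⟩, by simp only; omega⟩)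
      · exact Or.inr (Or.inr ⟨⟨b - 2 * r, by omega⟩, by simp only; omega⟩)
    rcases hcases b with ⟨j, hj⟩ | ⟨j, hj⟩ | ⟨j, hj⟩
    · rw [col_even b j hj]
      rcases hcases a with ⟨i, hi⟩ | ⟨i, hi⟩ | ⟨i, hi⟩
      · rw [col_even a i hi, skewSmithForm_even _ i a b hi, hee, if_neg (by omega)]
      · rw [col_odd a i hi, skewSmithForm_odd _ i a b hi, hfe]
        exact if_congr (by rw [Fin.ext_iff]; omega) rfl rfl
      · rw [col_ge a i hi, skewSmithForm_ge _ a b (by omega), h.dotProduct_mulVec_eq_zero]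
    · rw [col_odd b j hj]
      rcases hcases a with ⟨i, hi⟩ | ⟨i, hi⟩ | ⟨i, hi⟩
      · rw [col_even a i hi, skewSmithForm_even _ i a b hi, hef]
        exact if_congr (by rw [Fin.ext_iff]; omega) rfl rfl
      · rw [col_odd a i hi, skewSmithForm_odd _ i a b hi, hff, if_neg (by omega)]
      · rw [col_ge a i hi, skewSmithForm_ge _ a b (by omega), h.dotProduct_mulVec_eq_zero]
    · rw [col_ge b j hj, h.ker, dotProduct_zero, skewSmithForm_ge_right _ a b (by omega)]

/-! ### Ranks -/

section Rank
variable {K : Type*} [Field K] {m r : ℕ}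

/-- The vectors whose first `2r` entries vanish. -/
def tailSpace (K : Type*) [Field K] {m r : ℕ} (h : 2 * r ≤ m) : Submodule K (Fin m → K) :=
  LinearMap.ker (LinearMap.funLeft K K (Fin.castLE h))

theorem mem_tailSpace {h : 2 * r ≤ m} {v : Fin m → K} :
    v ∈ tailSpace K h ↔ ∀ a : Fin m, (a : ℕ) < 2 * r → v a = 0 := by
  simp only [tailSpace, LinearMap.mem_ker, funext_iff, LinearMap.funLeft_apply, Pi.zero_apply]
  exact ⟨fun hv a ha => hv ⟨a, ha⟩, fun hv i => hv _ i.2⟩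

theorem finrank_tailSpace (h : 2 * r ≤ m) : 2 * r + Module.finrank K (tailSpace K h) = m := by
  have := (LinearMap.funLeft K K (Fin.castLE h)).finrank_range_add_finrank_ker
  rw [LinearMap.range_eq_top.2 (LinearMap.funLeft_surjective_of_injective K K _
    (Fin.castLE_injective h)), finrank_top, Module.finrank_fintype_fun_eq_card,
    Module.finrank_fintype_fun_eq_card, Fintype.card_fin, Fintype.card_fin] at this
  exact this

theorem rank_add_finrank_ker (A : Matrix (Fin m) (Fin m) K) :
    A.rank + Module.finrank K (LinearMap.ker A.mulVecLin) = m := by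
  have := A.mulVecLin.finrank_range_add_finrank_ker
  simpa [Matrix.rank] using this

theorem smith_mulVec (φ : ℂ[X] →+* K) (g : Fin r → ℂ[X]) (v : Fin m → K) (i : Fin r)
    (a b : Fin m) (ha : (a : ℕ) = 2 * i) (hb : (b : ℕ) = 2 * i + 1) :
    (((skewSmithForm m g).map φ) *ᵥ v) a = φ (g i) * v b ∧
      (((skewSmithForm m g).map φ) *ᵥ v) b = -φ (g i) * v a := by
  constructor
  · rw [mulVec, dotProduct, Finset.sum_eq_single b]
    · rw [map_apply, skewSmithForm_even g i a b ha, if_pos hb]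
    · intro c _ hc
      rw [map_apply, skewSmithForm_even g i a c ha,
        if_neg (fun e => hc (Fin.ext (by omega))), map_zero, zero_mul]
    · simp
  · rw [mulVec, dotProduct, Finset.sum_eq_single a]
    · rw [map_apply, skewSmithForm_odd g i b a hb, if_pos ha, map_neg]
    · intro c _ hc
      rw [map_apply, skewSmithForm_odd g i b c hb,
        if_neg (fun e => hc (Fin.ext (by omega))), map_zero, zero_mul]
    · simp

theorem tailSpace_le_ker_smith (h : 2 * r ≤ m) (φ : ℂ[X] →+* K) (g : Fin r → ℂ[X]) :
    tailSpace K h ≤ LinearMap.ker ((skewSmithForm m g).map φ).mulVecLin := by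
  intro v hv
  rw [mem_tailSpace] at hv
  rw [LinearMap.mem_ker, mulVecLin_apply]
  ext1 a
  rw [mulVec, dotProduct]
  refine Finset.sum_eq_zero fun b _ => ?_
  by_cases hb : (b : ℕ) < 2 * r
  · rw [hv b hb, mul_zero]
  · rw [map_apply, skewSmithForm_ge_right g a b (not_lt.1 hb), map_zero, zero_mul]

theorem rank_smith_eq_iff (h : 2 * r ≤ m) (φ : ℂ[X] →+* K) (g : Fin r → ℂ[X]) :
    ((skewSmithForm m g).map φ).rank = 2 * r ↔ ∀ j, φ (g j) ≠ 0 := by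
  have hle := tailSpace_le_ker_smith h φ g
  have h1 := finrank_tailSpace (K := K) h
  have h2 := rank_add_finrank_ker ((skewSmithForm m g).map φ)
  constructor
  · intro hr j hj
    have heq := Submodule.eq_of_le_of_finrank_eq hle (by omega)
    have hj2 := j.2
    have hmem : (Pi.single ⟨2 * j, by omega⟩ 1 : Fin m → K) ∈
        LinearMap.ker ((skewSmithForm m g).map φ).mulVecLin := by
      rw [LinearMap.mem_ker, mulVecLin_apply, mulVec_single_one]
      ext1 a
      simp only [col_apply, map_apply, Pi.zero_apply]
      have hs : skewSmithForm m g a ⟨2 * j, by omega⟩ = 0 ∨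
          skewSmithForm m g a ⟨2 * j, by omega⟩ = -g j := by
        by_cases ha : (a : ℕ) = 2 * j + 1
        · right; rw [skewSmithForm_odd g j a _ ha, if_pos rfl]
        · left
          simp only [skewSmithForm, of_apply]
          refine Finset.sum_eq_zero fun i _ => ?_
          rw [if_neg (by omega), if_neg (by omega)]
      rcases hs with hs | hs <;> simp [hs, hj]
    rw [← heq, mem_tailSpace] at hmem
    have := hmem ⟨2 * j, by omega⟩ (by simp only; omega)
    simp at this
  · intro hg
    have : LinearMap.ker ((skewSmithForm m g).map φ).mulVecLin ≤ tailSpace K h := by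
      intro v hv
      rw [LinearMap.mem_ker, mulVecLin_apply] at hv
      rw [mem_tailSpace]
      intro a ha
      rcases Nat.mod_two_eq_zero_or_one a with h2 | h2
      · have := (smith_mulVec φ g v ⟨a / 2, by omega⟩ a ⟨a + 1, by omega⟩ (by simp only; omega)
          (by simp only; omega)).2
        rw [hv] at this
        simpa [hg] using this
      · have := (smith_mulVec φ g v ⟨a / 2, by omega⟩ ⟨a - 1, by omega⟩ a (by simp only; omega)
          (by simp only; omega)).1
        rw [hv] at this
        simpa [hg] using this
    have heq := le_antisymm hle this
    rw [← heq] at h2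
    omega

/-- The homomorphism `φ` serves both as evaluation at a point and as the embedding into `ℂ(λ)`, so
that special and generic ranks can be compared. -/
theorem IsInvariantPolys.rank_eq_iff {M : Matrix (Fin m) (Fin m) ℂ[X]} {g : Fin r → ℂ[X]}
    (h : IsInvariantPolys M g) (φ : ℂ[X] →+* K) :
    (M.map φ).rank = 2 * r ↔ ∀ j, φ (g j) ≠ 0 := by
  obtain ⟨hr, -, -, F, hF, hFM⟩ := h
  rw [← rank_smith_eq_iff hr φ g, ← hFM, Matrix.map_mul, Matrix.map_mul]
  have hdet : IsUnit (F.map φ).det := by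
    rw [← RingHom.mapMatrix_apply, ← RingHom.map_det]
    exact hF.map φ
  rw [rank_mul_eq_left_of_isUnit_det _ _ hdet,
    rank_mul_eq_right_of_isUnit_det _ _ (by rw [transpose_map, det_transpose]; exact hdet)]

theorem IsInvariantPolys.rank_ratMatrix {M : Matrix (Fin m) (Fin m) ℂ[X]} {g : Fin r → ℂ[X]}
    (h : IsInvariantPolys M g) : (ratMatrix M).rank = 2 * r := by
  refine (h.rank_eq_iff (algebraMap ℂ[X] (RatFunc ℂ))).2 fun j e => ?_
  exact (h.2.1 j).ne_zero ((map_eq_zero_iff _ (RatFunc.algebraMap_injective ℂ)).1 e)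

/-- The right-hand side does not mention `g`. This replaces uniqueness of the Smith form wherever
only the absence of elementary divisors matters. -/
theorem IsInvariantPolys.elemDivExponents_eq_zero_iff {M : Matrix (Fin m) (Fin m) ℂ[X]}
    {g : Fin r → ℂ[X]} (h : IsInvariantPolys M g) (μ : ℂ) :
    elemDivExponents g μ = 0 ↔ (evalMatrix M μ).rank = (ratMatrix M).rank := by
  rw [h.rank_ratMatrix, show evalMatrix M μ = M.map (evalRingHom μ) from rfl, h.rank_eq_iff,
    elemDivExponents, Multiset.filter_eq_nil]
  simp only [Multiset.mem_map, Finset.mem_val, Finset.mem_univ, true_and, forall_exists_index,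
    forall_apply_eq_imp_iff, not_lt, Nat.le_zero, coe_evalRingHom]
  refine forall_congr' fun j => ?_
  rw [rootMultiplicity_eq_zero_iff]
  exact ⟨fun h1 h2 => (h.2.1 j).ne_zero (h1 h2), fun h1 h2 => absurd h2 h1⟩

end Rank

end

section

variable {ι κ : Type} [Fintype ι] [Fintype κ]

/-! ### Reversal -/

theorem eval_reflect {f : ℂ[X]} {N : ℕ} (hf : f.natDegree ≤ N) {μ : ℂ} (hμ : μ ≠ 0) :
    (reflect N f).eval μ = μ ^ N * f.eval μ⁻¹ := by
  let _ : Invertible μ⁻¹ := invertibleOfNonzero (inv_ne_zero hμ)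
  have h := eval₂_reflect_mul_pow (RingHom.id ℂ) μ⁻¹ N f hf
  rw [invOf_eq_inv, inv_inv] at h
  simp only [eval₂_id] at h
  rw [← h, mul_comm, mul_assoc, ← mul_pow, inv_mul_cancel₀ hμ, one_pow, mul_one]

theorem coeff_reflect_of_le {f : ℂ[X]} {N s : ℕ} (hs : s ≤ N) :
    (reflect N f).coeff s = f.coeff (N - s) := by
  rw [coeff_reflect, revAt_le hs]

theorem eval_zero_reflect (f : ℂ[X]) (N : ℕ) : (reflect N f).eval 0 = f.coeff N := by
  rw [← coeff_zero_eq_eval_zero, coeff_reflect_of_le (Nat.zero_le _), Nat.sub_zero]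

theorem coeff_reflect_self (f : ℂ[X]) (N : ℕ) : (reflect N f).coeff N = f.eval 0 := by
  rw [← coeff_zero_eq_eval_zero, coeff_reflect_of_le le_rfl, Nat.sub_self]

theorem reflect_sum {α : Type*} (s : Finset α) (f : α → ℂ[X]) (N : ℕ) :
    reflect N (∑ i ∈ s, f i) = ∑ i ∈ s, reflect N (f i) := by
  ext n
  simp [coeff_reflect, finsetSum_coeff]

theorem natDegree_reflect_le_self {f : ℂ[X]} {N : ℕ} (hf : f.natDegree ≤ N) :
    (reflect N f).natDegree ≤ N := natDegree_reflect_le.trans (max_le le_rfl hf)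

/-- The reversed matrix polynomial has the reversed kernel. -/
theorem GoodKernel.reverse {M : Matrix ι ι ℂ[X]} {d : ℕ} {ε : κ → ℕ} {x : κ → ι → ℂ[X]}
    (h : GoodKernel M d ε x) :
    GoodKernel (M.map (reflect d)) d ε (fun j a => reflect (ε j) (x j a)) := by
  -- Reversal exchanges `μ` and `μ⁻¹` up to nonzero factors, and exchanges `0` with infinity, so
  -- each condition is carried over from the reciprocal point.
  have hev : ∀ μ : ℂ, μ ≠ 0 → ∀ j, (fun a => (reflect (ε j) (x j a)).eval μ) =
      μ ^ ε j • fun a => (x j a).eval μ⁻¹ := by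
    intro μ hμ j
    ext a
    rw [eval_reflect (h.deg_basis j a) hμ]
    rfl
  refine ⟨?_, fun a b => natDegree_reflect_le_self (h.deg a b), fun j => ?_,
    fun j a => natDegree_reflect_le_self (h.deg_basis j a), fun μ => ?_, ?_, fun μ v hv => ?_,
    fun v hv => ?_⟩
  · ext1 a b
    have := congrFun (congrFun h.skew a) b
    simp only [transpose_apply, Matrix.neg_apply] at this
    simp only [transpose_apply, map_apply, Matrix.neg_apply, this]
    ext s
    simp [coeff_reflect]
  · ext1 a
    have := congrFun (h.ker j) a
    simp only [mulVec, dotProduct, Pi.zero_apply] at this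
    simp only [mulVec, dotProduct, map_apply, Pi.zero_apply]
    rw [← reflect_zero (N := d + ε j), ← this, reflect_sum]
    exact Finset.sum_congr rfl fun b _ => (reflect_mul _ _ (h.deg a b) (h.deg_basis j b)).symm
  · by_cases hμ : μ = 0
    · subst hμ
      simp only [eval_zero_reflect]
      exact h.indep_lead
    · convert (h.indep_eval μ⁻¹).units_smul fun j => (Units.mk0 μ hμ) ^ ε j using 1
      funext j
      exact hev μ hμ j
  · simp only [coeff_reflect_self]
    exact h.indep_eval 0
  · by_cases hμ : μ = 0
    · subst hμ
      simp only [eval_zero_reflect] at hv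
      obtain ⟨u, hu⟩ := h.exact_lead v hv
      refine ⟨u, ?_⟩
      rw [← hu]
      congr 1
      ext a b
      simp [evalMatrix, coeffMatrix, eval_zero_reflect]
    · simp only [hev μ hμ, smul_dotProduct, smul_eq_mul, mul_eq_zero, pow_eq_zero_iff', hμ,
        false_and, false_or] at hv
      obtain ⟨u, hu⟩ := h.exact_eval μ⁻¹ v hv
      refine ⟨(μ ^ d)⁻¹ • u, ?_⟩
      have : evalMatrix (M.map (reflect d)) μ = μ ^ d • evalMatrix M μ⁻¹ := by
        ext a b
        simp [evalMatrix, eval_reflect (h.deg a b) hμ]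
      rw [this, smul_mulVec, mulVec_smul, hu, smul_smul, mul_inv_cancel₀ (pow_ne_zero _ hμ),
        one_smul]
  · simp only [coeff_reflect_self] at hv
    obtain ⟨u, hu⟩ := h.exact_eval 0 v hv
    refine ⟨u, ?_⟩
    rw [← hu]
    congr 1
    ext a b
    simp only [evalMatrix, coeffMatrix, map_apply, coeff_reflect_self]

/-! ### Matrix polynomials given by their coefficients -/

section PolyMatrix
variable {d m : ℕ}

theorem coeff_polyMatrix (P : Fin (d + 1) → Matrix (Fin m) (Fin m) ℂ) (a b : Fin m) (s : ℕ) :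
    (polyMatrix P a b).coeff s = if h : s < d + 1 then P ⟨s, h⟩ a b else 0 := by
  simp only [polyMatrix, of_apply, finsetSum_coeff, coeff_C_mul, coeff_X_pow]
  split_ifs with h
  · rw [Finset.sum_eq_single ⟨s, h⟩]
    · simp
    · intro i _ hi
      rw [if_neg (fun e => hi (Fin.ext e.symm)), mul_zero]
    · simp
  · refine Finset.sum_eq_zero fun i _ => ?_
    rw [if_neg (by have := i.2; omega), mul_zero]

theorem natDegree_polyMatrix_le (P : Fin (d + 1) → Matrix (Fin m) (Fin m) ℂ) (a b : Fin m) :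
    (polyMatrix P a b).natDegree ≤ d :=
  natDegree_le_iff_coeff_eq_zero.2 fun s hs => by rw [coeff_polyMatrix, dif_neg (by omega)]

theorem polyMatrix_transpose (P : SkewPoly d m) : (polyMatrix P.1)ᵀ = -polyMatrix P.1 := by
  ext1 a b
  simp only [transpose_apply, Matrix.neg_apply]
  ext s
  rw [coeff_neg, coeff_polyMatrix, coeff_polyMatrix]
  split_ifs with h
  · have := congrFun (congrFun (P.2 ⟨s, h⟩) a) b
    exact this
  · simp

theorem revMatrix_eq (P : Fin (d + 1) → Matrix (Fin m) (Fin m) ℂ) :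
    revMatrix P = (polyMatrix P).map (reflect d) := by
  ext1 a b
  ext s
  rw [revMatrix, map_apply, coeff_polyMatrix]
  split_ifs with h
  · rw [coeff_reflect_of_le (by omega), coeff_polyMatrix, dif_pos (by omega)]
    congr 1
    exact Fin.ext (by simp only [Fin.val_rev]; omega)
  · rw [coeff_eq_zero_of_natDegree_le (natDegree_reflect_le_self (natDegree_polyMatrix_le P a b))
      (by omega)]

/-- The coefficients of a skew-symmetric matrix over `ℂ[X]`. -/
def toSkewPoly (d : ℕ) (E : Matrix (Fin m) (Fin m) ℂ[X]) (hE : Eᵀ = -E) : SkewPoly d m :=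
  ⟨fun i => E.map fun p => p.coeff i, fun i => by
    ext a b
    have := congrFun (congrFun hE a) b
    simp only [transpose_apply, Matrix.neg_apply] at this
    simp [this]⟩

theorem polyMatrix_toSkewPoly (E : Matrix (Fin m) (Fin m) ℂ[X]) (hE : Eᵀ = -E)
    (hd : ∀ a b s, d + 1 ≤ s → (E a b).coeff s = 0) :
    polyMatrix (toSkewPoly d E hE).1 = E := by
  ext1 a b
  ext s
  rw [coeff_polyMatrix]
  split_ifs with h
  · rfl
  · exact (hd a b s (by omega)).symm

end PolyMatrix

/-! ### Eigenstructures without elementary divisors -/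

/-- The range of a skew-symmetric matrix is the orthogonal complement of its kernel. -/
theorem exists_mulVec_eq_of_orthogonal {A : Matrix ι ι ℂ} (hA : Aᵀ = -A) {v : κ → ι → ℂ}
    (hv : LinearIndependent ℂ v) (hker : ∀ j, A *ᵥ v j = 0)
    (hrank : Module.finrank ℂ (LinearMap.ker A.mulVecLin) ≤ Fintype.card κ) (w : ι → ℂ)
    (hw : ∀ j, v j ⬝ᵥ w = 0) : ∃ u, A *ᵥ u = w := by
  let f := Matrix.mulVecLin (Matrix.of v)
  have hf : Function.Surjective f := by
    intro c
    obtain ⟨w, hw⟩ := exists_dotProduct_eq hv c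
    exact ⟨w, funext hw⟩
  have hle : LinearMap.range A.mulVecLin ≤ LinearMap.ker f := by
    rintro _ ⟨u, rfl⟩
    rw [LinearMap.mem_ker]
    ext1 j
    change v j ⬝ᵥ (A *ᵥ u) = 0
    rw [dotProduct_mulVec_skew hA, hker, zero_dotProduct, neg_zero]
  have h1 := f.finrank_range_add_finrank_ker
  rw [LinearMap.range_eq_top.2 hf, finrank_top, Module.finrank_fintype_fun_eq_card] at h1
  have h2 := A.mulVecLin.finrank_range_add_finrank_ker
  have heq := Submodule.eq_of_le_of_finrank_le hle (by omega)
  have : w ∈ LinearMap.range A.mulVecLin := by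
    rw [heq, LinearMap.mem_ker]
    exact funext hw
  obtain ⟨u, hu⟩ := this
  exact ⟨u, hu⟩

section Eigen
variable {d m k : ℕ}

theorem coeffMatrix_eq_evalMatrix_rev (P : SkewPoly d m) :
    coeffMatrix (polyMatrix P.1) d = evalMatrix (revMatrix P.1) 0 := by
  rw [revMatrix_eq]
  ext a b
  simp [evalMatrix, coeffMatrix, eval_zero_reflect]

theorem rank_smul_eq {A : Matrix (Fin m) (Fin m) ℂ} {c : ℂ} (hc : c ≠ 0) :
    (c • A).rank = A.rank := by
  have h : c • A = A * (c • (1 : Matrix (Fin m) (Fin m) ℂ)) := by simp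
  rw [h]
  apply rank_mul_eq_left_of_isUnit_det
  rw [det_smul, det_one, mul_one]
  exact (pow_ne_zero _ hc).isUnit

/-- If the eigenstructure of `P` has no elementary divisors, then `P` has the same rank everywhere,
including infinity. -/
theorem HasEigenstructure.rank_eq {P : SkewPoly d m} {E : Eigenstructure}
    (h : HasEigenstructure P E) (hfin : ∀ μ, E.finiteDivisors μ = 0)
    (hinf : E.infiniteDivisors = 0) :
    (∀ μ, (evalMatrix (polyMatrix P.1) μ).rank = (ratMatrix (polyMatrix P.1)).rank) ∧
      (coeffMatrix (polyMatrix P.1) d).rank = (ratMatrix (polyMatrix P.1)).rank := by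
  obtain ⟨⟨r, g, hg, hE⟩, ⟨r', g', hg', hE'⟩, -, -⟩ := h
  have h1 : ∀ μ, (evalMatrix (polyMatrix P.1) μ).rank = (ratMatrix (polyMatrix P.1)).rank := by
    intro μ
    rw [← hg.elemDivExponents_eq_zero_iff, ← hE, hfin]
  refine ⟨h1, ?_⟩
  rw [coeffMatrix_eq_evalMatrix_rev, (hg'.elemDivExponents_eq_zero_iff 0).1 (by rw [← hE', hinf])]
  -- The generic ranks of `P` and its reversal are compared at one point `μ ≠ 0` where no invariant
  -- polynomial of the reversal vanishes; there the reversal equals `μ ^ d P(μ⁻¹)`.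
  have hne : X * ∏ j, g' j ≠ 0 :=
    mul_ne_zero X_ne_zero (Finset.prod_ne_zero_iff.2 fun j _ => (hg'.2.1 j).ne_zero)
  obtain ⟨μ, hμ⟩ := exists_eval_ne_zero_of_natDegree_lt_card _ hne
    (by simpa using Cardinal.nat_lt_continuum _)
  rw [eval_mul, eval_X, eval_prod, mul_ne_zero_iff, Finset.prod_ne_zero_iff] at hμ
  have h2 := (hg'.rank_eq_iff (evalRingHom μ)).2 fun j => hμ.2 j (Finset.mem_univ j)
  rw [hg'.rank_ratMatrix, ← h2, ← h1 μ⁻¹]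
  have : (revMatrix P.1).map (evalRingHom μ) = μ ^ d • evalMatrix (polyMatrix P.1) μ⁻¹ := by
    rw [revMatrix_eq]
    ext a b
    simp [evalMatrix, eval_reflect (natDegree_polyMatrix_le P.1 a b) hμ.1]
  rw [this, rank_smul_eq (pow_ne_zero _ hμ.1)]

/-- Having no elementary divisors depends only on the polynomial. -/
theorem HasEigenstructure.divisors_eq_zero {P : SkewPoly d m} {E E' : Eigenstructure}
    (h : HasEigenstructure P E) (hfin : ∀ μ, E.finiteDivisors μ = 0)
    (hinf : E.infiniteDivisors = 0) (h' : HasEigenstructure P E') :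
    (∀ μ, E'.finiteDivisors μ = 0) ∧ E'.infiniteDivisors = 0 := by
  have hr := (h.rank_eq hfin hinf).1
  obtain ⟨-, ⟨r, g, hg, hE⟩, -, -⟩ := h
  obtain ⟨⟨r₁, g₁, hg₁, hE₁⟩, ⟨r₂, g₂, hg₂, hE₂⟩, -, -⟩ := h'
  constructor
  · intro μ
    rw [hE₁, hg₁.elemDivExponents_eq_zero_iff, hr]
  · rw [hE₂, hg₂.elemDivExponents_eq_zero_iff, ← hg.elemDivExponents_eq_zero_iff, ← hE, hinf]

theorem ratMatrix_mulVec_ratVec (M : Matrix (Fin m) (Fin m) ℂ[X]) (x : Fin m → ℂ[X]) :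
    ratMatrix M *ᵥ ratVec x = ratVec (M *ᵥ x) := by
  ext1 a
  simp [ratMatrix, ratVec, mulVec, dotProduct]

/-- Independence at every point comes from minimality. Without elementary divisors the rank is `m -
k` everywhere, so each range, being orthogonal to the `k` kernel vectors, is their full orthogonal
complement. -/
theorem HasEigenstructure.goodKernel {P : SkewPoly d m} {E : Eigenstructure}
    (h : HasEigenstructure P E) (hfin : ∀ μ, E.finiteDivisors μ = 0)
    (hinf : E.infiniteDivisors = 0) {x : Fin k → Fin m → ℂ[X]}
    (hx : IsMinimalBasis (rightNullSpace (polyMatrix P.1)) x) :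
    GoodKernel (polyMatrix P.1) d (fun j => vecDegree (x j)) x := by
  obtain ⟨h1, h2⟩ := h.rank_eq hfin hinf
  have hk : (ratMatrix (polyMatrix P.1)).rank + k = m := by
    have := rank_add_finrank_ker (ratMatrix (polyMatrix P.1))
    rwa [show Module.finrank (RatFunc ℂ) (LinearMap.ker (ratMatrix (polyMatrix P.1)).mulVecLin) = k
      from hx.1.finrank_eq] at this
  have hker : ∀ j, polyMatrix P.1 *ᵥ x j = 0 := by
    intro j
    apply ratVec_injective
    rw [← ratMatrix_mulVec_ratVec, ratVec_zero]
    have : ratVec (x j) ∈ rightNullSpace (polyMatrix P.1) := by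
      rw [← (isPolyBasis_iff.1 hx.1).2]
      exact Submodule.subset_span ⟨j, rfl⟩
    exact this
  have hskew := polyMatrix_transpose P
  have hlead : ∀ j, coeffMatrix (polyMatrix P.1) d *ᵥ
      (fun a => (x j a).coeff (vecDegree (x j))) = 0 := by
    intro j
    ext1 a
    have := congrArg (fun p => p.coeff (d + vecDegree (x j))) (congrFun (hker j) a)
    simp only [mulVec, dotProduct, finsetSum_coeff, Pi.zero_apply, coeff_zero] at this
    rw [Pi.zero_apply, ← this]
    simp only [mulVec, dotProduct, coeffMatrix, map_apply]
    exact Finset.sum_congr rfl fun b _ => (coeff_mul_add (natDegree_polyMatrix_le P.1 a b)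
      (natDegree_le_vecDegree (x j) b)).symm
  refine ⟨hskew, natDegree_polyMatrix_le P.1, hker, fun j a => natDegree_le_vecDegree _ _,
    hx.indep_eval, hx.indep_lead, fun μ v hv => ?_, fun v hv => ?_⟩
  · refine exists_mulVec_eq_of_orthogonal ?_ (hx.indep_eval μ) (fun j => ?_) ?_ v hv
    · ext a b
      have := congrFun (congrFun hskew a) b
      simp only [transpose_apply, Matrix.neg_apply] at this
      simp [evalMatrix, this]
    · rw [← eval_mulVec, hker]
      simp; rfl
    · have := rank_add_finrank_ker (evalMatrix (polyMatrix P.1) μ)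
      rw [h1] at this
      rw [Fintype.card_fin]
      omega
  · refine exists_mulVec_eq_of_orthogonal ?_ hx.indep_lead hlead ?_ v hv
    · ext a b
      have := congrFun (congrFun hskew a) b
      simp only [transpose_apply, Matrix.neg_apply] at this
      simp [coeffMatrix, this]
    · have := rank_add_finrank_ker (coeffMatrix (polyMatrix P.1) d)
      rw [h2] at this
      rw [Fintype.card_fin]
      omega

theorem leftNullSpace_eq_rightNullSpace {M : Matrix (Fin m) (Fin m) ℂ[X]} (h : Mᵀ = -M) :
    leftNullSpace M = rightNullSpace M := by
  have hr : (ratMatrix M)ᵀ = -ratMatrix M := by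
    rw [ratMatrix, ← transpose_map, h]
    ext a b
    simp
  ext v
  simp only [leftNullSpace, rightNullSpace, LinearMap.mem_ker, mulVecLin_apply,
    vecMulLinear_apply]
  rw [← mulVec_transpose, hr, neg_mulVec, neg_eq_zero]

theorem GoodKernel.isPolyBasis {M : Matrix (Fin m) (Fin m) ℂ[X]} {ε : Fin k → ℕ}
    {x : Fin k → Fin m → ℂ[X]} (h : GoodKernel M d ε x) : IsPolyBasis (rightNullSpace M) x := by
  have hind : LinearIndependent (RatFunc ℂ) (fun i => ratVec (x i)) := by
    rw [← LinearIndependent.iff_fractionRing ℂ[X] (RatFunc ℂ), Fintype.linearIndependent_iff]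
    intro u hu j
    have : ratVec (∑ j, u j • x j) = ratVec 0 := by
      rw [ratVec_sum_smul, ratVec_zero, ← hu]
      refine Finset.sum_congr rfl fun j _ => ?_
      ext a
      simp [Algebra.smul_def]
    exact congrFun (h.eq_zero_of_sum_smul_eq_zero (ratVec_injective this)) j
  rw [isPolyBasis_iff]
  refine ⟨hind, ?_⟩
  apply Submodule.eq_of_le_of_finrank_le
  · rw [Submodule.span_le]
    rintro _ ⟨j, rfl⟩
    simp only [SetLike.mem_coe, rightNullSpace, LinearMap.mem_ker, mulVecLin_apply]
    rw [ratMatrix_mulVec_ratVec, h.ker, ratVec_zero]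
  · rw [finrank_span_eq_card hind, Fintype.card_fin]
    obtain ⟨r, hr, hM⟩ := h.exists_smith
    have h1 := hM.rank_ratMatrix
    have h2 := rank_add_finrank_ker (ratMatrix M)
    rw [rightNullSpace]
    omega

theorem elemDivExponents_one {r : ℕ} (μ : ℂ) :
    elemDivExponents (fun _ : Fin r => (1 : ℂ[X])) μ = 0 := by
  rw [elemDivExponents, Multiset.filter_eq_nil]
  intro a ha
  obtain ⟨j, -, rfl⟩ := Multiset.mem_map.1 ha
  simp [rootMultiplicity_eq_zero]

/-- The trivial Smith form of `P` excludes finite elementary divisors, and that of its reversal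
excludes infinite ones. The basis is minimal by the degree comparison, and skew-symmetry identifies
left and right indices. -/
theorem GoodKernel.hasEigenstructure {P : SkewPoly d m} {ε : Fin k → ℕ}
    {x : Fin k → Fin m → ℂ[X]} (h : GoodKernel (polyMatrix P.1) d ε x) {E : Eigenstructure}
    (hfin : ∀ μ, E.finiteDivisors μ = 0) (hinf : E.infiniteDivisors = 0)
    (hl : E.leftIndices = Finset.univ.val.map ε) (hr : E.rightIndices = Finset.univ.val.map ε) :
    HasEigenstructure P E := by
  have hmin : HasMinimalIndices (rightNullSpace (polyMatrix P.1)) (Finset.univ.val.map ε) := by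
    refine ⟨k, x, isMinimalBasis_of_indep h.isPolyBasis h.deg_basis h.indep_eval h.indep_lead, ?_⟩
    congr 1
    funext j
    exact (vecDegree_eq h.deg_basis h.indep_lead j).symm
  obtain ⟨r, -, hM⟩ := h.exists_smith
  obtain ⟨r', -, hM'⟩ := h.reverse.exists_smith
  refine ⟨⟨r, _, hM, fun μ => ?_⟩, ⟨r', fun _ => 1, ?_, ?_⟩, ?_, ?_⟩
  · rw [hfin, elemDivExponents_one]
  · rw [revMatrix_eq]; exact hM'
  · rw [hinf, elemDivExponents_one]
  · rw [leftNullSpace_eq_rightNullSpace h.skew, hl]; exact hmin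
  · rw [hr]; exact hmin

end Eigen

end

section

variable {ι κ : Type} [Fintype ι] [Fintype κ]

/-! ### Families of linear maps -/

section Families
open Filter Topology
variable {E : Type*} [NormedAddCommGroup E] [NormedSpace ℂ E] {P : E}
variable {V : Type*} [AddCommGroup V] [Module ℂ V]
variable {σ : Type} [Fintype σ] [DecidableEq σ]

theorem analyticAt_det {A : E → Matrix σ σ ℂ} (hA : ∀ i j, AnalyticAt ℂ (fun Q => A Q i j) P) :
    AnalyticAt ℂ (fun Q => (A Q).det) P := by
  simp only [det_apply']
  refine Finset.analyticAt_fun_sum _ fun σ _ => ?_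
  exact analyticAt_const.mul (Finset.analyticAt_fun_prod _ fun i _ => hA _ _)

theorem linear_apply_eq_sum (φ : (σ → ℂ) →ₗ[ℂ] ℂ) (y : σ → ℂ) :
    φ y = ∑ s, y s * φ (Pi.single s 1) := by
  have : y = ∑ s, y s • (Pi.single s (1 : ℂ) : σ → ℂ) := by
    ext b; simp [Finset.sum_apply, Pi.single_apply]
  conv_lhs => rw [this]
  simp only [map_sum, map_smul, smul_eq_mul]

theorem analyticAt_linear_apply (φ : (σ → ℂ) →ₗ[ℂ] ℂ) {y : E → σ → ℂ}
    (hy : ∀ s, AnalyticAt ℂ (fun Q => y Q s) P) : AnalyticAt ℂ (fun Q => φ (y Q)) P := by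
  rw [funext fun Q => linear_apply_eq_sum φ (y Q)]
  exact Finset.analyticAt_fun_sum _ fun s _ => (hy s).mul analyticAt_const

/-- Composing with a right inverse of `f P` gives a square matrix with determinant `1` at `P`, hence
a nonzero determinant nearby. -/
theorem eventually_surjective {f : E → V →ₗ[ℂ] (σ → ℂ)}
    (hf : ∀ v s, ContinuousAt (fun Q => f Q v s) P) (hP : Function.Surjective (f P)) :
    ∀ᶠ Q in 𝓝 P, Function.Surjective (f Q) := by
  obtain ⟨R, hR⟩ := LinearMap.exists_rightInverse_of_surjective (f P) (LinearMap.range_eq_top.2 hP)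
  have hdet : ContinuousAt (fun Q => (LinearMap.toMatrix' (f Q ∘ₗ R)).det) P := by
    simp only [det_apply']
    refine tendsto_finsetSum _ fun τ _ => ?_
    refine tendsto_const_nhds.mul (tendsto_finsetProd _ fun i _ => ?_)
    simp only [LinearMap.toMatrix'_apply, LinearMap.comp_apply]
    exact hf _ _
  have hne : (LinearMap.toMatrix' (f P ∘ₗ R)).det ≠ 0 := by
    rw [hR, LinearMap.toMatrix'_id, det_one]
    exact one_ne_zero
  filter_upwards [hdet.eventually_ne hne] with Q hQ
  have hu : IsUnit (LinearMap.toMatrix' (f Q ∘ₗ R)) :=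
    (Matrix.isUnit_iff_isUnit_det _).2 (isUnit_iff_ne_zero.2 hQ)
  intro y
  obtain ⟨c, hc⟩ := Matrix.mulVec_surjective_iff_isUnit.2 hu y
  rw [LinearMap.toMatrix'_mulVec] at hc
  exact ⟨R c, hc⟩

theorem eventually_injective [FiniteDimensional ℂ V] {f : E → V →ₗ[ℂ] (σ → ℂ)}
    (hf : ∀ v s, ContinuousAt (fun Q => f Q v s) P) (hP : Function.Injective (f P)) :
    ∀ᶠ Q in 𝓝 P, Function.Injective (f Q) := by
  obtain ⟨L, hL⟩ := LinearMap.exists_leftInverse_of_injective (f P) (LinearMap.ker_eq_bot.2 hP)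
  let b := Module.finBasis ℂ V
  let F : E → V →ₗ[ℂ] (Fin (Module.finrank ℂ V) → ℂ) := fun Q =>
    b.equivFun.toLinearMap ∘ₗ L ∘ₗ f Q
  have hF : ∀ v s, ContinuousAt (fun Q => F Q v s) P := by
    intro v s
    have : ∀ Q, F Q v s = ∑ t, f Q v t * (b.equivFun (L (Pi.single t 1))) s := by
      intro Q
      exact linear_apply_eq_sum (LinearMap.proj s ∘ₗ b.equivFun.toLinearMap ∘ₗ L) (f Q v)
    simp only [this]
    exact tendsto_finsetSum _ fun t _ => (hf v t).mul tendsto_const_nhds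
  have hFP : Function.Surjective (F P) := by
    have : F P = b.equivFun.toLinearMap := by
      simp only [F, hL, LinearMap.comp_id]
    rw [this]
    exact b.equivFun.surjective
  filter_upwards [eventually_surjective hF hFP] with Q hQ
  have hinj : Function.Injective (F Q) :=
    (LinearMap.injective_iff_surjective_of_finrank_eq_finrank (by simp)).2 hQ
  intro v w hvw
  apply hinj
  simp only [F, LinearMap.comp_apply, hvw]

/-- Cramer's rule for families of isomorphisms. -/
theorem exists_analytic_solution {f : E → V →ₗ[ℂ] (σ → ℂ)}
    (hf : ∀ v s, AnalyticAt ℂ (fun Q => f Q v s) P) (hP : Function.Bijective (f P))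
    {y : E → σ → ℂ} (hy : ∀ s, AnalyticAt ℂ (fun Q => y Q s) P) :
    ∃ w : E → V, (∀ φ : V →ₗ[ℂ] ℂ, AnalyticAt ℂ (fun Q => φ (w Q)) P) ∧
      ∀ᶠ Q in 𝓝 P, f Q (w Q) = y Q := by
  let e := LinearEquiv.ofBijective (f P) hP
  let R : (σ → ℂ) →ₗ[ℂ] V := e.symm.toLinearMap
  have hR : f P ∘ₗ R = LinearMap.id := by
    ext1 c
    exact LinearMap.ext fun z => e.apply_symm_apply _
  let A : E → Matrix σ σ ℂ := fun Q => LinearMap.toMatrix' (f Q ∘ₗ R)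
  have hA : ∀ i j, AnalyticAt ℂ (fun Q => A Q i j) P := by
    intro i j
    simp only [A, LinearMap.toMatrix'_apply, LinearMap.comp_apply]
    exact hf _ _
  have hdet := analyticAt_det hA
  have hne : (A P).det ≠ 0 := by
    simp only [A]
    rw [hR, LinearMap.toMatrix'_id, det_one]
    exact one_ne_zero
  refine ⟨fun Q => R ((A Q).det⁻¹ • cramer (A Q) (y Q)), fun φ => ?_, ?_⟩
  · refine analyticAt_linear_apply (φ ∘ₗ R) fun s => ?_
    simp only [Pi.smul_apply, smul_eq_mul, cramer_apply]
    refine (hdet.inv hne).mul (analyticAt_det fun i j => ?_)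
    by_cases h : j = s
    · subst h
      simpa using hy i
    · simpa [updateCol_apply, h] using hA i j
  · filter_upwards [hdet.continuousAt.eventually_ne hne] with Q hQ
    change (f Q ∘ₗ R) _ = _
    rw [← LinearMap.toMatrix'_mulVec, mulVec_smul]
    change (A Q).det⁻¹ • (A Q *ᵥ cramer (A Q) (y Q)) = y Q
    rw [mulVec_cramer, smul_smul, inv_mul_cancel₀ hQ, one_smul]

/-- A vector in the kernel of a member of an analytic family of linear maps extends to an analytic
family of vectors whose images lie in a complement of the range. -/
theorem exists_analytic_kernel [FiniteDimensional ℂ V] {T : E → V →ₗ[ℂ] (σ → ℂ)}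
    (hT : ∀ v s, AnalyticAt ℂ (fun Q => T Q v s) P) :
    ∃ C : Submodule ℂ (σ → ℂ), Disjoint (LinearMap.range (T P)) C ∧
      (∀ᶠ Q in 𝓝 P, ∀ y, ∃ v, y - T Q v ∈ C) ∧
      ∀ x : V, T P x = 0 → ∃ ξ : E → V, ξ P = x ∧
        (∀ φ : V →ₗ[ℂ] ℂ, AnalyticAt ℂ (fun Q => φ (ξ Q)) P) ∧
        ∀ᶠ Q in 𝓝 P, T Q (ξ Q) ∈ C ∧ (Module.finrank ℂ (LinearMap.ker (T Q)) =
          Module.finrank ℂ (LinearMap.ker (T P)) → T Q (ξ Q) = 0) := by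
  obtain ⟨C, hC⟩ := Submodule.exists_isCompl (LinearMap.range (T P))
  obtain ⟨V', hV'⟩ := Submodule.exists_isCompl (LinearMap.ker (T P))
  -- With `V'` a complement of the kernel and `C` one of the range, `Φ P` is bijective. Solving `Φ Q
  -- w = T Q x` analytically and subtracting the `V'` part of `w` from `x` leaves a vector with
  -- image in `C`.
  let Φ : E → (V' × C) →ₗ[ℂ] (σ → ℂ) := fun Q =>
    LinearMap.coprod (T Q ∘ₗ V'.subtype) C.subtype
  have hΦ : ∀ Q w, Φ Q w = T Q w.1 + w.2 := fun Q w => rfl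
  have hΦa : ∀ w s, AnalyticAt ℂ (fun Q => Φ Q w s) P := by
    intro w s
    simp only [hΦ, Pi.add_apply]
    exact (hT _ _).add analyticAt_const
  have hΦP : Function.Bijective (Φ P) := by
    constructor
    · rw [injective_iff_map_eq_zero]
      rintro ⟨v, c⟩ h
      rw [hΦ] at h
      have hc : (c : σ → ℂ) ∈ LinearMap.range (T P) :=
        ⟨-v, by rw [map_neg]; exact (eq_neg_of_add_eq_zero_right h).symm⟩
      have hc0 : (c : σ → ℂ) = 0 := Submodule.disjoint_def.1 hC.disjoint _ hc c.2
      simp only [hc0, add_zero] at h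
      have hv0 : (v : V) = 0 := Submodule.disjoint_def.1 hV'.disjoint _ h v.2
      exact Prod.ext (Subtype.ext hv0) (Subtype.ext hc0)
    · intro y
      obtain ⟨z, ⟨v, rfl⟩, c, hc, rfl⟩ := Submodule.mem_sup.1
        (hC.sup_eq_top ▸ (Submodule.mem_top : y ∈ ⊤))
      obtain ⟨a, ha, b, hb, rfl⟩ := Submodule.mem_sup.1
        (hV'.sup_eq_top ▸ (Submodule.mem_top : v ∈ ⊤))
      refine ⟨(⟨b, hb⟩, ⟨c, hc⟩), ?_⟩
      rw [hΦ, map_add, show T P a = 0 from ha, zero_add]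
  have hinj := eventually_injective (fun v s => (hΦa v s).continuousAt) hΦP.1
  have hsur := eventually_surjective (fun v s => (hΦa v s).continuousAt) hΦP.2
  refine ⟨C, hC.disjoint, ?_, fun x hx => ?_⟩
  · filter_upwards [hsur] with Q hQ y
    obtain ⟨w, hw⟩ := hQ y
    refine ⟨w.1, ?_⟩
    rw [← hw, hΦ, add_sub_cancel_left]
    exact w.2.2
  obtain ⟨w, hw, hwQ⟩ := exists_analytic_solution hΦa hΦP (y := fun Q => T Q x) (hT x)
  have hwP : w P = 0 := by
    apply hΦP.1
    rw [hwQ.self_of_nhds, hx, map_zero]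
  refine ⟨fun Q => x - (w Q).1, by simp [hwP], fun φ => ?_, ?_⟩
  · simp only [map_sub]
    exact analyticAt_const.sub (hw (φ ∘ₗ V'.subtype ∘ₗ LinearMap.fst ℂ V' C))
  · filter_upwards [hwQ, hinj] with Q hQ hQinj
    have hTξ : T Q (x - (w Q).1) = (w Q).2 := by
      rw [map_sub, ← hQ, hΦ, add_sub_cancel_left]
    refine ⟨by rw [hTξ]; exact (w Q).2.2, fun hrank => ?_⟩
    -- If the kernel keeps its dimension, `V'` is still a complement of it. Then `T Q x` is already
    -- attained on `V'`, and injectivity of `Φ Q` forces the component in `C` to vanish.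
    have hdisj : Disjoint (LinearMap.ker (T Q)) V' := by
      rw [Submodule.disjoint_def]
      intro v hv hv'
      have : (⟨v, hv'⟩, 0) = (0 : V' × C) := by
        apply hQinj
        rw [hΦ, map_zero]
        simpa using hv
      exact congrArg (fun z : V' × C => (z.1 : V)) this
    have htop : LinearMap.ker (T Q) ⊔ V' = ⊤ := by
      apply Submodule.eq_top_of_finrank_eq
      have h1 := Submodule.finrank_sup_add_finrank_inf_eq (LinearMap.ker (T Q)) V'
      have h2 := Submodule.finrank_sup_add_finrank_inf_eq (LinearMap.ker (T P)) V'
      rw [hdisj.eq_bot, finrank_bot] at h1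
      rw [hV'.inf_eq_bot, hV'.sup_eq_top, finrank_bot, finrank_top] at h2
      omega
    obtain ⟨a, ha, b, hb, hab⟩ := Submodule.mem_sup.1 (htop ▸ (Submodule.mem_top : x ∈ ⊤))
    have hTa : T Q a = 0 := ha
    have : (⟨b, hb⟩, 0) = w Q := by
      apply hQinj
      rw [hQ, hΦ, ← hab, map_add, hTa]
      simp
    rw [hTξ, ← this]
    simp

end Families

/-! ### Polynomials depending analytically on a parameter -/

section CoeffAnalytic
variable {E : Type*} [NormedAddCommGroup E] [NormedSpace ℂ E] {P : E}

/-- The coefficients of the polynomial `p Q` depend analytically on `Q` near `P`. -/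
def CoeffAnalyticAt (p : E → ℂ[X]) (P : E) : Prop :=
  ∀ s, AnalyticAt ℂ (fun Q => (p Q).coeff s) P

theorem CoeffAnalyticAt.const (p : ℂ[X]) : CoeffAnalyticAt (fun _ => p) P :=
  fun _ => analyticAt_const

theorem CoeffAnalyticAt.sub {p q : E → ℂ[X]} (hp : CoeffAnalyticAt p P)
    (hq : CoeffAnalyticAt q P) : CoeffAnalyticAt (fun Q => p Q - q Q) P := by
  intro s
  simp only [coeff_sub]
  exact (hp s).sub (hq s)

theorem CoeffAnalyticAt.mul {p q : E → ℂ[X]} (hp : CoeffAnalyticAt p P)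
    (hq : CoeffAnalyticAt q P) : CoeffAnalyticAt (fun Q => p Q * q Q) P := by
  intro s
  simp only [coeff_mul]
  exact Finset.analyticAt_fun_sum _ fun t _ => (hp _).mul (hq _)

theorem CoeffAnalyticAt.sum {α : Type*} {s : Finset α} {p : α → E → ℂ[X]}
    (hp : ∀ i ∈ s, CoeffAnalyticAt (p i) P) : CoeffAnalyticAt (fun Q => ∑ i ∈ s, p i Q) P := by
  intro t
  simp only [finsetSum_coeff]
  exact Finset.analyticAt_fun_sum _ fun i hi => hp i hi t

theorem CoeffAnalyticAt.dotProduct {u v : E → ι → ℂ[X]}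
    (hu : ∀ a, CoeffAnalyticAt (fun Q => u Q a) P) (hv : ∀ a, CoeffAnalyticAt (fun Q => v Q a) P) :
    CoeffAnalyticAt (fun Q => u Q ⬝ᵥ v Q) P :=
  CoeffAnalyticAt.sum fun a _ => (hu a).mul (hv a)

theorem CoeffAnalyticAt.mulVec {M : E → Matrix ι ι ℂ[X]} {v : E → ι → ℂ[X]}
    (hM : ∀ a b, CoeffAnalyticAt (fun Q => M Q a b) P)
    (hv : ∀ a, CoeffAnalyticAt (fun Q => v Q a) P) (a : ι) :
    CoeffAnalyticAt (fun Q => (M Q *ᵥ v Q) a) P :=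
  CoeffAnalyticAt.dotProduct (hM a) hv

/-- A scalar product of two families vanishing at `P` vanishes to second order at `P`. -/
theorem hasFDerivAt_coeff_dotProduct {u v : E → ι → ℂ[X]}
    (hu : ∀ a, CoeffAnalyticAt (fun Q => u Q a) P) (hv : ∀ a, CoeffAnalyticAt (fun Q => v Q a) P)
    (hu0 : u P = 0) (hv0 : v P = 0) (s : ℕ) :
    HasFDerivAt (fun Q => (u Q ⬝ᵥ v Q).coeff s) (0 : E →L[ℂ] ℂ) P := by
  simp only [dotProduct, finsetSum_coeff, coeff_mul]
  have : (0 : E →L[ℂ] ℂ) = ∑ a : ι, ∑ t ∈ Finset.HasAntidiagonal.antidiagonal s, 0 := by simp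
  rw [this]
  refine HasFDerivAt.fun_sum fun a _ => HasFDerivAt.fun_sum fun t _ => ?_
  have h1 := (hu a t.1).differentiableAt.hasFDerivAt
  have h2 := (hv a t.2).differentiableAt.hasFDerivAt
  have e1 : (u P a).coeff t.1 = 0 := by rw [hu0]; simp
  have e2 : (v P a).coeff t.2 = 0 := by rw [hv0]; simp
  refine (h1.mul h2).congr_fderiv ?_
  ext w
  simp [e1, e2]

end CoeffAnalytic

end

section

variable {ι κ : Type} [Fintype ι] [Fintype κ]

/-! ### Deformations of the kernel -/

theorem dotProduct_mem_polyLT {x : κ → ι → ℂ[X]} {ε : κ → ℕ}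
    (hx : ∀ j a, (x j a).natDegree ≤ ε j) {y : ι → ℂ[X]} {N : ℕ}
    (hy : y ∈ polyLT (fun _ : ι => N)) : (fun j => x j ⬝ᵥ y) ∈ polyLT (fun j => N + ε j) := by
  intro j s hs
  simp only [dotProduct, finsetSum_coeff]
  exact Finset.sum_eq_zero fun a _ =>
    coeff_mul_eq_zero (hx j a) (hy a) (by simp only at hs ⊢; omega)

/-- Surjectivity and exactness in a single degree give surjectivity and exactness everywhere. -/
theorem goodKernel_of_exact {M : Matrix ι ι ℂ[X]} {d : ℕ} (hd : 1 ≤ d) {ε : κ → ℕ}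
    {x : κ → ι → ℂ[X]} (skew : Mᵀ = -M) (deg : ∀ a b, (M a b).natDegree ≤ d)
    (ker : ∀ j, M *ᵥ x j = 0) (deg_basis : ∀ j a, (x j a).natDegree ≤ ε j) (n : ℕ)
    (hsurj : ∀ p ∈ polyLT (fun j => d + n + ε j), ∃ y ∈ polyLT (fun _ : ι => d + n),
      ∀ j, x j ⬝ᵥ y = p j)
    (hexact : ∀ z ∈ polyLT (fun _ : ι => d + (n + 1)), (∀ j, x j ⬝ᵥ z = 0) →
      ∃ u ∈ polyLT (fun _ : ι => n + 1), M *ᵥ u = z) : GoodKernel M d ε x := by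
  classical
  have hlead : ∀ (j : κ) (y : ι → ℂ[X]) (N : ℕ), y ∈ polyLT (fun _ : ι => N + 1) →
      (x j ⬝ᵥ y).coeff (ε j + N) =
        (fun a => (x j a).coeff (ε j)) ⬝ᵥ fun a => (y a).coeff N := by
    intro j y N hy
    simp only [dotProduct, finsetSum_coeff]
    exact Finset.sum_congr rfl fun a _ =>
      coeff_mul_add (deg_basis j a) (natDegree_le_of_mem_polyLT hy a)
  refine ⟨skew, deg, ker, deg_basis, fun μ => ?_, ?_, fun μ v hv => ?_, fun v hv => ?_⟩
  · rw [Fintype.linearIndependent_iff]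
    intro c hc i
    obtain ⟨y, -, hy⟩ := hsurj (fun j => if j = i then 1 else 0) (by
      intro j s hs
      simp only at hs ⊢
      split_ifs
      · rw [coeff_one, if_neg (by omega)]
      · simp)
    have h0 := congrArg (fun w => w ⬝ᵥ fun a => (y a).eval μ) hc
    simp only [sum_smul_dotProduct, ← eval_dotProduct, hy, zero_dotProduct] at h0
    simpa [apply_ite (eval μ)] using h0
  · rw [Fintype.linearIndependent_iff]
    intro c hc i
    -- The exponent is the largest one allowed, so the top coefficients of `y` pair with the leading
    -- vectors to give the Kronecker symbol. It is here that `1 ≤ d` is needed.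
    obtain ⟨y, hylt, hy⟩ := hsurj (fun j => if j = i then X ^ (ε j + (d + n - 1)) else 0) (by
      intro j s hs
      simp only at hs ⊢
      split_ifs
      · rw [coeff_X_pow, if_neg (by omega)]
      · simp)
    have hylt' : y ∈ polyLT (fun _ : ι => (d + n - 1) + 1) := by
      rwa [show d + n - 1 + 1 = d + n by omega]
    have h0 := congrArg (fun w => w ⬝ᵥ fun a => (y a).coeff (d + n - 1)) hc
    simp only [sum_smul_dotProduct, ← hlead _ y _ hylt', hy, zero_dotProduct] at h0
    rw [Finset.sum_eq_single i] at h0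
    · simpa using h0
    · intro j _ hj
      simp [hj]
    · simp
  -- If `y` realizes the quotients `q`, then `v - (X - μ) y` is orthogonal to the basis, hence
  -- equals `M u`; its value at `μ` is `v`.
  · have hq : ∀ j, ∃ q, (x j ⬝ᵥ fun a => C (v a)) = (X - C μ) * q := by
      intro j
      apply dvd_iff_isRoot.2
      rw [IsRoot.def, eval_dotProduct]
      simpa using hv j
    choose q hq using hq
    have hqlt : q ∈ polyLT (fun j => d + n + ε j) := by
      intro j s hs
      simp only at hs
      have h1 : ((X - C μ) * q j).natDegree ≤ ε j := by
        rw [← hq j]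
        refine natDegree_sum_le_of_forall_le _ _ fun a _ => ?_
        exact (natDegree_mul_C_le _ _).trans (deg_basis j a)
      by_cases h0 : q j = 0
      · simp [h0]
      · rw [natDegree_mul (X_sub_C_ne_zero μ) h0, natDegree_X_sub_C] at h1
        exact coeff_eq_zero_of_natDegree_lt (by omega)
    obtain ⟨y, hylt, hy⟩ := hsurj q hqlt
    obtain ⟨u, -, hu⟩ := hexact ((fun a => C (v a)) - (X - C μ) • y) (by
        intro a s hs
        simp only at hs
        have e1 : (C (v a)).coeff s = 0 := by rw [coeff_C, if_neg (by omega)]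
        have e2 : ((X - C μ) * y a).coeff s = 0 :=
          coeff_mul_eq_zero (natDegree_X_sub_C_le μ) (hylt a) (by simp only; omega)
        simp only [Pi.sub_apply, Pi.smul_apply, smul_eq_mul, coeff_sub, e1, e2, sub_zero]) (by
        intro j
        rw [dotProduct_sub, dotProduct_smul, hy, hq, smul_eq_mul, sub_self])
    refine ⟨fun a => (u a).eval μ, ?_⟩
    rw [← eval_mulVec, hu]
    ext a
    simp
  -- The same argument at infinity: orthogonality of `v` to the leading vectors lowers the degree of
  -- the pairings, so some `y` of degree less than `d + n` has the same pairings as `X ^ (d + n) v`.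
  -- The difference is an image with top coefficient `v`.
  · obtain ⟨y, hylt, hy⟩ := hsurj (fun j => x j ⬝ᵥ ((X : ℂ[X]) ^ (d + n) • fun a => C (v a))) (by
      intro j s hs
      have hX := GoodKernel.X_pow_smul_mem_polyLT (e := d + n) (GoodKernel.C_mem_polyLT v)
      rcases Nat.lt_or_ge (d + n + ε j) s with hs' | hs'
      · exact dotProduct_mem_polyLT deg_basis hX j s (by simp only; omega)
      · obtain rfl : s = ε j + (d + n) := by simp only at hs; omega
        rw [add_comm 1] at hX
        rw [hlead j _ _ hX, ← hv j]
        congr 1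
        ext a
        simp)
    have hX := GoodKernel.X_pow_smul_mem_polyLT (e := d + n) (GoodKernel.C_mem_polyLT v)
    obtain ⟨u, hult, hu⟩ := hexact (((X : ℂ[X]) ^ (d + n) • fun a => C (v a)) - y) (by
        refine Submodule.sub_mem _ ?_ ?_
        · rwa [show d + (n + 1) = 1 + (d + n) by omega]
        · exact fun a s hs => hylt a s (by simp only at hs ⊢; omega)) (by
        intro j
        rw [dotProduct_sub, hy, sub_self])
    refine ⟨fun a => (u a).coeff n, ?_⟩
    ext a
    have h1 : ((M *ᵥ u) a).coeff (d + n) = (coeffMatrix M d *ᵥ fun a => (u a).coeff n) a := by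
      simp only [mulVec, dotProduct, finsetSum_coeff, coeffMatrix, map_apply]
      exact Finset.sum_congr rfl fun b _ =>
        coeff_mul_add (deg a b) (natDegree_le_of_mem_polyLT hult b)
    rw [← h1, hu]
    simp [hylt a (d + n) le_rfl]

theorem eq_zero_of_vecCoeff_eq_zero {n : ι → ℕ} {y : ι → ℂ[X]} (hy : y ∈ polyLT n)
    (h : vecCoeff n y = 0) : y = 0 := by
  funext a
  ext s
  by_cases hs : s < n a
  · exact congrFun h ⟨a, ⟨s, hs⟩⟩
  · exact hy a s (not_lt.1 hs)

/-- The vector polynomial with given coefficients. -/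
def ofCoeff (n : ι → ℕ) : ((Σ a, Fin (n a)) → ℂ) →ₗ[ℂ] (ι → ℂ[X]) :=
  (polyLT n).subtype ∘ₗ (polyLTEquiv n).symm.toLinearMap

theorem ofCoeff_mem (n : ι → ℕ) (c : (Σ a, Fin (n a)) → ℂ) : ofCoeff n c ∈ polyLT n :=
  ((polyLTEquiv n).symm c).2

theorem vecCoeff_ofCoeff (n : ι → ℕ) (c : (Σ a, Fin (n a)) → ℂ) :
    vecCoeff n (ofCoeff n c) = c := (polyLTEquiv n).apply_symm_apply c

theorem ofCoeff_vecCoeff {n : ι → ℕ} {y : ι → ℂ[X]} (hy : y ∈ polyLT n) :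
    ofCoeff n (vecCoeff n y) = y :=
  congrArg Subtype.val ((polyLTEquiv n).symm_apply_apply ⟨y, hy⟩)

section Local
open Filter Topology
variable {d m k : ℕ}

theorem coeffAnalyticAt_polyMatrix (P : SkewPoly d m) (a b : Fin m) :
    CoeffAnalyticAt (fun Q : SkewPoly d m => polyMatrix Q.1 a b) P := by
  intro s
  simp only [coeff_polyMatrix]
  split_ifs with h
  · let f : SkewPoly d m →ₗ[ℂ] ℂ :=
      { toFun := fun Q => Q.1 ⟨s, h⟩ a b
        map_add' := fun Q R => rfl
        map_smul' := fun c Q => rfl }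
    exact f.toContinuousLinearMap.analyticAt P
  · exact analyticAt_const

theorem polyMatrix_mulVec_mem_polyLT (Q : SkewPoly d m) {v : Fin m → ℂ[X]} {n : ℕ}
    (hv : v ∈ polyLT (fun _ : Fin m => n)) :
    polyMatrix Q.1 *ᵥ v ∈ polyLT (fun _ : Fin m => d + n) := by
  intro a s hs
  simp only [mulVec, dotProduct, finsetSum_coeff]
  exact Finset.sum_eq_zero fun b _ =>
    coeff_mul_eq_zero (natDegree_polyMatrix_le Q.1 a b) (hv b) hs

/-- Multiplication by a matrix polynomial on the vector polynomials of degree less than `n`. -/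
def mulCoeff (n : ℕ) (Q : SkewPoly d m) :
    polyLT (fun _ : Fin m => n) →ₗ[ℂ] ((Σ _ : Fin m, Fin (d + n)) → ℂ) :=
  vecCoeff (fun _ : Fin m => d + n) ∘ₗ
    ((polyMatrix Q.1).mulVecLin.restrictScalars ℂ) ∘ₗ Submodule.subtype _

theorem mulCoeff_apply (n : ℕ) (Q : SkewPoly d m) (v : polyLT (fun _ : Fin m => n)) :
    mulCoeff n Q v = vecCoeff (fun _ => d + n) (polyMatrix Q.1 *ᵥ v.1) := rfl

theorem mulCoeff_eq_zero_iff (n : ℕ) (Q : SkewPoly d m) (v : polyLT (fun _ : Fin m => n)) :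
    mulCoeff n Q v = 0 ↔ polyMatrix Q.1 *ᵥ v.1 = 0 := by
  rw [mulCoeff_apply]
  refine ⟨fun h => eq_zero_of_vecCoeff_eq_zero (polyMatrix_mulVec_mem_polyLT Q v.2) h, fun h => ?_⟩
  rw [h, map_zero]

theorem finrank_ker_mulCoeff (n : ℕ) (Q : SkewPoly d m) :
    Module.finrank ℂ (LinearMap.ker (mulCoeff n Q)) =
      Module.finrank ℂ (kerLT (polyMatrix Q.1) n) := by
  have : kerLT (polyMatrix Q.1) n = (LinearMap.ker (mulCoeff n Q)).map (Submodule.subtype _) := by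
    ext v
    simp only [Submodule.mem_map, LinearMap.mem_ker, mulCoeff_eq_zero_iff, mem_kerLT]
    constructor
    · rintro ⟨h1, h2⟩
      exact ⟨⟨v, h1⟩, h2, rfl⟩
    · rintro ⟨w, hw, rfl⟩
      exact ⟨w.2, hw⟩
  rw [this]
  exact (LinearEquiv.finrank_eq (Submodule.equivMapOfInjective _
    (Submodule.injective_subtype _) _))

/-- The family `ξ Q i` keeps degree at most `ε i`, and `Q ξ Q i` stays in a fixed complement `C i`
of the range at `P`. If the bounded-degree kernels keep their dimensions, these images vanish.
Conversely, pairing with `ξ Q` is injective on `C i` for `Q` near `P`, so the vanishing of all `ξ Q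
i ⬝ᵥ (Q *ᵥ ξ Q j)` also forces `Q ξ Q i = 0`; the remaining exactness conditions are open. -/
theorem exists_local_kernel (hd : 1 ≤ d) (hk : 0 < k) {P : SkewPoly d m} {ε : Fin k → ℕ}
    {x : Fin k → Fin m → ℂ[X]} (h : GoodKernel (polyMatrix P.1) d ε x)
    (hbal : ∀ i j, ε j ≤ ε i + 1) :
    ∃ ξ : SkewPoly d m → Fin k → Fin m → ℂ[X], ξ P = x ∧
      (∀ i a, CoeffAnalyticAt (fun Q => ξ Q i a) P) ∧
      (∀ Q i a, (ξ Q i a).natDegree ≤ ε i) ∧ ∀ᶠ Q in 𝓝 P,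
        ((∀ i, Module.finrank ℂ (kerLT (polyMatrix Q.1) (ε i + 1)) =
            Module.finrank ℂ (kerLT (polyMatrix P.1) (ε i + 1))) →
          ∀ i, polyMatrix Q.1 *ᵥ ξ Q i = 0) ∧
        ((∀ i j, ξ Q i ⬝ᵥ (polyMatrix Q.1 *ᵥ ξ Q j) = 0) →
          GoodKernel (polyMatrix Q.1) d ε (ξ Q)) := by
  have hT : ∀ n (v : polyLT (fun _ : Fin m => n)) s,
      AnalyticAt ℂ (fun Q => mulCoeff (d := d) n Q v s) P := by
    intro n v s
    exact CoeffAnalyticAt.mulVec (fun a b => coeffAnalyticAt_polyMatrix P a b)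
      (fun a => CoeffAnalyticAt.const (v.1 a)) s.1 s.2
  have hex := fun i => exists_analytic_kernel (hT (ε i + 1))
  choose C hCdisj hCsup hC using hex
  have hx : ∀ i, x i ∈ polyLT (fun _ : Fin m => ε i + 1) := fun i a s hs =>
    coeff_eq_zero_of_natDegree_le (h.deg_basis i a) hs
  have hex2 := fun i => hC i ⟨x i, hx i⟩ ((mulCoeff_eq_zero_iff _ _ _).2 (h.ker i))
  choose ξ hξP hξa hξQ using hex2
  have han : ∀ i a, CoeffAnalyticAt (fun Q => (ξ i Q).1 a) P := by
    intro i a s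
    let φ : polyLT (fun _ : Fin m => ε i + 1) →ₗ[ℂ] ℂ :=
      { toFun := fun v => (v.1 a).coeff s
        map_add' := fun v w => by simp
        map_smul' := fun c v => by simp }
    exact hξa i φ
  have hdeg : ∀ Q i a, ((ξ i Q).1 a).natDegree ≤ ε i := fun Q i a =>
    natDegree_le_of_mem_polyLT (ξ i Q).2 a
  refine ⟨fun Q i => (ξ i Q).1, funext fun i => congrArg Subtype.val (hξP i), han, hdeg, ?_⟩
  let pair : (n : ℕ) → SkewPoly d m → (Fin m → ℂ[X]) →ₗ[ℂ] ((Σ j : Fin k, Fin (n + ε j)) → ℂ) :=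
    fun n Q => vecCoeff (fun j => n + ε j) ∘ₗ
      ((Matrix.mulVecLin (Matrix.of fun j => (ξ j Q).1)).restrictScalars ℂ)
  have hpair : ∀ n Q y, pair n Q y = vecCoeff (fun j => n + ε j) fun j => (ξ j Q).1 ⬝ᵥ y :=
    fun n Q y => rfl
  have hpaira : ∀ n y s, ContinuousAt (fun Q => pair n Q y s) P := by
    intro n y s
    exact (CoeffAnalyticAt.dotProduct (fun a => han s.1 a)
      (fun a => CoeffAnalyticAt.const (y a)) s.2).continuousAt
  have hpair0 : ∀ n Q y, y ∈ polyLT (fun _ : Fin m => n) → pair n Q y = 0 →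
      ∀ j, (ξ j Q).1 ⬝ᵥ y = 0 := by
    intro n Q y hy h0 j
    exact congrFun (eq_zero_of_vecCoeff_eq_zero
      (dotProduct_mem_polyLT (x := fun j => (ξ j Q).1) (hdeg Q) hy) h0) j
  have hinj : ∀ i, ∀ᶠ Q in 𝓝 P, Function.Injective
      (pair (d + (ε i + 1)) Q ∘ₗ ofCoeff (fun _ : Fin m => d + (ε i + 1)) ∘ₗ (C i).subtype) := by
    intro i
    refine eventually_injective (fun v s => hpaira _ _ _) ?_
    rw [injective_iff_map_eq_zero]
    intro c hc
    have h1 := hpair0 _ P _ (ofCoeff_mem _ _) hc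
    simp only [hξP] at h1
    -- The balance of the indices enters here: since `ε j ≤ ε i + 1` for all `j`, everything
    -- orthogonal to `x` of degree less than `d + ε i + 1` is the image of a vector of degree at
    -- most `ε i`. An element of `C i` orthogonal to `x` is thus in the range, hence zero.
    obtain ⟨v, hv, hvc⟩ := h.exists_mulVec_eq_of_mem_polyLT (hbal i) (ofCoeff_mem _ _) h1
    apply Subtype.ext
    refine Submodule.disjoint_def.1 (hCdisj i) _ ⟨⟨v, hv⟩, ?_⟩ c.2
    rw [mulCoeff_apply]
    simp only [hvc]
    exact vecCoeff_ofCoeff _ _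
  let i₀ : Fin k := ⟨0, hk⟩
  have hsurj : ∀ᶠ Q in 𝓝 P, Function.Surjective
      (pair (d + ε i₀) Q ∘ₗ ofCoeff (fun _ : Fin m => d + ε i₀)) := by
    refine eventually_surjective (fun v s => hpaira _ _ _) fun c => ?_
    obtain ⟨y, hy, hyc⟩ := h.exists_dotProduct_eq_of_mem_polyLT (Nat.le_add_right d (ε i₀))
      (ofCoeff_mem (fun j => d + ε i₀ + ε j) c)
    refine ⟨vecCoeff _ y, ?_⟩
    rw [LinearMap.comp_apply, ofCoeff_vecCoeff hy, hpair]
    simp only [hξP, hyc]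
    exact vecCoeff_ofCoeff _ _
  have hall := eventually_all.2 hξQ
  have hall2 := eventually_all.2 hinj
  filter_upwards [hall, hall2, hsurj, hCsup i₀] with Q hQ hQinj hQsurj hQsup
  constructor
  · intro hr i
    refine (mulCoeff_eq_zero_iff _ _ _).1 ((hQ i).2 ?_)
    rw [finrank_ker_mulCoeff, finrank_ker_mulCoeff]
    exact hr i
  · intro hzero
    have hzeroC : ∀ i (c : C i),
        (∀ j, (ξ j Q).1 ⬝ᵥ ofCoeff (fun _ : Fin m => d + (ε i + 1)) c = 0) → c = 0 := by
      intro i c hc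
      apply hQinj i
      rw [map_zero]
      change vecCoeff _ (fun j => (ξ j Q).1 ⬝ᵥ ofCoeff (fun _ : Fin m => d + (ε i + 1)) c) = 0
      rw [funext hc]
      exact map_zero _
    have hker : ∀ i, polyMatrix Q.1 *ᵥ (ξ i Q).1 = 0 := by
      intro i
      refine (mulCoeff_eq_zero_iff _ _ _).1 ?_
      refine congrArg Subtype.val (hzeroC i ⟨_, (hQ i).1⟩ fun j => ?_)
      simp only [mulCoeff_apply]
      rw [ofCoeff_vecCoeff (polyMatrix_mulVec_mem_polyLT Q (ξ i Q).2)]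
      exact hzero j i
    refine goodKernel_of_exact hd (polyMatrix_transpose Q) (natDegree_polyMatrix_le Q.1) hker
      (hdeg Q) (ε i₀) ?_ ?_
    · intro p hp
      obtain ⟨c, hc⟩ := hQsurj (vecCoeff _ p)
      refine ⟨_, ofCoeff_mem _ c, fun j => ?_⟩
      have h1 : (fun j => (ξ j Q).1 ⬝ᵥ ofCoeff (fun _ : Fin m => d + ε i₀) c) - p = 0 := by
        refine eq_zero_of_vecCoeff_eq_zero (Submodule.sub_mem _
          (dotProduct_mem_polyLT (x := fun j => (ξ j Q).1) (hdeg Q) (ofCoeff_mem _ c)) hp) ?_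
        rw [map_sub, sub_eq_zero]
        exact hc
      exact congrFun (sub_eq_zero.1 h1) j
    · intro z hz hz0
      -- Modulo an image, `z` lies in `C i₀` and stays orthogonal to `ξ Q`, so that remainder is
      -- zero.
      obtain ⟨v, hv⟩ := hQsup (vecCoeff _ z)
      refine ⟨v.1, v.2, ?_⟩
      have h1 : vecCoeff _ z - mulCoeff _ Q v =
          vecCoeff (fun _ : Fin m => d + (ε i₀ + 1)) (z - polyMatrix Q.1 *ᵥ v.1) := by
        rw [map_sub, mulCoeff_apply]
      have h2 := congrArg Subtype.val (hzeroC i₀ ⟨_, hv⟩ fun j => by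
        simp only [h1]
        rw [ofCoeff_vecCoeff (Submodule.sub_mem _ hz (polyMatrix_mulVec_mem_polyLT Q v.2)),
          dotProduct_sub, hz0, dotProduct_mulVec_skew (polyMatrix_transpose Q), hker]
        simp)
      simp only [h1] at h2
      have h3 := eq_zero_of_vecCoeff_eq_zero
        (Submodule.sub_mem _ hz (polyMatrix_mulVec_mem_polyLT Q v.2)) h2
      exact (sub_eq_zero.1 h3).symm

end Local

end

section

/-! ### The orbit of a generic polynomial is a submanifold -/

section Submanifold
open Filter Topology
variable {d m k : ℕ}

/-- A coefficient of `uᵀ Q v` as a linear function of `Q`. -/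
def coeffForm (u v : Fin m → ℂ[X]) (s : ℕ) : SkewPoly d m →ₗ[ℂ] ℂ where
  toFun Q := (u ⬝ᵥ (polyMatrix Q.1 *ᵥ v)).coeff s
  map_add' Q R := by
    have : polyMatrix (Q + R).1 = polyMatrix Q.1 + polyMatrix R.1 := by
      ext1 a b
      ext s
      rw [Matrix.add_apply, coeff_add, coeff_polyMatrix, coeff_polyMatrix, coeff_polyMatrix]
      split_ifs
      · rfl
      · simp
    rw [this, add_mulVec, dotProduct_add, coeff_add]
  map_smul' c Q := by
    have : polyMatrix (c • Q).1 = C c • polyMatrix Q.1 := by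
      ext1 a b
      ext s
      rw [Matrix.smul_apply, smul_eq_mul, coeff_C_mul, coeff_polyMatrix, coeff_polyMatrix]
      split_ifs
      · rfl
      · simp
    rw [this, smul_mulVec, dotProduct_smul, smul_eq_mul, coeff_C_mul]
    rfl

/-- The indices of the equations of the orbit. -/
abbrev EqIndex (d : ℕ) (ε : Fin k → ℕ) : Type :=
  Σ p : {p : Fin k × Fin k // p.1 < p.2}, Fin (d + 1 + ε p.1.1 + ε p.1.2)

/-- Put `δ i = ξ Q i - x i`. By skewness the form is `x i ⬝ᵥ Q x j + δ i ⬝ᵥ Q x j - Q x i ⬝ᵥ δ j + δ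
i ⬝ᵥ Q δ j`. The last three terms are products of factors vanishing at `P`, so only the first one,
linear in `Q`, contributes to the derivative. -/
theorem hasFDerivAt_restriction {P : SkewPoly d m} {x : Fin k → Fin m → ℂ[X]}
    (hker : ∀ i, polyMatrix P.1 *ᵥ x i = 0) {ξ : SkewPoly d m → Fin k → Fin m → ℂ[X]}
    (hξP : ξ P = x) (hξ : ∀ i a, CoeffAnalyticAt (fun Q => ξ Q i a) P) (i j : Fin k) (s : ℕ) :
    HasFDerivAt (fun Q => (ξ Q i ⬝ᵥ (polyMatrix Q.1 *ᵥ ξ Q j)).coeff s)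
      (coeffForm (d := d) (x i) (x j) s).toContinuousLinearMap P := by
  have hM : ∀ a b, CoeffAnalyticAt (fun Q : SkewPoly d m => polyMatrix Q.1 a b) P :=
    coeffAnalyticAt_polyMatrix P
  have hD : ∀ i a, CoeffAnalyticAt (fun Q => (ξ Q i - x i) a) P := fun i a =>
    (hξ i a).sub (CoeffAnalyticAt.const _)
  have hD0 : ∀ i, ξ P i - x i = 0 := fun i => by rw [hξP, sub_self]
  have hMx : ∀ j a, CoeffAnalyticAt (fun Q : SkewPoly d m => (polyMatrix Q.1 *ᵥ x j) a) P :=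
    fun j => CoeffAnalyticAt.mulVec hM fun a => CoeffAnalyticAt.const _
  have h1 := hasFDerivAt_coeff_dotProduct (hD i) (hMx j) (hD0 i) (hker j) s
  have h2 := hasFDerivAt_coeff_dotProduct (hMx i) (hD j) (hker i) (hD0 j) s
  have h3 := hasFDerivAt_coeff_dotProduct (hD i) (CoeffAnalyticAt.mulVec hM (hD j)) (hD0 i)
    (by rw [hD0, mulVec_zero]) s
  have h4 := (coeffForm (d := d) (x i) (x j) s).toContinuousLinearMap.hasFDerivAt (x := P)
  have h5 := (((h4.add h1).sub h2).add h3).congr_fderiv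
    (g' := (coeffForm (d := d) (x i) (x j) s).toContinuousLinearMap) (by
      ext w
      change coeffForm (x i) (x j) s w + 0 - 0 + 0 = coeffForm (x i) (x j) s w
      ring)
  refine h5.congr_of_eventuallyEq (Eventually.of_forall fun Q => ?_)
  change _ = (x i ⬝ᵥ (polyMatrix Q.1 *ᵥ x j)).coeff s +
    ((ξ Q i - x i) ⬝ᵥ (polyMatrix Q.1 *ᵥ x j)).coeff s -
    ((polyMatrix Q.1 *ᵥ x i) ⬝ᵥ (ξ Q j - x j)).coeff s +
    ((ξ Q i - x i) ⬝ᵥ (polyMatrix Q.1 *ᵥ (ξ Q j - x j))).coeff s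
  rw [← coeff_add, ← coeff_sub, ← coeff_add]
  refine congrArg (fun p : ℂ[X] => p.coeff s) ?_
  have e := dotProduct_mulVec_skew (polyMatrix_transpose Q) (x i) (ξ Q j - x j)
  rw [← neg_eq_iff_eq_neg] at e
  rw [← e]
  simp only [mulVec_sub, dotProduct_sub, sub_dotProduct]
  ring

/-- This is the submersion property of the local equations at `P`: values prescribed above the
diagonal extend to a skew matrix, which is a restriction to the kernel. -/
theorem GoodKernel.coeffForm_surjective {P : SkewPoly d m} {ε : Fin k → ℕ}
    {x : Fin k → Fin m → ℂ[X]} (h : GoodKernel (polyMatrix P.1) d ε x) (c : EqIndex d ε → ℂ) :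
    ∃ E : SkewPoly d m, ∀ t, coeffForm (x t.1.1.1) (x t.1.1.2) t.2 E = c t := by
  let q : {p : Fin k × Fin k // p.1 < p.2} → ℂ[X] := fun p =>
    ∑ s : Fin (d + 1 + ε p.1.1 + ε p.1.2), monomial (s : ℕ) (c ⟨p, s⟩)
  have hqlt : ∀ p s, d + 1 + ε p.1.1 + ε p.1.2 ≤ s → (q p).coeff s = 0 := by
    intro p s hs
    simp only [q, finsetSum_coeff, coeff_monomial]
    exact Finset.sum_eq_zero fun t _ => if_neg (by have := t.2; omega)
  let p : Fin k → Fin k → ℂ[X] := fun i j =>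
    if hij : i < j then q ⟨(i, j), hij⟩ else if hji : j < i then -q ⟨(j, i), hji⟩ else 0
  obtain ⟨E, hE, hElt, hEp⟩ := h.exists_skew_restriction_eq (p := p) (by
    intro i j s hs
    simp only [p]
    split_ifs with h1 h2
    · exact hqlt _ s hs
    · rw [coeff_neg, hqlt _ s (by simp only; omega), neg_zero]
    · exact coeff_zero s) (by
    intro i j
    simp only [p]
    rcases lt_trichotomy i j with h1 | h1 | h1
    · rw [dif_neg h1.asymm, dif_pos h1, dif_pos h1]
    · subst h1; simp
    · rw [dif_pos h1, dif_neg h1.asymm, dif_pos h1, neg_neg])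
  refine ⟨toSkewPoly d E hE, fun t => ?_⟩
  obtain ⟨⟨⟨i, j⟩, hij⟩, s⟩ := t
  change (x i ⬝ᵥ (polyMatrix (toSkewPoly d E hE).1 *ᵥ x j)).coeff s = _
  rw [polyMatrix_toSkewPoly E hE hElt, hEp]
  simp only [p]
  rw [dif_pos hij]
  simp only [q, finsetSum_coeff, coeff_monomial]
  rw [Finset.sum_eq_single s]
  · simp
  · intro b _ hb
    exact if_neg fun e => hb (Fin.ext e)
  · simp

/-- The equations are the coefficients of `ξ Q i ⬝ᵥ (Q *ᵥ ξ Q j)` with `i < j`. Skew-symmetry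
supplies the other entries, and the coefficients from degree `d + 1 + ε i + ε j` on vanish by the
degree bounds. -/
theorem exists_local_equations (hd : 1 ≤ d) (hk : 0 < k) {P : SkewPoly d m} {ε : Fin k → ℕ}
    {x : Fin k → Fin m → ℂ[X]} (h : GoodKernel (polyMatrix P.1) d ε x)
    (hbal : ∀ i j, ε j ≤ ε i + 1) {S : Set (SkewPoly d m)}
    (hS : ∀ Q ∈ S, ∀ i, Module.finrank ℂ (kerLT (polyMatrix Q.1) (ε i + 1)) =
            Module.finrank ℂ (kerLT (polyMatrix P.1) (ε i + 1)))
    (hS' : ∀ (Q : SkewPoly d m) (y : Fin k → Fin m → ℂ[X]),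
      GoodKernel (polyMatrix Q.1) d ε y → Q ∈ S) {c : ℕ}
    (hc : Fintype.card (EqIndex d ε) = c) :
    ∃ (U : Set (SkewPoly d m)) (g : SkewPoly d m → Fin c → ℂ), IsOpen U ∧ P ∈ U ∧
      AnalyticOnNhd ℂ g U ∧ (∀ y ∈ U, Function.Surjective (fderiv ℂ g y)) ∧
      S ∩ U = {y | y ∈ U ∧ g y = 0} := by
  obtain ⟨ξ, hξP, hξ, hdeg, hev⟩ := exists_local_kernel hd hk h hbal
  let e : Fin c ≃ EqIndex d ε := (Fintype.equivFinOfCardEq hc).symm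
  let H : SkewPoly d m → EqIndex d ε → ℂ := fun Q t =>
    (ξ Q t.1.1.1 ⬝ᵥ (polyMatrix Q.1 *ᵥ ξ Q t.1.1.2)).coeff t.2
  let G : SkewPoly d m → Fin c → ℂ := fun Q t => H Q (e t)
  have hGa : AnalyticAt ℂ G P := by
    rw [analyticAt_pi_iff]
    intro t
    exact CoeffAnalyticAt.dotProduct (fun a => hξ _ a)
      (CoeffAnalyticAt.mulVec (coeffAnalyticAt_polyMatrix P) fun a => hξ _ a) _
  have hGsurj : Function.Surjective (fderiv ℂ G P) := by
    intro z
    obtain ⟨E, hE⟩ := h.coeffForm_surjective (fun t => z (e.symm t))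
    refine ⟨E, ?_⟩
    have hfd := hasFDerivAt_pi.2 fun t : Fin c =>
      hasFDerivAt_restriction h.ker hξP hξ (e t).1.1.1 (e t).1.1.2 (e t).2
    rw [show fderiv ℂ G P = _ from hfd.fderiv]
    ext t
    have := hE (e t)
    rw [Equiv.symm_apply_apply] at this
    exact this
  have hevsurj : ∀ᶠ Q in 𝓝 P, Function.Surjective (fderiv ℂ G Q) := by
    have hcont : ContinuousAt (fderiv ℂ G) P := hGa.fderiv.continuousAt
    refine eventually_surjective (f := fun Q => (fderiv ℂ G Q : SkewPoly d m →ₗ[ℂ] Fin c → ℂ))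
      (fun v s => ?_) hGsurj
    have h1 : ContinuousAt (fun Q => fderiv ℂ G Q v) P := hcont.clm_apply continuousAt_const
    exact (continuous_apply s).continuousAt.comp h1
  obtain ⟨U, hU, hUo, hPU⟩ := eventually_nhds_iff.1
    (hev.and (hGa.eventually_analyticAt.and hevsurj))
  refine ⟨U, G, hUo, hPU, fun Q hQ => (hU Q hQ).2.1, fun Q hQ => (hU Q hQ).2.2, ?_⟩
  ext Q
  simp only [Set.mem_inter_iff, Set.mem_ofPred_eq]
  constructor
  · rintro ⟨hQS, hQ⟩
    refine ⟨hQ, ?_⟩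
    ext t
    have := (hU Q hQ).1.1 (hS Q hQS) (e t).1.1.2
    simp only [G, H, this, dotProduct_zero, coeff_zero, Pi.zero_apply]
  · rintro ⟨hQ, hG⟩
    have hlt : ∀ i j, i < j → ξ Q i ⬝ᵥ (polyMatrix Q.1 *ᵥ ξ Q j) = 0 := by
      intro i j hij
      ext s
      rw [coeff_zero]
      by_cases hs : s < d + 1 + ε i + ε j
      · have := congrFun hG (e.symm ⟨⟨(i, j), hij⟩, ⟨s, hs⟩⟩)
        change H Q (e (e.symm _)) = 0 at this
        rw [Equiv.apply_symm_apply] at this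
        exact this
      · have hmem : polyMatrix Q.1 *ᵥ ξ Q j ∈ polyLT (fun _ : Fin m => d + (ε j + 1)) :=
          polyMatrix_mulVec_mem_polyLT Q fun a s hs =>
            coeff_eq_zero_of_natDegree_le (hdeg Q j a) hs
        exact dotProduct_mem_polyLT (hdeg Q) hmem i s (by simp only; omega)
    refine ⟨hS' Q _ ((hU Q hQ).1.2 fun i j => ?_), hQ⟩
    rcases lt_trichotomy i j with hij | rfl | hij
    · exact hlt i j hij
    · exact dotProduct_mulVec_self (polyMatrix_transpose Q) _
    · rw [dotProduct_mulVec_skew (polyMatrix_transpose Q), dotProduct_comm, hlt j i hij, neg_zero]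

/-! The generic eigenstructure. -/

theorem sum_of_map_val_eq {k k' : ℕ} {ε : Fin k → ℕ} {ε' : Fin k' → ℕ}
    (h : Finset.univ.val.map ε = Finset.univ.val.map ε') (f : ℕ → ℕ) :
    ∑ j, f (ε j) = ∑ j, f (ε' j) := by
  have := congrArg (fun s => (s.map f).sum) h
  simp only [Multiset.map_map] at this
  exact this

variable {r : ℕ}

/-- The orbit only provides some eigenstructure shared with `W`. It has no elementary divisors
because that depends on `W` alone, and its indices are generic by uniqueness of minimal indices. -/
theorem IsGenericPoly.exists_goodKernel {W P : SkewPoly d m} (hW : IsGenericPoly r W)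
    (hP : P ∈ polyOrbit W) :
    ∃ (k : ℕ) (ε : Fin k → ℕ) (x : Fin k → Fin m → ℂ[X]), GoodKernel (polyMatrix P.1) d ε x ∧
      Finset.univ.val.map ε = (genericEigenstructure d m r).rightIndices := by
  obtain ⟨-, -, hE⟩ := hW
  obtain ⟨E, hWE, hPE⟩ := hP
  obtain ⟨hfin, hinf⟩ := hE.divisors_eq_zero (fun _ => rfl) rfl hWE
  have hr : E.rightIndices = (genericEigenstructure d m r).rightIndices :=
    HasMinimalIndices.unique hWE.2.2.2 hE.2.2.2
  obtain ⟨k, x, hx, hxE⟩ := hPE.2.2.2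
  exact ⟨k, _, x, hPE.goodKernel hfin hinf hx, by rw [← hxE, hr]⟩

theorem mem_polyOrbit_of_goodKernel {W Q : SkewPoly d m} (hW : IsGenericPoly r W)
    {ε : Fin k → ℕ} {x : Fin k → Fin m → ℂ[X]} (h : GoodKernel (polyMatrix Q.1) d ε x)
    (hε : Finset.univ.val.map ε = (genericEigenstructure d m r).rightIndices) :
    Q ∈ polyOrbit W :=
  ⟨_, hW.2.2, h.hasEigenstructure (fun _ => rfl) rfl hε.symm hε.symm⟩

theorem generic_indices {ε : Fin k → ℕ} (hr : 2 * r < m)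
    (hε : Finset.univ.val.map ε = (genericEigenstructure d m r).rightIndices) :
    k = m - 2 * r ∧ ∑ j, ε j = r * d ∧ ∀ i j, ε j ≤ ε i + 1 := by
  have hpos : 0 < m - 2 * r := by omega
  have hlt := Nat.mod_lt (r * d) hpos
  refine ⟨?_, ?_, fun i j => ?_⟩
  · have := congrArg Multiset.card hε
    simp only [genericEigenstructure, Multiset.card_map, Multiset.card_add,
      Multiset.card_replicate] at this
    rw [show (Finset.univ.val : Multiset (Fin k)).card = k from Finset.card_fin k] at this
    omega
  · have := congrArg Multiset.sum hε
    simp only [genericEigenstructure, Multiset.sum_add, Multiset.sum_replicate, smul_eq_mul] at this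
    rw [show ∑ j, ε j = (Multiset.map ε Finset.univ.val).sum from rfl, this]
    -- Writing `m - 2r` as remainder plus `u + 1` removes the truncated subtraction.
    obtain ⟨u, hu⟩ := Nat.exists_eq_add_of_lt hlt
    have hdm := Nat.div_add_mod (r * d) (m - 2 * r)
    have hsub : m - 2 * r - r * d % (m - 2 * r) = u + 1 := by omega
    rw [hsub]
    calc _ = (r * d % (m - 2 * r) + u + 1) * (r * d / (m - 2 * r)) + r * d % (m - 2 * r) := by ring
      _ = _ := by rw [← hu, hdm]
  · have hmem : ∀ i, ε i = r * d / (m - 2 * r) + 1 ∨ ε i = r * d / (m - 2 * r) := by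
      intro i
      have : ε i ∈ (genericEigenstructure d m r).rightIndices := by
        rw [← hε]; exact Multiset.mem_map_of_mem _ (Finset.mem_univ i)
      simp only [genericEigenstructure, Multiset.mem_add, Multiset.mem_replicate] at this
      rcases this with h | h
      · exact Or.inl h.2
      · exact Or.inr h.2
    rcases hmem i with h1 | h1 <;> rcases hmem j with h2 | h2 <;> omega

/-- Each index occurs in `k - 1` of the pairs. -/
theorem two_mul_sum_pairs (ε : Fin k → ℕ) (e : ℕ) :
    2 * (∑ p : {p : Fin k × Fin k // p.1 < p.2}, (e + ε p.1.1 + ε p.1.2) : ℤ) =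
      ((k : ℤ) - 1) * (k * e + 2 * ∑ j, (ε j : ℤ)) := by
  let f : Fin k → Fin k → ℤ := fun i j => e + ε i + ε j
  have h1 : (∑ p : {p : Fin k × Fin k // p.1 < p.2}, (e + ε p.1.1 + ε p.1.2) : ℤ) =
      ∑ i, ∑ j, if i < j then f i j else 0 := by
    rw [← Fintype.sum_prod_type' (fun i j => if i < j then f i j else 0), ← Finset.sum_filter]
    exact (Finset.sum_subtype _ (by simp) (fun p : Fin k × Fin k => f p.1 p.2)).symm
  have h2 : ∑ i, ∑ j, (if i < j then f i j else 0) = ∑ i, ∑ j, if j < i then f i j else 0 := by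
    rw [Finset.sum_comm]
    refine Finset.sum_congr rfl fun i _ => Finset.sum_congr rfl fun j _ => ?_
    simp only [f]
    split_ifs
    · ring
    · rfl
  have h3 : ∑ i, ∑ j, f i j = (∑ i, ∑ j, if i < j then f i j else 0) +
      (∑ i, ∑ j, if j < i then f i j else 0) + ∑ i, f i i := by
    rw [← Finset.sum_add_distrib, ← Finset.sum_add_distrib]
    refine Finset.sum_congr rfl fun i _ => ?_
    have : f i i = ∑ j, if i = j then f i j else 0 := by simp
    rw [this, ← Finset.sum_add_distrib, ← Finset.sum_add_distrib]
    refine Finset.sum_congr rfl fun j _ => ?_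
    rcases lt_trichotomy i j with h | h | h
    · simp [h, h.asymm, h.ne]
    · simp [h]
    · simp [h, h.asymm, h.ne']
  have h4 : ∑ i, ∑ j, f i j = (k : ℤ) * (k * e + 2 * ∑ j, (ε j : ℤ)) := by
    simp only [f, Finset.sum_add_distrib, Finset.sum_const, Finset.card_univ, Fintype.card_fin,
      nsmul_eq_mul, ← Finset.mul_sum]
    ring
  have h5 : ∑ i, f i i = (k : ℤ) * e + 2 * ∑ j, (ε j : ℤ) := by
    simp only [f, Finset.sum_add_distrib, Finset.sum_const, Finset.card_univ, Fintype.card_fin,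
      nsmul_eq_mul]
    ring
  rw [h1]
  linarith [h2, h3, h4, h5]

theorem card_eqIndex (ε : Fin k → ℕ) :
    2 * (Fintype.card (EqIndex d ε) : ℤ) = ((k : ℤ) - 1) * (k * (d + 1) + 2 * ∑ j, (ε j : ℤ)) := by
  have := two_mul_sum_pairs ε (d + 1)
  push_cast at this
  rw [← this, Fintype.card_sigma]
  simp

theorem isSubmanifoldOfCodim_polyOrbit (hd : 1 ≤ d) (hr : 2 * r < m) {W : SkewPoly d m}
    (hW : IsGenericPoly r W) {c : ℕ}
    (hc : 2 * (c : ℤ) = ((m : ℤ) - 2 * r - 1) * (m * (d + 1) - 2 * r)) :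
    IsSubmanifoldOfCodim (polyOrbit W) c := by
  intro P hP
  obtain ⟨k, ε, x, hx, hε⟩ := hW.exists_goodKernel hP
  obtain ⟨hk, hsum, hbal⟩ := generic_indices hr hε
  refine exists_local_equations hd (by omega) hx hbal (fun Q hQ i => ?_)
    (fun Q y hy => mem_polyOrbit_of_goodKernel hW hy hε) ?_
  -- The dimensions of the bounded-degree kernels depend only on the multiset of minimal indices, so
  -- they are constant on the orbit.
  · obtain ⟨k', ε', x', hx', hε'⟩ := hW.exists_goodKernel hQ
    rw [hx.finrank_kerLT, hx'.finrank_kerLT]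
    exact sum_of_map_val_eq (hε'.trans hε.symm) fun e => ε i + 1 - e
  · have h1 := card_eqIndex (d := d) ε
    have h2 : ∑ j, (ε j : ℤ) = r * d := by exact_mod_cast hsum
    have h3 : (k : ℤ) = m - 2 * r := by omega
    rw [h2, h3] at h1
    have : 2 * (Fintype.card (EqIndex d ε) : ℤ) = 2 * c := by rw [h1, hc]; ring
    omega

end Submanifold

end

section

variable {ι ι' : Type} [Fintype ι] [Fintype ι'] {k : ℕ}

/-! ### The normal space of a congruence orbit -/

/-- By skewness both summands of `Xᵀ A + A X` have the same trace against `Bᴴ`. Orthogonality to the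
tangent space is thus the vanishing of a trace form at every `X`. -/
theorem mem_congNormalSpace_iff (P Q : SkewPencil ι) :
    Q ∈ congNormalSpace P ↔ Q.1.1ᴴ * P.1.1 + Q.1.2ᴴ * P.1.2 = 0 := by
  classical
  have hskew : ∀ {A : Matrix ι ι ℂ}, Aᵀ = -A → ∀ {B : Matrix ι ι ℂ}, Bᵀ = -B →
      ∀ Y : Matrix ι ι ℂ, ((Yᵀ * A + A * Y) * Bᴴ).trace = 2 * (Bᴴ * A * Y).trace := by
    intro A hA B hB Y
    have hB' : Bᴴᵀ = -Bᴴ := by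
      ext i j
      have := congrFun (congrFun hB j) i
      simp only [transpose_apply, Matrix.neg_apply] at this
      simp [this]
    have h1 : (Yᵀ * A * Bᴴ).trace = (Bᴴ * A * Y).trace := by
      rw [← trace_transpose, transpose_mul, transpose_mul, hA, hB', transpose_transpose]
      simp [Matrix.mul_assoc]
    have h2 : (A * Y * Bᴴ).trace = (Bᴴ * A * Y).trace := by
      rw [trace_mul_comm, Matrix.mul_assoc]
    rw [Matrix.add_mul, trace_add, h1, h2]
    ring
  have hinner : ∀ Y, frobeniusInner (congDifferential P Y) Q =
      2 * ((Q.1.1ᴴ * P.1.1 + Q.1.2ᴴ * P.1.2) * Y).trace := by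
    intro Y
    rw [Matrix.add_mul, trace_add, mul_add, ← hskew P.2.1 Q.2.1, ← hskew P.2.2 Q.2.2]
    rfl
  constructor
  · intro h
    refine Matrix.ext_iff_trace_mul_right.2 ?_
    intro Y
    have h1 : frobeniusInner (congDifferential P Y) Q = 0 := h _ ⟨Y, rfl⟩
    rw [hinner] at h1
    rw [Matrix.zero_mul, trace_zero]
    exact (mul_eq_zero.1 h1).resolve_left two_ne_zero
  · rintro h _ ⟨Y, rfl⟩
    rw [hinner, h, Matrix.zero_mul, trace_zero, mul_zero]

/-- Congruence by `S` moves normal vectors by `Q ↦ S.map star * Q * Sᴴ`, the adjoint of the action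
on tangent vectors; the conjugates reflect that the inner product is Hermitian. -/
theorem congCodim_le_of_congruent [DecidableEq ι] [DecidableEq ι'] (P : SkewPencil ι)
    (P' : SkewPencil ι') (S : Matrix ι ι' ℂ) (T : Matrix ι' ι ℂ) (hST : S * T = 1)
    (hTS : T * S = 1) (hA : P'.1.1 = Sᵀ * P.1.1 * S) (hB : P'.1.2 = Sᵀ * P.1.2 * S) :
    congCodim P' ≤ congCodim P := by
  have hskew : ∀ {A : Matrix ι' ι' ℂ}, Aᵀ = -A →
      (S.map star * A * Sᴴ)ᵀ = -(S.map star * A * Sᴴ) := by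
    intro A hA
    have e1 : Sᴴᵀ = S.map star := rfl
    have e2 : (S.map star)ᵀ = Sᴴ := rfl
    rw [transpose_mul, transpose_mul, e1, e2, hA]
    simp [Matrix.mul_assoc]
  let f : SkewPencil ι' →ₗ[ℂ] SkewPencil ι :=
    { toFun := fun Q => ⟨(S.map star * Q.1.1 * Sᴴ, S.map star * Q.1.2 * Sᴴ),
        hskew Q.2.1, hskew Q.2.2⟩
      map_add' := fun Q R => by
        apply Subtype.ext
        apply Prod.ext <;> simp [Matrix.mul_add, Matrix.add_mul]
      map_smul' := fun c Q => by
        apply Subtype.ext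
        apply Prod.ext <;> simp }
  have hconj : T.map star * S.map star = 1 := by
    have := congrArg (fun M : Matrix ι' ι' ℂ => M.map (starRingEnd ℂ)) hTS
    simpa [Matrix.map_mul] using this
  have hconj' : Sᴴ * Tᴴ = 1 := by
    rw [← conjTranspose_mul, hTS, conjTranspose_one]
  have hcancel : ∀ A : Matrix ι' ι' ℂ, T.map star * (S.map star * A * Sᴴ) * Tᴴ = A := by
    intro A
    calc _ = (T.map star * S.map star) * A * (Sᴴ * Tᴴ) := by simp only [Matrix.mul_assoc]
      _ = A := by rw [hconj, hconj', Matrix.one_mul, Matrix.mul_one]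
  have hinj : Function.Injective f := by
    intro Q R h
    have h1 : S.map star * Q.1.1 * Sᴴ = S.map star * R.1.1 * Sᴴ :=
      congrArg (fun Z : SkewPencil ι => Z.1.1) h
    have h2 : S.map star * Q.1.2 * Sᴴ = S.map star * R.1.2 * Sᴴ :=
      congrArg (fun Z : SkewPencil ι => Z.1.2) h
    apply Subtype.ext
    apply Prod.ext
    · rw [← hcancel Q.1.1, h1, hcancel]
    · rw [← hcancel Q.1.2, h2, hcancel]
  have hmap : ∀ Q ∈ congNormalSpace P', f Q ∈ congNormalSpace P := by
    intro Q hQ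
    rw [mem_congNormalSpace_iff, hA, hB] at hQ
    rw [mem_congNormalSpace_iff]
    have hct : ∀ A : Matrix ι' ι' ℂ, (S.map star * A * Sᴴ)ᴴ = S * Aᴴ * Sᵀ := by
      intro A
      have : (S.map star)ᴴ = Sᵀ := by
        ext i j
        simp
      rw [conjTranspose_mul, conjTranspose_mul, conjTranspose_conjTranspose, this,
        Matrix.mul_assoc]
    change (S.map star * Q.1.1 * Sᴴ)ᴴ * P.1.1 + (S.map star * Q.1.2 * Sᴴ)ᴴ * P.1.2 = 0
    rw [hct, hct]
    calc _ = S * (Q.1.1ᴴ * (Sᵀ * P.1.1 * S) + Q.1.2ᴴ * (Sᵀ * P.1.2 * S)) * T := by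
          simp only [Matrix.mul_add, Matrix.add_mul, Matrix.mul_assoc, hST, Matrix.mul_one]
      _ = 0 := by rw [hQ, Matrix.mul_zero, Matrix.zero_mul]
  exact LinearMap.finrank_le_finrank_of_injective (f := f.restrict hmap)
    (fun Q R h => Subtype.ext (hinj (congrArg Subtype.val h)))

theorem congCodim_eq_of_congruent [DecidableEq ι] [DecidableEq ι'] (P : SkewPencil ι)
    (P' : SkewPencil ι') (S : Matrix ι ι' ℂ) (T : Matrix ι' ι ℂ) (hST : S * T = 1)
    (hTS : T * S = 1) (hA : P'.1.1 = Sᵀ * P.1.1 * S) (hB : P'.1.2 = Sᵀ * P.1.2 * S) :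
    congCodim P' = congCodim P := by
  refine le_antisymm (congCodim_le_of_congruent P P' S T hST hTS hA hB)
    (congCodim_le_of_congruent P' P T S hTS hST ?_ ?_)
  all_goals
    have h : Tᵀ * Sᵀ = 1 := by rw [← transpose_mul, hST, transpose_one]
    first
    | rw [hA]
      calc P.1.1 = (Tᵀ * Sᵀ) * P.1.1 * (S * T) := by
            rw [h, hST, Matrix.one_mul, Matrix.mul_one]
        _ = _ := by simp only [Matrix.mul_assoc]
    | rw [hB]
      calc P.1.2 = (Tᵀ * Sᵀ) * P.1.2 * (S * T) := by
            rw [h, hST, Matrix.one_mul, Matrix.mul_one]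
        _ = _ := by simp only [Matrix.mul_assoc]

/-! ### Canonical pencils -/

/-- The index type of the canonical pencil. -/
abbrev CanIndex (ε : Fin k → ℕ) : Type := Σ j : Fin k, Fin (ε j) ⊕ Fin (ε j + 1)

theorem blockDiagonal'_skewBlock_transpose (ε : Fin k → ℕ)
    (K : ∀ j, Matrix (Fin (ε j)) (Fin (ε j + 1)) ℂ) :
    (blockDiagonal' fun j => skewBlock (K j))ᵀ = -blockDiagonal' fun j => skewBlock (K j) := by
  simp only [blockDiagonal'_transpose, skewBlock_transpose]
  ext i j
  simp [blockDiagonal'_apply]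
  split_ifs <;> simp

/-- The block-diagonal pencil with blocks `M_{ε j}`. -/
def canonicalPencil (ε : Fin k → ℕ) : SkewPencil (CanIndex ε) :=
  ⟨(blockDiagonal' fun j => skewBlock (matG (ε j)), blockDiagonal' fun j => skewBlock (matF (ε j))),
    blockDiagonal'_skewBlock_transpose ε fun j => matG (ε j),
    blockDiagonal'_skewBlock_transpose ε fun j => matF (ε j)⟩

section Canonical
variable {ε : Fin k → ℕ}

theorem mul_blockDiagonal'_inl (C : Matrix (CanIndex ε) (CanIndex ε) ℂ)
    (K : ∀ j, Matrix (Fin (ε j)) (Fin (ε j + 1)) ℂ) (p : CanIndex ε) (j : Fin k) (a : Fin (ε j)) :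
    (C * blockDiagonal' fun j => skewBlock (K j)) p ⟨j, Sum.inl a⟩ =
      -∑ b, C p ⟨j, Sum.inr b⟩ * K j a b := by
  rw [Matrix.mul_apply, Fintype.sum_sigma, Finset.sum_eq_single j]
  · simp [blockDiagonal'_apply, skewBlock]
  · intro i _ hi
    refine Finset.sum_eq_zero fun q _ => ?_
    rw [blockDiagonal'_apply_ne _ _ _ hi, mul_zero]
  · simp

theorem mul_blockDiagonal'_inr (C : Matrix (CanIndex ε) (CanIndex ε) ℂ)
    (K : ∀ j, Matrix (Fin (ε j)) (Fin (ε j + 1)) ℂ) (p : CanIndex ε) (j : Fin k)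
    (b : Fin (ε j + 1)) :
    (C * blockDiagonal' fun j => skewBlock (K j)) p ⟨j, Sum.inr b⟩ =
      ∑ a, C p ⟨j, Sum.inl a⟩ * K j a b := by
  rw [Matrix.mul_apply, Fintype.sum_sigma, Finset.sum_eq_single j]
  · simp [blockDiagonal'_apply, skewBlock]
  · intro i _ hi
    refine Finset.sum_eq_zero fun q _ => ?_
    rw [blockDiagonal'_apply_ne _ _ _ hi, mul_zero]
  · simp

/-- The canonical pencil is real, so conjugation and skewness turn the normal equation into `C A + D
B = 0` for `Q = (C, D)`. Read column by column, `A` and `B` merely shift columns. The two guards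
mark the columns where one of the shifts leaves the block. -/
theorem mem_congNormalSpace_canonicalPencil (Q : SkewPencil (CanIndex ε)) :
    Q ∈ congNormalSpace (canonicalPencil ε) ↔
      (∀ p j (a : Fin (ε j)), Q.1.1 p ⟨j, Sum.inr a.castSucc⟩ + Q.1.2 p ⟨j, Sum.inr a.succ⟩ = 0) ∧
      (∀ p j (b : Fin (ε j + 1)), (if h : (b : ℕ) < ε j then Q.1.1 p ⟨j, Sum.inl ⟨b, h⟩⟩ else 0) +
        (if h : 0 < (b : ℕ) then Q.1.2 p ⟨j, Sum.inl ⟨b - 1, by omega⟩⟩ else 0) = 0) := by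
  rw [mem_congNormalSpace_iff]
  have hreal : ∀ K : ∀ j, Matrix (Fin (ε j)) (Fin (ε j + 1)) ℂ, (∀ j a b, star (K j a b) = K j a b) →
      (blockDiagonal' fun j => skewBlock (K j)).map star = blockDiagonal' fun j => skewBlock (K j) := by
    intro K hK
    ext ⟨i, p⟩ ⟨j, q⟩
    by_cases hij : i = j
    · subst hij
      rcases p with p | p <;> rcases q with q | q <;>
        simpa [blockDiagonal'_apply, skewBlock] using hK _ _ _
    · simp [blockDiagonal'_apply_ne _ _ _ hij]
  have hG := hreal (fun j => matG (ε j)) (fun j a b => by simp only [matG, of_apply]; split_ifs <;> simp)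
  have hF := hreal (fun j => matF (ε j)) (fun j a b => by simp only [matF, of_apply]; split_ifs <;> simp)
  have hH : ∀ {A : Matrix (CanIndex ε) (CanIndex ε) ℂ}, Aᵀ = -A → Aᴴ = -A.map star := by
    intro A hA
    rw [conjTranspose, hA]
    ext; simp
  have h1 : Q.1.1ᴴ * (canonicalPencil ε).1.1 + Q.1.2ᴴ * (canonicalPencil ε).1.2 =
      -(Q.1.1 * (canonicalPencil ε).1.1 + Q.1.2 * (canonicalPencil ε).1.2).map star := by
    have hmap : ∀ A B : Matrix (CanIndex ε) (CanIndex ε) ℂ,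
        (A * B).map star = A.map star * B.map star := fun A B => by
      ext i j
      simp [Matrix.mul_apply]
    have hadd : ∀ A B : Matrix (CanIndex ε) (CanIndex ε) ℂ,
        (A + B).map star = A.map star + B.map star := fun A B => by
      ext i j
      simp
    rw [hadd, hmap, hmap, hH Q.2.1, hH Q.2.2]
    simp only [canonicalPencil] at hG hF ⊢
    rw [hG, hF]
    simp only [Matrix.neg_mul]
    abel
  have h2 : Q.1.1ᴴ * (canonicalPencil ε).1.1 + Q.1.2ᴴ * (canonicalPencil ε).1.2 = 0 ↔
      ∀ p q, (Q.1.1 * (canonicalPencil ε).1.1 + Q.1.2 * (canonicalPencil ε).1.2) p q = 0 := by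
    rw [h1, neg_eq_zero]
    constructor
    · intro h p q
      have := congrFun (congrFun h p) q
      rw [map_apply] at this
      exact star_eq_zero.1 this
    · intro h
      ext p q
      rw [map_apply, h]
      simp
  rw [h2]
  have e1 : ∀ p j (a : Fin (ε j)),
      (Q.1.1 * (canonicalPencil ε).1.1 + Q.1.2 * (canonicalPencil ε).1.2) p ⟨j, Sum.inl a⟩ =
      -(Q.1.1 p ⟨j, Sum.inr a.castSucc⟩ + Q.1.2 p ⟨j, Sum.inr a.succ⟩) := by
    intro p j a
    simp only [canonicalPencil, Matrix.add_apply, mul_blockDiagonal'_inl]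
    rw [Finset.sum_eq_single a.castSucc, Finset.sum_eq_single a.succ]
    · simp [matG, matF, add_comm]
    · intro b _ hb
      rw [matF, of_apply, if_neg (fun e => hb (Fin.ext (by simpa using e))), mul_zero]
    · simp
    · intro b _ hb
      rw [matG, of_apply, if_neg (fun e => hb (Fin.ext (by simpa using e))), mul_zero]
    · simp
  have e2 : ∀ p j (b : Fin (ε j + 1)),
      (Q.1.1 * (canonicalPencil ε).1.1 + Q.1.2 * (canonicalPencil ε).1.2) p ⟨j, Sum.inr b⟩ =
      (if h : (b : ℕ) < ε j then Q.1.1 p ⟨j, Sum.inl ⟨b, h⟩⟩ else 0) +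
        (if h : 0 < (b : ℕ) then Q.1.2 p ⟨j, Sum.inl ⟨b - 1, by omega⟩⟩ else 0) := by
    intro p j b
    simp only [canonicalPencil, Matrix.add_apply, mul_blockDiagonal'_inr]
    congr 1
    · split_ifs with h
      · rw [Finset.sum_eq_single (⟨b, h⟩ : Fin (ε j))]
        · simp [matG]
        · intro a _ ha
          rw [matG, of_apply, if_neg (fun e => ha (Fin.ext e.symm)), mul_zero]
        · simp
      · refine Finset.sum_eq_zero fun a _ => ?_
        rw [matG, of_apply, if_neg (by have := a.2; omega), mul_zero]
    · split_ifs with h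
      · rw [Finset.sum_eq_single (⟨b - 1, by omega⟩ : Fin (ε j))]
        · rw [matF, of_apply, if_pos (by simp only; omega), mul_one]
        · intro a _ ha
          rw [matF, of_apply, if_neg (fun e => ha (Fin.ext (by simp only; omega))), mul_zero]
        · simp
      · refine Finset.sum_eq_zero fun a _ => ?_
        rw [matF, of_apply, if_neg (by omega), mul_zero]
  constructor
  · intro h
    exact ⟨fun p j a => by rw [← neg_eq_zero, ← e1]; exact h _ _,
      fun p j b => by rw [← e2]; exact h _ _⟩
  · rintro ⟨ha, hb⟩ p ⟨j, q | q⟩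
    · rw [e1, ha, neg_zero]
    · rw [e2, hb]

end Canonical

end

/-! ### The normal space of a balanced canonical pencil: Hankel blocks -/

section

variable {k : ℕ} {ε : Fin k → ℕ}

/-- Entries on one antidiagonal agree; the point with the largest admissible row index serves as its
representative. -/
theorem hankel_eq {m n : ℕ} {f : ℕ → ℕ → ℂ}
    (h : ∀ a b, a < m → b < n → f a (b + 1) = f (a + 1) b) (b : ℕ) :
    ∀ a, a ≤ m → b ≤ n → f a b = f (min (a + b) m) (a + b - min (a + b) m) := by
  induction b with
  | zero => intro a ha _; simp [ha]
  | succ b ih =>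
    intro a ha hb
    rcases ha.lt_or_eq with ha | rfl
    · rw [h a b ha hb, ih (a + 1) ha (by omega)]
      congr 2 <;> omega
    · rw [min_eq_right (by omega)]
      congr 1
      omega

/-- The skew-symmetric pencil whose blocks at the positions of the second summands are the Hankel
matrices of the sequences `g i j`. -/
def hankelPencil (ε : Fin k → ℕ) (g : Fin k → Fin k → ℕ → ℂ) (hg : ∀ i j s, g j i s = -g i j s) :
    SkewPencil (CanIndex ε) :=
  ⟨(Matrix.of fun p q => match p, q with
      | ⟨i, Sum.inr a⟩, ⟨j, Sum.inr b⟩ => -g i j (a + b + 1)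
      | _, _ => 0,
    Matrix.of fun p q => match p, q with
      | ⟨i, Sum.inr a⟩, ⟨j, Sum.inr b⟩ => g i j (a + b)
      | _, _ => 0), by
    constructor
    · ext ⟨i, a | a⟩ ⟨j, b | b⟩ <;> simp
      rw [hg, add_comm (b : ℕ), neg_neg]
    · ext ⟨i, a | a⟩ ⟨j, b | b⟩ <;> simp
      rw [hg, add_comm (b : ℕ)]⟩

theorem hankelPencil_add (g g' g'' : Fin k → Fin k → ℕ → ℂ) (hg hg' hg'')
    (h : ∀ i j s, g'' i j s = g i j s + g' i j s) :
    hankelPencil ε g'' hg'' = hankelPencil ε g hg + hankelPencil ε g' hg' := by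
  apply Subtype.ext
  apply Prod.ext
  · ext ⟨i, a | a⟩ ⟨j, b | b⟩
    · exact (add_zero 0).symm
    · exact (add_zero 0).symm
    · exact (add_zero 0).symm
    · change -g'' i j _ = -g i j _ + -g' i j _
      rw [h, neg_add]
  · ext ⟨i, a | a⟩ ⟨j, b | b⟩
    · exact (add_zero 0).symm
    · exact (add_zero 0).symm
    · exact (add_zero 0).symm
    · exact h i j _

theorem hankelPencil_smul (z : ℂ) (g g' : Fin k → Fin k → ℕ → ℂ) (hg hg')
    (h : ∀ i j s, g' i j s = z * g i j s) :
    hankelPencil ε g' hg' = z • hankelPencil ε g hg := by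
  apply Subtype.ext
  apply Prod.ext
  · ext ⟨i, a | a⟩ ⟨j, b | b⟩
    · exact (mul_zero z).symm
    · exact (mul_zero z).symm
    · exact (mul_zero z).symm
    · change -g' i j _ = z * -g i j _
      rw [h, mul_neg]
  · ext ⟨i, a | a⟩ ⟨j, b | b⟩
    · exact (mul_zero z).symm
    · exact (mul_zero z).symm
    · exact (mul_zero z).symm
    · exact h i j _

theorem hankelPencil_mem (g : Fin k → Fin k → ℕ → ℂ) (hg : ∀ i j s, g j i s = -g i j s) :
    hankelPencil ε g hg ∈ congNormalSpace (canonicalPencil ε) := by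
  rw [mem_congNormalSpace_canonicalPencil]
  constructor
  · rintro ⟨i, a | a⟩ j b
    · simp [hankelPencil]
    · simp [hankelPencil, add_assoc]
  · rintro ⟨i, a | a⟩ j b <;> simp [hankelPencil]

/-- Skewness turns the column relations into row relations as well. Blocks between first summands
are constant along antidiagonals and vanish at the ends. Mixed blocks are constant along diagonals;
balance makes every diagonal end in a zero. Only the Hankel blocks between second summands survive.
-/
theorem eq_hankelPencil (hε : ∀ i j, ε j ≤ ε i + 1) {Q : SkewPencil (CanIndex ε)}
    (hQ : Q ∈ congNormalSpace (canonicalPencil ε)) :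
    ∃ g hg, Q = hankelPencil ε g hg := by
  obtain ⟨h1, h2⟩ := (mem_congNormalSpace_canonicalPencil Q).1 hQ
  have hC : ∀ p q, Q.1.1 q p = -Q.1.1 p q := fun p q => congrFun (congrFun Q.2.1 p) q
  have hD : ∀ p q, Q.1.2 q p = -Q.1.2 p q := fun p q => congrFun (congrFun Q.2.2 p) q
  have hext : ∀ g hg, (∀ p q, Q.1.1 p q = (hankelPencil ε g hg).1.1 p q) →
      (∀ p q, Q.1.2 p q = (hankelPencil ε g hg).1.2 p q) → Q = hankelPencil ε g hg :=
    fun g hg h h' => Subtype.ext (Prod.ext (Matrix.ext h) (Matrix.ext h'))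
  generalize Q.1.1 = C at *
  generalize Q.1.2 = D at *
  have r1 : ∀ p j b (hb : b < ε j),
      C p ⟨j, Sum.inr ⟨b, by omega⟩⟩ = -D p ⟨j, Sum.inr ⟨b + 1, by omega⟩⟩ :=
    fun p j b hb => eq_neg_of_add_eq_zero_left (h1 p j ⟨b, hb⟩)
  have l0 : ∀ p j (h : 0 < ε j), C p ⟨j, Sum.inl ⟨0, h⟩⟩ = 0 := by
    intro p j h
    simpa [h] using h2 p j 0
  have l1 : ∀ p j b (hb : b + 1 < ε j),
      C p ⟨j, Sum.inl ⟨b + 1, hb⟩⟩ = -D p ⟨j, Sum.inl ⟨b, by omega⟩⟩ := by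
    intro p j b hb
    have := h2 p j ⟨b + 1, by omega⟩
    rw [dif_pos (by simpa using hb), dif_pos (by simp)] at this
    exact eq_neg_of_add_eq_zero_left this
  have l2 : ∀ p j b (hb : b + 1 = ε j), D p ⟨j, Sum.inl ⟨b, by omega⟩⟩ = 0 := by
    intro p j b hb
    have := h2 p j ⟨b + 1, by omega⟩
    rw [dif_neg (by simp [hb]), dif_pos (by simp), zero_add] at this
    exact this
  have ll : ∀ b i j a (ha : a < ε i) (hb : b < ε j),
      C ⟨i, Sum.inl ⟨a, ha⟩⟩ ⟨j, Sum.inl ⟨b, hb⟩⟩ = 0 := by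
    intro b
    induction b with
    | zero => intro i j a ha hb; exact l0 _ _ _
    | succ b ih =>
      intro i j a ha hb
      rw [l1, hD, neg_neg]
      rcases Nat.lt_or_ge (a + 1) (ε i) with h | h
      · rw [← neg_inj, ← l1 _ _ a h, hC, ih i j (a + 1) h (by omega)]
      · exact l2 _ _ _ (by omega)
  have ll' : ∀ b i j a (ha : a < ε i) (hb : b < ε j),
      D ⟨i, Sum.inl ⟨a, ha⟩⟩ ⟨j, Sum.inl ⟨b, hb⟩⟩ = 0 := by
    intro b i j a ha hb
    rcases Nat.lt_or_ge (b + 1) (ε j) with h | h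
    · rw [← neg_eq_zero, ← l1 _ _ b h, ll]
    · exact l2 _ _ _ (by omega)
  have lr1 : ∀ i j a b (ha : a + 1 < ε i) (hb : b < ε j + 1),
      C ⟨i, Sum.inl ⟨a + 1, ha⟩⟩ ⟨j, Sum.inr ⟨b, hb⟩⟩ =
        -D ⟨i, Sum.inl ⟨a, by omega⟩⟩ ⟨j, Sum.inr ⟨b, hb⟩⟩ := by
    intro i j a b ha hb
    rw [hC, l1 _ _ _ ha, hD, neg_neg]
  have lr2 : ∀ i j a b (ha : a + 1 < ε i) (hb : b < ε j),
      C ⟨i, Sum.inl ⟨a + 1, ha⟩⟩ ⟨j, Sum.inr ⟨b + 1, by omega⟩⟩ =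
        C ⟨i, Sum.inl ⟨a, by omega⟩⟩ ⟨j, Sum.inr ⟨b, by omega⟩⟩ := by
    intro i j a b ha hb
    rw [lr1, r1 _ _ _ hb]
  have lr_ge : ∀ a i j b (ha : a < ε i) (hb : b < ε j + 1), a ≤ b →
      C ⟨i, Sum.inl ⟨a, ha⟩⟩ ⟨j, Sum.inr ⟨b, hb⟩⟩ = 0 := by
    intro a
    induction a with
    | zero => intro i j b ha hb _; rw [hC, l0, neg_zero]
    | succ a ih =>
      intro i j b ha hb hab
      obtain ⟨b, rfl⟩ : ∃ c, b = c + 1 := ⟨b - 1, by omega⟩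
      rw [lr2 _ _ _ _ ha (by omega)]
      exact ih _ _ _ _ _ (by omega)
  -- Below the diagonal the entries are followed down to the last row. Since `ε i ≤ ε j + 1`, the
  -- last row is reached with `b < ε j`, where the entry of `C` is minus an entry of `D` known to
  -- vanish.
  have lr_lt : ∀ t i j a b (ha : a < ε i) (hb : b < ε j + 1), a + t + 1 = ε i → b < a →
      C ⟨i, Sum.inl ⟨a, ha⟩⟩ ⟨j, Sum.inr ⟨b, hb⟩⟩ = 0 := by
    intro t
    induction t with
    | zero =>
      intro i j a b ha hb hat hba
      have := hε j i
      rw [r1 _ _ b (by omega), hD, l2 _ _ _ (by omega), neg_zero, neg_zero]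
    | succ t ih =>
      intro i j a b ha hb hat hba
      have := hε j i
      rw [← lr2 _ _ _ _ (by omega) (by omega)]
      exact ih _ _ _ _ _ _ (by omega) (by omega)
  have lr : ∀ i j a b (ha : a < ε i) (hb : b < ε j + 1),
      C ⟨i, Sum.inl ⟨a, ha⟩⟩ ⟨j, Sum.inr ⟨b, hb⟩⟩ = 0 := by
    intro i j a b ha hb
    rcases Nat.lt_or_ge b a with h | h
    · exact lr_lt (ε i - a - 1) i j a b ha hb (by omega) h
    · exact lr_ge a i j b ha hb h
  have lr' : ∀ i j a b (ha : a < ε i) (hb : b < ε j + 1),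
      D ⟨i, Sum.inl ⟨a, ha⟩⟩ ⟨j, Sum.inr ⟨b, hb⟩⟩ = 0 := by
    intro i j a b ha hb
    rcases Nat.lt_or_ge (a + 1) (ε i) with h | h
    · rw [← neg_eq_zero, ← lr1 _ _ _ _ h, lr]
    · rw [hD, l2 _ _ _ (by omega), neg_zero]
  let f : Fin k → Fin k → ℕ → ℕ → ℂ := fun i j a b =>
    if h : a < ε i + 1 ∧ b < ε j + 1 then D ⟨i, Sum.inr ⟨a, h.1⟩⟩ ⟨j, Sum.inr ⟨b, h.2⟩⟩ else 0
  have hf : ∀ i j a b (ha : a < ε i + 1) (hb : b < ε j + 1),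
      D ⟨i, Sum.inr ⟨a, ha⟩⟩ ⟨j, Sum.inr ⟨b, hb⟩⟩ = f i j a b :=
    fun i j a b ha hb => (dif_pos ⟨ha, hb⟩ : f i j a b = _).symm
  have hfskew : ∀ i j a b, f j i b a = -f i j a b := by
    intro i j a b
    by_cases h : a < ε i + 1 ∧ b < ε j + 1
    · rw [← hf i j a b h.1 h.2, ← hf j i b a h.2 h.1, hD]
    · simp only [f]
      rw [dif_neg h, dif_neg (fun h' => h h'.symm), neg_zero]
  have hr : ∀ i j a b (ha : a < ε i + 1) (hb : b < ε j),
      C ⟨i, Sum.inr ⟨a, ha⟩⟩ ⟨j, Sum.inr ⟨b, by omega⟩⟩ = -f i j a (b + 1) := by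
    intro i j a b ha hb
    rw [r1 _ _ _ hb, hf]
  have hl : ∀ i j a b (ha : a < ε i) (hb : b < ε j + 1),
      C ⟨i, Sum.inr ⟨a, by omega⟩⟩ ⟨j, Sum.inr ⟨b, hb⟩⟩ = -f i j (a + 1) b := by
    intro i j a b ha hb
    rw [hC, hr _ _ _ _ hb ha, hfskew, neg_neg]
  have hhankel : ∀ i j a b, a < ε i → b < ε j → f i j a (b + 1) = f i j (a + 1) b := by
    intro i j a b ha hb
    rw [← neg_inj, ← hr i j a b (by omega) hb, ← hl i j a b ha (by omega)]
  -- A block of `D` fixes the terms `0, …, ε i + ε j`. One more term appears only in the last corner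
  -- of `C`, for `ε i + ε j + 2` in all.
  let g : Fin k → Fin k → ℕ → ℂ := fun i j s =>
    if s ≤ ε i + ε j then f i j (min s (ε i)) (s - min s (ε i))
    else if s = ε i + ε j + 1 then
      -C ⟨i, Sum.inr (Fin.last _)⟩ ⟨j, Sum.inr (Fin.last _)⟩
    else 0
  have hfg : ∀ i j a b, a ≤ ε i → b ≤ ε j → f i j a b = g i j (a + b) := by
    intro i j a b ha hb
    rw [hankel_eq (hhankel i j) b a ha hb]
    exact (if_pos (by omega) : g i j (a + b) = _).symm
  have hg : ∀ i j s, g j i s = -g i j s := by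
    intro i j s
    by_cases hs : s ≤ ε i + ε j
    · have e : s = min s (ε i) + (s - min s (ε i)) := by omega
      rw [e, ← hfg i j _ _ (by omega) (by omega), ← hfskew, add_comm,
        hfg j i _ _ (by omega) (by omega)]
    · by_cases hs' : s = ε i + ε j + 1
      · simp only [g]
        rw [if_neg hs, if_neg (by omega), if_pos hs', if_pos (by omega), hC]
      · simp only [g]
        rw [if_neg hs, if_neg (by omega), if_neg hs', if_neg (by omega), neg_zero]
  refine ⟨g, hg, hext g hg ?_ ?_⟩
  · rintro ⟨i, ⟨a, ha⟩ | ⟨a, ha⟩⟩ ⟨j, ⟨b, hb⟩ | ⟨b, hb⟩⟩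
    · exact ll _ _ _ _ _ _
    · exact lr _ _ _ _ _ _
    · rw [hC, lr]
      exact neg_zero
    · change _ = -g i j (a + b + 1)
      rcases Nat.lt_or_ge b (ε j) with h | h
      · rw [hr _ _ _ _ _ h, hfg _ _ _ _ (by omega) (by omega), add_assoc]
      · rcases Nat.lt_or_ge a (ε i) with h' | h'
        · rw [hl _ _ _ _ h', hfg _ _ _ _ (by omega) (by omega)]
          congr 2
          omega
        · obtain rfl : a = ε i := by omega
          obtain rfl : b = ε j := by omega
          simp only [g]
          rw [if_neg (by omega)]
          simp only [if_true, neg_neg]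
          rfl
  · rintro ⟨i, ⟨a, ha⟩ | ⟨a, ha⟩⟩ ⟨j, ⟨b, hb⟩ | ⟨b, hb⟩⟩
    · exact ll' _ _ _ _ _ _
    · exact lr' _ _ _ _ _ _
    · rw [hD, lr']
      exact neg_zero
    · change _ = g i j (a + b)
      rw [hf, hfg _ _ _ _ (by omega) (by omega)]

/-- The antisymmetric family of sequences with prescribed terms above the diagonal. -/
def antisymmFamily (ε : Fin k → ℕ) (c : EqIndex 1 ε → ℂ) (i j : Fin k) (s : ℕ) : ℂ :=
  (if h : i < j ∧ s < 1 + 1 + ε i + ε j then c ⟨⟨(i, j), h.1⟩, ⟨s, h.2⟩⟩ else 0) -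
    (if h : j < i ∧ s < 1 + 1 + ε j + ε i then c ⟨⟨(j, i), h.1⟩, ⟨s, h.2⟩⟩ else 0)

theorem antisymmFamily_antisymm (c : EqIndex 1 ε → ℂ) (i j : Fin k) (s : ℕ) :
    antisymmFamily ε c j i s = -antisymmFamily ε c i j s := by
  simp [antisymmFamily]

theorem antisymmFamily_apply (c : EqIndex 1 ε → ℂ) (t : EqIndex 1 ε) :
    antisymmFamily ε c t.1.1.1 t.1.1.2 t.2 = c t := by
  obtain ⟨⟨⟨i, j⟩, hij⟩, s⟩ := t
  have hij' : i < j := hij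
  simp [antisymmFamily, hij', hij'.asymm]

/-- The congruence orbit of a canonical pencil whose indices differ by at most one has the
codimension given by the number of parameters of the Hankel blocks. -/
theorem congCodim_canonicalPencil (hε : ∀ i j, ε j ≤ ε i + 1) :
    congCodim (canonicalPencil ε) = Fintype.card (EqIndex 1 ε) := by
  let Φ : (EqIndex 1 ε → ℂ) →ₗ[ℂ] congNormalSpace (canonicalPencil ε) :=
    { toFun := fun c => ⟨hankelPencil ε (antisymmFamily ε c) (antisymmFamily_antisymm c),
        hankelPencil_mem _ _⟩
      map_add' := by
        intro c c'
        have h : ∀ i j s, antisymmFamily ε (c + c') i j s =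
            antisymmFamily ε c i j s + antisymmFamily ε c' i j s := by
          intro i j s
          simp only [antisymmFamily, Pi.add_apply]
          split_ifs <;> ring
        exact Subtype.ext (hankelPencil_add _ _ _ (antisymmFamily_antisymm c)
          (antisymmFamily_antisymm c') (antisymmFamily_antisymm _) h)
      map_smul' := by
        intro z c
        have h : ∀ i j s, antisymmFamily ε (z • c) i j s = z * antisymmFamily ε c i j s := by
          intro i j s
          simp only [antisymmFamily, Pi.smul_apply, smul_eq_mul]
          split_ifs <;> ring
        exact Subtype.ext (hankelPencil_smul z _ _ (antisymmFamily_antisymm c)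
          (antisymmFamily_antisymm _) h) }
  have hval : ∀ (g hg g' hg'), hankelPencil ε g hg = hankelPencil ε g' hg' →
      ∀ i j s, s < 1 + 1 + ε i + ε j → g i j s = g' i j s := by
    intro g hg g' hg' h i j s hs
    rcases Nat.lt_or_ge (ε i + ε j) s with h1 | h1
    · have := congrFun (congrFun (congrArg (fun Z : SkewPencil (CanIndex ε) => Z.1.1) h)
        ⟨i, Sum.inr (Fin.last _)⟩) ⟨j, Sum.inr (Fin.last _)⟩
      have e : s = ε i + ε j + 1 := by omega
      rw [e]
      exact neg_inj.1 this
    · have := congrFun (congrFun (congrArg (fun Z : SkewPencil (CanIndex ε) => Z.1.2) h)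
        ⟨i, Sum.inr ⟨min s (ε i), by omega⟩⟩) ⟨j, Sum.inr ⟨s - min s (ε i), by omega⟩⟩
      have e : s = min s (ε i) + (s - min s (ε i)) := by omega
      rw [e]
      exact this
  have hbij : Function.Bijective Φ := by
    constructor
    · intro c c' h
      funext t
      rw [← antisymmFamily_apply c, ← antisymmFamily_apply c']
      exact hval _ (antisymmFamily_antisymm c) _ (antisymmFamily_antisymm c') (congrArg Subtype.val h) _ _ _ t.2.2
    · rintro ⟨Q, hQ⟩
      obtain ⟨g, hg, rfl⟩ := eq_hankelPencil hε hQ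
      refine ⟨fun t => g t.1.1.1 t.1.1.2 t.2, Subtype.ext ?_⟩
      have key : ∀ i j s, s < 1 + 1 + ε i + ε j →
          antisymmFamily ε (fun t => g t.1.1.1 t.1.1.2 t.2) i j s = g i j s := by
        intro i j s hs
        simp only [antisymmFamily]
        rcases lt_trichotomy i j with h | rfl | h
        · rw [dif_pos ⟨h, hs⟩, dif_neg (fun h' => h.asymm h'.1), sub_zero]
        · rw [dif_neg (fun h' => lt_irrefl _ h'.1), sub_zero, eq_comm]
          have := hg i i s
          linear_combination (1 / 2 : ℂ) * this
        · rw [dif_neg (fun h' => h.asymm h'.1), dif_pos ⟨h, by omega⟩, zero_sub, hg, neg_neg]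
      apply Subtype.ext
      apply Prod.ext
      · ext ⟨i, a | a⟩ ⟨j, b | b⟩
        · rfl
        · rfl
        · rfl
        · exact congrArg Neg.neg (key i j _ (by omega))
      · ext ⟨i, a | a⟩ ⟨j, b | b⟩
        · rfl
        · rfl
        · rfl
        · exact key i j _ (by omega)
  rw [congCodim, ← (LinearEquiv.ofBijective Φ hbij).finrank_eq, Module.finrank_fintype_fun_eq_card]

end

section

/-! ### Pencils with a full set of singular chains are canonical -/

variable {ι : Type} [Fintype ι] {k : ℕ} {ε : Fin k → ℕ}

/-- Auxiliary solution of the recursion `w (a + 1) b = w a (b + 1) + U a (b + 1) - V a b`. -/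
def hankelRecursion (U V : ℕ → ℕ → ℂ) : ℕ → ℕ → ℂ
  | 0, _ => 0
  | a + 1, b => hankelRecursion U V a (b + 1) + U a (b + 1) - V a b

/-- The first equation fixes the skew part of `S` as `U / 2`. The second becomes a recursion along
antidiagonals for the symmetric part, solvable from arbitrary initial values; averaging the solution
with its transpose gives the symmetry. -/
theorem exists_skew_correction {κ : Type*} (U V : κ → κ → ℕ → ℕ → ℂ)
    (hU : ∀ i j a b, U j i b a = -U i j a b) (hV : ∀ i j a b, V j i b a = -V i j a b) :
    ∃ S : κ → κ → ℕ → ℕ → ℂ, (∀ i j a b, S i j a b - S j i b a = U i j a b) ∧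
      ∀ i j a b, S i j a (b + 1) - S j i b (a + 1) = V i j a b := by
  let w : κ → κ → ℕ → ℕ → ℂ := fun i j => hankelRecursion (U i j) (V i j)
  have hw : ∀ i j a b, w i j (a + 1) b = w i j a (b + 1) + U i j a (b + 1) - V i j a b :=
    fun i j a b => rfl
  refine ⟨fun i j a b => (1 / 2 : ℂ) * (w i j a b + U i j a b + w j i b a), fun i j a b => ?_,
    fun i j a b => ?_⟩
  · simp only
    rw [hU i j a b]
    ring
  · simp only
    rw [hw i j a b, hw j i b a, hV i j a b]
    ring

/-- A singular chain structure of a skew-symmetric pencil `λ A - B`: vectors `x j 0, …, x j (ε j)`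
with `B x j 0 = 0`, `A x j a = B x j (a + 1)` and `A x j (ε j) = 0`, all together independent, such
that the last vectors span the kernel of `A`. -/
structure SingularChains (P : SkewPencil ι) (ε : Fin k → ℕ) (x : Fin k → ℕ → ι → ℂ) : Prop where
  zero_of_lt : ∀ j a, ε j < a → x j a = 0
  first : ∀ j, P.1.2 *ᵥ x j 0 = 0
  step : ∀ j a, P.1.1 *ᵥ x j a = P.1.2 *ᵥ x j (a + 1)
  indep : LinearIndependent ℂ fun z : (Σ j, Fin (ε j + 1)) => x z.1 z.2
  ker : ∀ v, P.1.1 *ᵥ v = 0 → ∃ e : Fin k → ℂ, v = ∑ j, e j • x j (ε j)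

namespace SingularChains

variable {P : SkewPencil ι} {x : Fin k → ℕ → ι → ℂ}

theorem last (h : SingularChains P ε x) (j : Fin k) : P.1.1 *ᵥ x j (ε j) = 0 := by
  rw [h.step, h.zero_of_lt j _ (Nat.lt_succ_self _), mulVec_zero]

/-- Skewness and the chain relation move one step from the left vector to the right one, until the
left vector is `x i 0`, which `B` kills. -/
theorem isotropic_lead (h : SingularChains P ε x) (i j : Fin k) (a b : ℕ) :
    x i a ⬝ᵥ (P.1.1 *ᵥ x j b) = 0 := by
  induction a generalizing b with
  | zero => rw [h.step, dotProduct_mulVec_skew P.2.2, h.first, zero_dotProduct, neg_zero]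
  | succ a ih =>
    rw [h.step, dotProduct_mulVec_skew P.2.2, ← h.step, ← dotProduct_mulVec_skew P.2.1, ih]

theorem isotropic_const (h : SingularChains P ε x) (i j : Fin k) (a b : ℕ) :
    x i a ⬝ᵥ (P.1.2 *ᵥ x j b) = 0 := by
  cases b with
  | zero => rw [h.first, dotProduct_zero]
  | succ b => rw [← h.step, h.isotropic_lead]

/-- A relation gives a vector of `ker A`, hence a combination of last chain vectors, contradicting
independence of all chain vectors. -/
theorem linearIndependent_mulVec (h : SingularChains P ε x) :
    LinearIndependent ℂ fun q : (Σ j, Fin (ε j)) => P.1.1 *ᵥ x q.1 q.2 := by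
  rw [Fintype.linearIndependent_iff]
  intro c hc
  have h0 : P.1.1 *ᵥ (∑ q : (Σ j, Fin (ε j)), c q • x q.1 q.2) = 0 := by
    rw [← hc, mulVec_sum]
    exact Finset.sum_congr rfl fun q _ => mulVec_smul _ _ _
  obtain ⟨e, he⟩ := h.ker _ h0
  let g : (Σ j, Fin (ε j + 1)) → ℂ := fun z =>
    Fin.lastCases (motive := fun _ => ℂ) (-e z.1) (fun b => c ⟨z.1, b⟩) z.2
  have hg : ∑ z, g z • x z.1 z.2 = 0 := by
    rw [Fintype.sum_sigma]
    simp only [Fin.sum_univ_castSucc, g, Fin.lastCases_castSucc, Fin.lastCases_last,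
      Fin.val_castSucc, Fin.val_last, Finset.sum_add_distrib, neg_smul, Finset.sum_neg_distrib]
    rw [← he, Fintype.sum_sigma, add_neg_cancel]
  rintro ⟨j, b⟩
  have := Fintype.linearIndependent_iff.1 h.indep g hg ⟨j, b.castSucc⟩
  simpa [g] using this

/-- A pencil with enough singular chains is congruent to the canonical pencil. -/
theorem congCodim_eq [DecidableEq ι] (h : SingularChains P ε x)
    (hcard : Fintype.card ι = ∑ j, (2 * ε j + 1)) :
    congCodim P = congCodim (canonicalPencil ε) := by
  obtain ⟨y, hy⟩ := exists_dual_family h.linearIndependent_mulVec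
  have hskA := fun u v => dotProduct_mulVec_skew P.2.1 u v
  have hskB := fun u v => dotProduct_mulVec_skew P.2.2 u v
  -- Duality to the vectors `A x j b` already gives the correct pairings with the chains under `A`,
  -- and, through the chain relation, under `B`.
  let Y : Fin k → ℕ → ι → ℂ := fun j b => if hb : b < ε j then y ⟨j, ⟨b, hb⟩⟩ else 0
  have hYA : ∀ i j a b, a < ε i → Y i a ⬝ᵥ (P.1.1 *ᵥ x j b) = if i = j ∧ a = b then 1 else 0 := by
    intro i j a b ha
    simp only [Y, dif_pos ha]
    rcases lt_trichotomy b (ε j) with hb | rfl | hb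
    · rw [dotProduct_comm, hy ⟨j, ⟨b, hb⟩⟩ ⟨i, ⟨a, ha⟩⟩]
      refine if_congr ?_ rfl rfl
      constructor
      · intro e
        obtain ⟨rfl, e⟩ := Sigma.mk.inj_iff.1 e
        have := Fin.mk.inj_iff.1 (eq_of_heq e)
        exact ⟨rfl, this.symm⟩
      · rintro ⟨rfl, rfl⟩
        rfl
    · rw [h.last, dotProduct_zero, if_neg]
      rintro ⟨rfl, rfl⟩
      omega
    · rw [h.zero_of_lt j b hb, mulVec_zero, dotProduct_zero, if_neg]
      rintro ⟨rfl, rfl⟩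
      omega
  have hYB : ∀ i j a b, a < ε i →
      Y i a ⬝ᵥ (P.1.2 *ᵥ x j b) = if i = j ∧ b = a + 1 then 1 else 0 := by
    intro i j a b ha
    cases b with
    | zero => rw [h.first, dotProduct_zero, if_neg (by omega)]
    | succ b =>
      rw [← h.step, hYA _ _ _ _ ha]
      exact if_congr (by omega) rfl rfl
  obtain ⟨s, hsA, hsB⟩ := exists_skew_correction
    (fun i j a b => Y i a ⬝ᵥ (P.1.1 *ᵥ Y j b)) (fun i j a b => Y i a ⬝ᵥ (P.1.2 *ᵥ Y j b))
    (fun i j a b => by rw [hskA, dotProduct_comm]) (fun i j a b => by rw [hskB, dotProduct_comm])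
  -- Chain vectors are mutually isotropic, so adding them keeps the pairings with the chains while
  -- the coefficients `s` cancel the pairings among the `Y` for both `A` and `B`.
  let y' : Fin k → ℕ → ι → ℂ := fun i a =>
    Y i a + ∑ z : (Σ j, Fin (ε j + 1)), s i z.1 a z.2 • x z.1 z.2
  have hsum : ∀ (M : Matrix ι ι ℂ) (i : Fin k) (a : ℕ) (v : ι → ℂ),
      y' i a ⬝ᵥ (M *ᵥ v) = Y i a ⬝ᵥ (M *ᵥ v) +
        ∑ z : (Σ j, Fin (ε j + 1)), s i z.1 a z.2 * (x z.1 z.2 ⬝ᵥ (M *ᵥ v)) := by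
    intro M i a v
    rw [add_dotProduct, sum_smul_dotProduct]
  have hy'A : ∀ i j a b, a < ε i →
      y' i a ⬝ᵥ (P.1.1 *ᵥ x j b) = if i = j ∧ a = b then 1 else 0 := by
    intro i j a b ha
    rw [hsum, hYA _ _ _ _ ha]
    simp [h.isotropic_lead]
  have hy'B : ∀ i j a b, a < ε i →
      y' i a ⬝ᵥ (P.1.2 *ᵥ x j b) = if i = j ∧ b = a + 1 then 1 else 0 := by
    intro i j a b ha
    rw [hsum, hYB _ _ _ _ ha]
    simp [h.isotropic_const]
  have hpick : ∀ (g : (Σ j, Fin (ε j + 1)) → ℂ) (i : Fin k) (a : ℕ) (ha : a < ε i + 1),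
      ∑ z : (Σ j, Fin (ε j + 1)), g z * (if i = z.1 ∧ a = z.2 then 1 else 0) = g ⟨i, ⟨a, ha⟩⟩ := by
    intro g i a ha
    rw [Finset.sum_eq_single ⟨i, ⟨a, ha⟩⟩]
    · simp
    · rintro ⟨j, b⟩ _ hb
      rw [if_neg, mul_zero]
      rintro ⟨rfl, rfl⟩
      exact hb rfl
    · simp
  have hflip : ∀ {M : Matrix ι ι ℂ}, Mᵀ = -M → ∀ u v, u ⬝ᵥ (M *ᵥ v) = -(v ⬝ᵥ (M *ᵥ u)) :=
    fun hM u v => by rw [dotProduct_mulVec_skew hM, dotProduct_comm]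
  have hyy : ∀ {M : Matrix ι ι ℂ}, Mᵀ = -M → ∀ i j a b, y' i a ⬝ᵥ (M *ᵥ y' j b) =
      Y i a ⬝ᵥ (M *ᵥ Y j b) +
        ∑ z : (Σ j, Fin (ε j + 1)), s j z.1 b z.2 * (Y i a ⬝ᵥ (M *ᵥ x z.1 z.2)) -
        ∑ z : (Σ j, Fin (ε j + 1)), s i z.1 a z.2 * (y' j b ⬝ᵥ (M *ᵥ x z.1 z.2)) := by
    intro M hM i j a b
    rw [hsum M i a, hflip hM (Y i a) (y' j b), hsum M j b, hflip hM (Y j b), sub_eq_add_neg,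
      ← Finset.sum_neg_distrib, neg_add, neg_neg, ← Finset.sum_neg_distrib]
    congr 1
    · congr 1
      refine Finset.sum_congr rfl fun z _ => ?_
      rw [hflip hM (x z.1 z.2), mul_neg, neg_neg]
    · refine Finset.sum_congr rfl fun z _ => ?_
      rw [hflip hM (x z.1 z.2), mul_neg]
  have hyyA : ∀ i j a b, a < ε i → b < ε j → y' i a ⬝ᵥ (P.1.1 *ᵥ y' j b) = 0 := by
    intro i j a b ha hb
    rw [hyy P.2.1]
    simp only [hYA i _ a _ ha, hy'A j _ b _ hb]
    rw [hpick (fun z => s j z.1 b z.2) i a (by omega),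
      hpick (fun z => s i z.1 a z.2) j b (by omega)]
    linear_combination -hsA i j a b
  have hyyB : ∀ i j a b, a < ε i → b < ε j → y' i a ⬝ᵥ (P.1.2 *ᵥ y' j b) = 0 := by
    intro i j a b ha hb
    rw [hyy P.2.2]
    simp only [hYB i _ a _ ha, hy'B j _ b _ hb, eq_comm (b := _ + 1)]
    rw [hpick (fun z => s j z.1 b z.2) i (a + 1) (by omega),
      hpick (fun z => s i z.1 a z.2) j (b + 1) (by omega)]
    linear_combination -hsB i j a b
  let col : CanIndex ε → ι → ℂ := fun p => match p with
    | ⟨j, Sum.inl b⟩ => y' j b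
    | ⟨j, Sum.inr a⟩ => x j a
  have hcol : LinearIndependent ℂ col := by
    rw [Fintype.linearIndependent_iff]
    intro c hc
    have hinl : ∀ j (b : Fin (ε j)), c ⟨j, Sum.inl b⟩ = 0 := by
      intro j b
      have h1 := congrArg (fun v => v ⬝ᵥ (P.1.1 *ᵥ x j b)) hc
      simp only [zero_dotProduct] at h1
      rw [sum_smul_dotProduct, Finset.sum_eq_single ⟨j, Sum.inl b⟩] at h1
      · simpa [col, hy'A j j b b b.2] using h1
      · rintro ⟨i, a | a⟩ _ hne
        · simp only [col]
          rw [hy'A _ _ _ _ a.2, if_neg, mul_zero]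
          rintro ⟨rfl, e⟩
          exact hne (by rw [Fin.ext e])
        · simp only [col]
          rw [h.isotropic_lead, mul_zero]
      · simp
    have hinr : ∑ z : (Σ j, Fin (ε j + 1)), c ⟨z.1, Sum.inr z.2⟩ • x z.1 z.2 = 0 := by
      rw [Fintype.sum_sigma] at hc
      simpa [Fintype.sum_sigma, hinl, col] using hc
    rintro ⟨j, b | a⟩
    · exact hinl j b
    · exact Fintype.linearIndependent_iff.1 h.indep _ hinr ⟨j, a⟩
  have hcard' : Fintype.card (CanIndex ε) = Fintype.card ι := by
    rw [hcard, Fintype.card_sigma]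
    refine Finset.sum_congr rfl fun j _ => ?_
    simp
    omega
  let S : Matrix ι (CanIndex ε) ℂ := Matrix.of fun v p => col p v
  have hS : Function.Injective S.mulVecLin := by
    rw [← LinearMap.ker_eq_bot, LinearMap.ker_eq_bot']
    intro c hc
    funext p
    refine Fintype.linearIndependent_iff.1 hcol c ?_ p
    rw [← hc]
    ext v
    simp [S, mulVec, dotProduct, mul_comm]
  let e := LinearEquiv.ofInjectiveOfFinrankEq S.mulVecLin hS (by simp [hcard'])
  let T := LinearMap.toMatrix' (e.symm : (ι → ℂ) →ₗ[ℂ] (CanIndex ε → ℂ))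
  have hSe : S = LinearMap.toMatrix' (e : (CanIndex ε → ℂ) →ₗ[ℂ] (ι → ℂ)) :=
    (LinearMap.toMatrix'_toLin' S).symm.trans
      (congrArg LinearMap.toMatrix' (LinearMap.ext fun v => rfl))
  have hST : S * T = 1 := by
    rw [hSe, ← LinearMap.toMatrix'_comp]
    simp
  have hTS : T * S = 1 := by
    rw [hSe, ← LinearMap.toMatrix'_comp]
    simp
  have hentry : ∀ (M : Matrix ι ι ℂ) p q, (Sᵀ * M * S) p q = col p ⬝ᵥ (M *ᵥ col q) := by
    intro M p q
    rw [Matrix.mul_assoc]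
    rfl
  have hmain : ∀ (M : Matrix ι ι ℂ) (K : ∀ j, Matrix (Fin (ε j)) (Fin (ε j + 1)) ℂ), Mᵀ = -M →
      (∀ i j a b, x i a ⬝ᵥ (M *ᵥ x j b) = 0) →
      (∀ i j a b, a < ε i → b < ε j → y' i a ⬝ᵥ (M *ᵥ y' j b) = 0) →
      (∀ i j (a : Fin (ε i)) b, i ≠ j → y' i a ⬝ᵥ (M *ᵥ x j b) = 0) →
      (∀ j (a : Fin (ε j)) (b : Fin (ε j + 1)), y' j a ⬝ᵥ (M *ᵥ x j b) = K j a b) →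
      (blockDiagonal' fun j => skewBlock (K j)) = Sᵀ * M * S := by
    intro M K hM hxx hyy hne hK
    ext ⟨i, p⟩ ⟨j, q⟩
    rw [hentry]
    rcases p with p | p <;> rcases q with q | q <;> simp only [col]
    · rw [hyy _ _ _ _ p.2 q.2]
      by_cases hij : i = j
      · subst hij
        rw [blockDiagonal'_apply_eq]
        rfl
      · rw [blockDiagonal'_apply_ne _ _ _ hij]
    · by_cases hij : i = j
      · subst hij
        rw [hK, blockDiagonal'_apply_eq]
        rfl
      · rw [blockDiagonal'_apply_ne _ _ _ hij, hne _ _ _ _ hij]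
    · rw [hflip hM]
      by_cases hij : i = j
      · subst hij
        rw [hK, blockDiagonal'_apply_eq]
        rfl
      · rw [blockDiagonal'_apply_ne _ _ _ hij, hne _ _ _ _ (Ne.symm hij), neg_zero]
    · rw [hxx]
      by_cases hij : i = j
      · subst hij
        rw [blockDiagonal'_apply_eq]
        rfl
      · rw [blockDiagonal'_apply_ne _ _ _ hij]
  refine (congCodim_eq_of_congruent P (canonicalPencil ε) S T hST hTS
    (hmain P.1.1 (fun j => matG (ε j)) P.2.1 h.isotropic_lead hyyA ?_ ?_)
    (hmain P.1.2 (fun j => matF (ε j)) P.2.2 h.isotropic_const hyyB ?_ ?_)).symm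
  · intro i j a b hij
    rw [hy'A _ _ _ _ a.2, if_neg (fun e => hij e.1)]
  · intro j a b
    rw [hy'A _ _ _ _ a.2, matG, of_apply]
    exact if_congr (by omega) rfl rfl
  · intro i j a b hij
    rw [hy'B _ _ _ _ a.2, if_neg (fun e => hij e.1)]
  · intro j a b
    rw [hy'B _ _ _ _ a.2, matF, of_apply]
    exact if_congr (by omega) rfl rfl

end SingularChains

end

section

/-! ### Chains from a polynomial basis of the kernel of a pencil -/

theorem coeff_iterate_divX (n : ℕ) (p : ℂ[X]) (s : ℕ) :
    (divX^[n] p).coeff s = p.coeff (s + n) := by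
  induction n generalizing p with
  | zero => rfl
  | succ n ih => rw [Function.iterate_succ_apply, ih, coeff_divX]; rfl

section Chains

variable {ι : Type} [Fintype ι] {k : ℕ} {ε : Fin k → ℕ}

/-- The matrix `λ A - B` over `ℂ[λ]`. -/
def pencilMatrix (P : SkewPencil ι) : Matrix ι ι ℂ[X] :=
  Matrix.of fun a b => X * C (P.1.1 a b) - C (P.1.2 a b)

theorem coeff_zero_pencilMatrix_mulVec (P : SkewPencil ι) (z : ι → ℂ[X]) :
    (fun a => ((pencilMatrix P *ᵥ z) a).coeff 0) = -(P.1.2 *ᵥ fun a => (z a).coeff 0) := by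
  ext a
  simp [pencilMatrix, mulVec, dotProduct, finsetSum_coeff, sub_mul, mul_assoc]

theorem coeff_succ_pencilMatrix_mulVec (P : SkewPencil ι) (z : ι → ℂ[X]) (s : ℕ) :
    (fun a => ((pencilMatrix P *ᵥ z) a).coeff (s + 1)) =
      (P.1.1 *ᵥ fun a => (z a).coeff s) - P.1.2 *ᵥ fun a => (z a).coeff (s + 1) := by
  ext a
  simp [pencilMatrix, mulVec, dotProduct, finsetSum_coeff, sub_mul, mul_assoc, coeff_X_mul]

theorem pencilMatrix_mulVec_eq_zero_iff (P : SkewPencil ι) (z : ι → ℂ[X]) :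
    pencilMatrix P *ᵥ z = 0 ↔ (P.1.2 *ᵥ fun a => (z a).coeff 0) = 0 ∧
      ∀ s, (P.1.1 *ᵥ fun a => (z a).coeff s) = P.1.2 *ᵥ fun a => (z a).coeff (s + 1) := by
  constructor
  · intro h
    constructor
    · rw [← neg_eq_zero, ← coeff_zero_pencilMatrix_mulVec, h]
      rfl
    · intro s
      rw [← sub_eq_zero, ← coeff_succ_pencilMatrix_mulVec, h]
      rfl
  · rintro ⟨h0, hs⟩
    ext a s
    cases s with
    | zero =>
      have := congrFun (coeff_zero_pencilMatrix_mulVec P z) a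
      rw [h0, neg_zero] at this
      exact this
    | succ s =>
      have := congrFun (coeff_succ_pencilMatrix_mulVec P z s) a
      rw [hs, sub_self] at this
      exact this

/-- A basis of the kernel of a skew-symmetric pencil with independent leading coefficients which
span the kernel at infinity provides singular chains. -/
theorem singularChains_of_kernel {P : SkewPencil ι} {v : Fin k → ι → ℂ[X]}
    (hker : ∀ j, pencilMatrix P *ᵥ v j = 0) (hdeg : ∀ j a, (v j a).natDegree ≤ ε j)
    (hlead : LinearIndependent ℂ fun j a => (v j a).coeff (ε j))
    (hgen : ∀ z, pencilMatrix P *ᵥ z = 0 → ∃ u : Fin k → ℂ[X], z = ∑ j, u j • v j)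
    (hinf : ∀ w, P.1.1 *ᵥ w = 0 → ∃ e : Fin k → ℂ, w = ∑ j, e j • fun a => (v j a).coeff (ε j)) :
    SingularChains P ε fun j s a => (v j a).coeff s where
  zero_of_lt j s hs := funext fun a => coeff_eq_zero_of_natDegree_le (hdeg j a) hs
  first j := ((pencilMatrix_mulVec_eq_zero_iff P _).1 (hker j)).1
  step j := ((pencilMatrix_mulVec_eq_zero_iff P _).1 (hker j)).2
  ker := hinf
  indep := by
    rw [Fintype.linearIndependent_iff]
    intro c hc
    -- Any common bound of the indices would do. A relation with coefficients `c` is encoded in `q j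
    -- = ∑ c X ^ (N - a)`, so that the kernel vector `G = ∑ q j • v j` has zero coefficient at `X ^
    -- N`.
    let N := ∑ j, ε j
    have hN : ∀ j, ε j ≤ N := fun j => Finset.single_le_sum (fun _ _ => Nat.zero_le _)
      (Finset.mem_univ j)
    let q : Fin k → ℂ[X] := fun j => ∑ a : Fin (ε j + 1), monomial (N - a) (c ⟨j, a⟩)
    have hqc : ∀ j (a : Fin (ε j + 1)), (q j).coeff (N - a) = c ⟨j, a⟩ := by
      intro j a
      simp only [q, finsetSum_coeff, coeff_monomial]
      rw [Finset.sum_eq_single a]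
      · simp
      · intro b _ hb
        have := hN j
        rw [if_neg]
        intro e
        exact hb (Fin.ext (by omega))
      · simp
    let G : ι → ℂ[X] := ∑ j, q j • v j
    have hG : pencilMatrix P *ᵥ G = 0 := by
      simp only [G]
      rw [mulVec_sum]
      refine Finset.sum_eq_zero fun j _ => ?_
      rw [mulVec_smul, hker, smul_zero]
    obtain ⟨-, hG1⟩ := (pencilMatrix_mulVec_eq_zero_iff P G).1 hG
    have hGN : (fun a => (G a).coeff N) = 0 := by
      rw [← hc]
      ext a
      simp only [G, Finset.sum_apply, Pi.smul_apply, smul_eq_mul, finsetSum_coeff,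
        Fintype.sum_sigma]
      refine Finset.sum_congr rfl fun j _ => ?_
      simp only [q, Finset.sum_mul, finsetSum_coeff]
      refine Finset.sum_congr rfl fun b _ => ?_
      have e : N = (N - b) + b := by have := hN j; omega
      conv_lhs => rw [e]
      rw [← C_mul_X_pow_eq_monomial, mul_assoc, coeff_C_mul, Nat.add_sub_cancel,
        add_comm (N - (b : ℕ)), coeff_X_pow_mul]
    -- The gap at `X ^ N` lets the chain relations restart, so the part of `G` above it is again in
    -- the kernel. Subtracting it leaves a combination of degree less than `N`, and predictable
    -- degrees force the coefficients of `q j` at `N - a` to vanish.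
    let Y : ι → ℂ[X] := fun a => divX^[N + 1] (G a)
    have hYc : ∀ s, (fun a => (Y a).coeff s) = fun a => (G a).coeff (s + (N + 1)) :=
      fun s => funext fun a => coeff_iterate_divX _ _ _
    have hY : pencilMatrix P *ᵥ Y = 0 := by
      rw [pencilMatrix_mulVec_eq_zero_iff]
      constructor
      · rw [hYc, zero_add, ← hG1, hGN, mulVec_zero]
      · intro s
        rw [hYc, hYc, hG1, Nat.add_right_comm]
    obtain ⟨u, hu⟩ := hgen Y hY
    rintro ⟨j, a⟩
    have hzero := coeff_eq_zero_of_sum_smul hdeg hlead (fun j => q j - X ^ (N + 1) * u j) N ?_ j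
      (N - a) (by have := a.2; omega)
    · rw [coeff_sub, hqc, coeff_X_pow_mul', if_neg (by omega), sub_zero] at hzero
      exact hzero
    · intro a s hs
      have e : (∑ j, (q j - X ^ (N + 1) * u j) • v j) a = G a - X ^ (N + 1) * Y a := by
        rw [hu]
        simp only [G, Finset.sum_apply, Pi.smul_apply, smul_eq_mul, sub_mul,
          Finset.sum_sub_distrib, Finset.mul_sum, mul_assoc]
      rw [e, coeff_sub, coeff_X_pow_mul']
      rcases hs.lt_or_eq with hs | rfl
      · rw [if_pos (Nat.succ_le_of_lt hs), congrFun (hYc _) a, Nat.sub_add_cancel hs, sub_self]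
      · rw [if_neg (by omega), sub_zero]
        exact congrFun hGN a

/-- A kernel vector is orthogonal to the range of `N`, which contains the orthogonal complement of
the `y j`; it therefore lies in their span. -/
theorem exists_eq_sum_of_mulVec_eq_zero {N : Matrix ι ι ℂ} (hN : Nᵀ = -N) {y : Fin k → ι → ℂ}
    (hy : LinearIndependent ℂ y) (hex : ∀ v, (∀ j, y j ⬝ᵥ v = 0) → ∃ u, N *ᵥ u = v)
    {w : ι → ℂ} (hw : N *ᵥ w = 0) : ∃ e : Fin k → ℂ, w = ∑ j, e j • y j := by
  classical
  obtain ⟨b, hb⟩ := exists_dual_family hy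
  refine ⟨fun j => w ⬝ᵥ b j, ?_⟩
  have key : ∀ v, w ⬝ᵥ v = (∑ j, (w ⬝ᵥ b j) • y j) ⬝ᵥ v := by
    intro v
    obtain ⟨u, hu⟩ := hex (v - ∑ i, (y i ⬝ᵥ v) • b i) fun j => by
      rw [dotProduct_sub, dotProduct_sum]
      simp [dotProduct_smul, hb]
    have h0 : w ⬝ᵥ (v - ∑ i, (y i ⬝ᵥ v) • b i) = 0 := by
      rw [← hu, dotProduct_mulVec_skew hN, hw, zero_dotProduct, neg_zero]
    rw [dotProduct_sub, dotProduct_sum, sub_eq_zero] at h0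
    rw [h0, sum_smul_dotProduct]
    refine Finset.sum_congr rfl fun j _ => ?_
    rw [dotProduct_smul, smul_eq_mul, mul_comm]
  funext a
  simpa using key (Pi.single a 1)

end Chains

end

section

/-! ### The kernel of the linearization -/

section Linearization

variable {d m : ℕ}

/-- The coefficient of `λ ^ q`, as a constant matrix polynomial. -/
def constCoeff (W : SkewPoly d m) (q : ℕ) : Matrix (Fin m) (Fin m) ℂ[X] :=
  (coeffMatrix (polyMatrix W.1) q).map C

/-- The polynomial part of `λ ^ (-s) W`. -/
def shiftMatrix (W : SkewPoly d m) (s : ℕ) : Matrix (Fin m) (Fin m) ℂ[X] :=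
  (polyMatrix W.1).map divX^[s]

theorem shiftMatrix_eq (W : SkewPoly d m) (s : ℕ) :
    shiftMatrix W s = (X : ℂ[X]) • shiftMatrix W (s + 1) + constCoeff W s := by
  ext1 a b
  simp only [shiftMatrix, constCoeff, coeffMatrix, map_apply, Matrix.add_apply, Matrix.smul_apply,
    smul_eq_mul]
  conv_lhs => rw [← divX_mul_X_add (divX^[s] (polyMatrix W.1 a b))]
  rw [coeff_iterate_divX, zero_add, mul_comm, Function.iterate_succ_apply']

theorem shiftMatrix_zero (W : SkewPoly d m) : shiftMatrix W 0 = polyMatrix W.1 := rfl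

theorem shiftMatrix_eq_zero (W : SkewPoly d m) {s : ℕ} (hs : d < s) : shiftMatrix W s = 0 := by
  ext a b t
  simp only [shiftMatrix, map_apply, coeff_iterate_divX, Matrix.zero_apply, coeff_zero]
  rw [coeff_polyMatrix, dif_neg (by omega)]

theorem coeff_constCoeff_mulVec (W : SkewPoly d m) (q : ℕ) (y : Fin m → ℂ[X]) (s : ℕ) :
    (fun i => ((constCoeff W q *ᵥ y) i).coeff s) =
      coeffMatrix (polyMatrix W.1) q *ᵥ fun i => (y i).coeff s := by
  ext i
  simp [constCoeff, mulVec, dotProduct, finsetSum_coeff]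

/-- As `W y = 0`, the upper part `λ ^ s` times the shift, applied to `y`, is minus the lower part of
`W` applied to `y`, of degree less than `s + e`. This bounds the degrees of the odd blocks of
`linVector`. -/
theorem coeff_shiftMatrix_mulVec_eq_zero (W : SkewPoly d m) {y : Fin m → ℂ[X]} {e : ℕ}
    (hy : polyMatrix W.1 *ᵥ y = 0) (hdeg : ∀ i, (y i).natDegree ≤ e) (s : ℕ) :
    ∀ i t, e ≤ t → ((shiftMatrix W s *ᵥ y) i).coeff t = 0 := by
  induction s with
  | zero => intro i t _; rw [shiftMatrix_zero, hy]; simp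
  | succ s ih =>
    intro i t ht
    have h1 := congrArg (fun M => ((M *ᵥ y) i).coeff (t + 1)) (shiftMatrix_eq W s)
    simp only [add_mulVec, smul_mulVec, Pi.add_apply, Pi.smul_apply, smul_eq_mul, coeff_add,
      coeff_X_mul] at h1
    have h2 : ((constCoeff W s *ᵥ y) i).coeff (t + 1) = 0 := by
      have h3 : (fun i => (y i).coeff (t + 1)) = 0 :=
        funext fun i => coeff_eq_zero_of_natDegree_le (hdeg i) (by omega)
      have := congrFun (coeff_constCoeff_mulVec W s y (t + 1)) i
      rw [h3, mulVec_zero] at this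
      exact this
    rw [ih i _ (by omega), h2, add_zero] at h1
    exact h1.symm

theorem sum_fin_ite_eq {M : Type*} [AddCommMonoid M] (n c : ℕ) (f : ℕ → M) :
    ∑ b : Fin n, (if (b : ℕ) = c then f b else 0) = if c < n then f c else 0 := by
  rw [Fin.sum_univ_eq_sum_range (fun b => if b = c then f b else 0) n, Finset.sum_ite_eq']
  simp

theorem constCoeff_eq (W : SkewPoly d m) {q : ℕ} (hq : q < d + 1) :
    constCoeff W q = (W.1 ⟨q, hq⟩).map C := by
  ext1 a b
  simp only [constCoeff, coeffMatrix, map_apply, coeff_polyMatrix, dif_pos hq]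

/-- The rows of the linearization, applied to a vector with blocks `Z a`. -/
theorem linearization_mulVec (W : SkewPoly d m) (Z : ℕ → Fin m → ℂ[X]) (a : Fin d) (i : Fin m) :
    (pencilMatrix (linearization W) *ᵥ fun p => Z p.1 p.2) (a, i) =
      if Even (a : ℕ) then
        (X * (constCoeff W (d - a) *ᵥ Z a) i + (constCoeff W (d - a - 1) *ᵥ Z a) i) +
          (if 0 < (a : ℕ) then X * Z (a - 1) i else 0) - (if (a : ℕ) + 1 < d then Z (a + 1) i else 0)
      else Z (a - 1) i - (if (a : ℕ) + 1 < d then X * Z (a + 1) i else 0) := by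
  -- Block tridiagonality leaves three terms; the test `0 < a` guards the truncated `a - 1`.
  have hblock : ∀ b : Fin d, ∑ j, pencilMatrix (linearization W) (a, i) (b, j) * Z b j =
      (if (b : ℕ) = a then if Even (a : ℕ) then
          X * (constCoeff W (d - a) *ᵥ Z b) i + (constCoeff W (d - a - 1) *ᵥ Z b) i else 0 else 0) +
      (if (b : ℕ) = a + 1 then if Even (a : ℕ) then -Z b i else -(X * Z b i) else 0) +
      (if (b : ℕ) = a - 1 then if 0 < (a : ℕ) then
          if Even (a : ℕ) then X * Z b i else Z b i else 0 else 0) := by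
    intro b
    have hsum : ∀ (A B : Matrix (Fin m) (Fin m) ℂ),
        ∑ j, (X * C (A i j) + C (B i j)) * Z b j =
          X * (A.map C *ᵥ Z b) i + (B.map C *ᵥ Z b) i := by
      intro A B
      simp only [mulVec, dotProduct, map_apply, Finset.mul_sum, ← Finset.sum_add_distrib]
      exact Finset.sum_congr rfl fun j _ => by ring
    have h1 : ∑ j, pencilMatrix (linearization W) (a, i) (b, j) * Z b j =
        X * ((linLead W.1 a b).map C *ᵥ Z b) i + ((linConst W.1 a b).map C *ᵥ Z b) i := by
      rw [← hsum]
      refine Finset.sum_congr rfl fun j _ => ?_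
      simp [pencilMatrix, linearization]
    have hmapone : ((1 : Matrix (Fin m) (Fin m) ℂ).map (C : ℂ → ℂ[X])) = 1 :=
      Matrix.map_one _ C_0 C_1
    have hmapzero : ((0 : Matrix (Fin m) (Fin m) ℂ).map (C : ℂ → ℂ[X])) = 0 :=
      Matrix.map_zero _ C_0
    have hmapneg : ((-1 : Matrix (Fin m) (Fin m) ℂ).map (C : ℂ → ℂ[X])) = -1 := by
      rw [← neg_inj, neg_neg]
      calc _ = (1 : Matrix (Fin m) (Fin m) ℂ).map (C : ℂ → ℂ[X]) := by ext1 u v; simp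
        _ = 1 := hmapone
    rw [h1]
    unfold linLead linConst
    rcases lt_trichotomy (b : ℕ) a with hab | hab | hab
    · have hne : a ≠ b := fun e => by rw [e] at hab; omega
      rw [if_neg hne, if_neg hne, if_neg (by omega : ¬(b : ℕ) = a + 1),
        if_neg (by omega : ¬(b : ℕ) = a + 1), if_neg (by omega : ¬(b : ℕ) = a),
        if_neg (by omega : ¬(b : ℕ) = a + 1)]
      by_cases h : (a : ℕ) = b + 1
      · rw [if_pos h, if_pos h, if_pos (by omega : (b : ℕ) = a - 1),
          if_pos (by omega : 0 < (a : ℕ))]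
        have hev : Even (a : ℕ) ↔ ¬Even (b : ℕ) := by rw [h, Nat.even_add_one]
        by_cases hb : Even (b : ℕ)
        · simp [hb, hev, hmapone, hmapzero]
        · simp [hb, hev, hmapone, hmapzero]
      · rw [if_neg h, if_neg h, if_neg (by omega : ¬(b : ℕ) = a - 1)]
        simp [hmapzero]
    · obtain rfl : b = a := Fin.ext hab
      rw [if_pos rfl, if_pos rfl, if_pos rfl, if_neg (by omega : ¬(b : ℕ) = b + 1)]
      have hlast : (if (b : ℕ) = b - 1 then if 0 < (b : ℕ) then
          if Even (b : ℕ) then X * Z b i else Z b i else 0 else 0) = 0 := by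
        split_ifs <;> first | rfl | omega
      rw [hlast, add_zero, add_zero]
      by_cases hb : Even (b : ℕ)
      · simp only [hb, if_true]
        rw [constCoeff_eq W (by omega), constCoeff_eq W (by omega)]
      · simp [hb, hmapzero]
    · have hne : a ≠ b := fun e => by rw [e] at hab; omega
      rw [if_neg hne, if_neg hne, if_neg (by omega : ¬(a : ℕ) = b + 1),
        if_neg (by omega : ¬(a : ℕ) = b + 1), if_neg (by omega : ¬(b : ℕ) = a),
        if_neg (by omega : ¬(b : ℕ) = a - 1)]
      by_cases h : (b : ℕ) = a + 1
      · rw [if_pos h, if_pos h, if_pos h]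
        by_cases ha : Even (a : ℕ)
        · simp [ha, hmapneg, hmapzero, neg_mulVec]
        · simp [ha, hmapneg, hmapzero, neg_mulVec]
      · rw [if_neg h, if_neg h, if_neg h]
        simp [hmapzero]
  have hexp : (pencilMatrix (linearization W) *ᵥ fun p => Z p.1 p.2) (a, i) =
      ∑ b : Fin d, ∑ j, pencilMatrix (linearization W) (a, i) (b, j) * Z b j := by
    simp only [mulVec, dotProduct, Fintype.sum_prod_type]
  rw [hexp, Finset.sum_congr rfl fun b _ => hblock b, Finset.sum_add_distrib,
    Finset.sum_add_distrib,
    sum_fin_ite_eq d a (fun b => if Even (a : ℕ) then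
          X * (constCoeff W (d - a) *ᵥ Z b) i + (constCoeff W (d - a - 1) *ᵥ Z b) i else 0),
    sum_fin_ite_eq d (a + 1) (fun b => if Even (a : ℕ) then -Z b i else -(X * Z b i)),
    sum_fin_ite_eq d (a - 1) (fun b => if 0 < (a : ℕ) then
          if Even (a : ℕ) then X * Z b i else Z b i else 0), if_pos a.2,
    if_pos (by omega : (a : ℕ) - 1 < d)]
  by_cases he : Even (a : ℕ)
  · simp only [he, if_true]
    split_ifs <;> ring
  · have : 0 < (a : ℕ) := Nat.pos_of_ne_zero fun h => he (by simp [h])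
    simp only [he, if_false, this, if_true]
    split_ifs <;> ring

/-- The vector in the kernel of the linearization of a matrix polynomial of grade `2h + 1` which is
determined by its last block `y`, block after block. -/
def linBlock (W : SkewPoly d m) (h : ℕ) (y : Fin m → ℂ[X]) (a : ℕ) : Fin m → ℂ[X] :=
  (X : ℂ[X]) ^ (h - a / 2) •
    if Even a then y else shiftMatrix W (2 * (h - a / 2)) *ᵥ y

/-- The vector with blocks `linBlock`. -/
def linVector (W : SkewPoly d m) (h : ℕ) (y : Fin m → ℂ[X]) : Fin d × Fin m → ℂ[X] :=
  fun p => linBlock W h y p.1 p.2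

theorem linVector_sum_smul {k : ℕ} (W : SkewPoly d m) (h : ℕ) (u : Fin k → ℂ[X])
    (y : Fin k → Fin m → ℂ[X]) :
    linVector W h (∑ j, u j • y j) = ∑ j, u j • linVector W h (y j) := by
  ext1 p
  simp only [linVector, linBlock, Finset.sum_apply, Pi.smul_apply, smul_eq_mul]
  split_ifs
  · simp only [Finset.sum_apply, Pi.smul_apply, smul_eq_mul, Finset.mul_sum]
    exact Finset.sum_congr rfl fun j _ => by ring
  · rw [mulVec_sum]
    simp only [mulVec_smul, Finset.sum_apply, Pi.smul_apply, smul_eq_mul, Finset.mul_sum]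
    exact Finset.sum_congr rfl fun j _ => by ring

theorem shiftMatrix_mulVec_two (W : SkewPoly d m) (s : ℕ) (y : Fin m → ℂ[X]) (i : Fin m) :
    (shiftMatrix W s *ᵥ y) i = X * (X * (shiftMatrix W (s + 2) *ᵥ y) i) +
      X * (constCoeff W (s + 1) *ᵥ y) i + (constCoeff W s *ᵥ y) i := by
  rw [shiftMatrix_eq W s, shiftMatrix_eq W (s + 1)]
  simp only [add_mulVec, smul_mulVec, smul_add, Pi.add_apply, Pi.smul_apply, smul_eq_mul]

theorem linBlock_even (W : SkewPoly d m) (h l : ℕ) (y : Fin m → ℂ[X]) :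
    linBlock W h y (2 * l) = (X : ℂ[X]) ^ (h - l) • y := by
  rw [linBlock, if_pos (even_two_mul l), Nat.mul_div_cancel_left l two_pos]

theorem linBlock_odd (W : SkewPoly d m) (h l : ℕ) (y : Fin m → ℂ[X]) :
    linBlock W h y (2 * l + 1) = (X : ℂ[X]) ^ (h - l) • (shiftMatrix W (2 * (h - l)) *ᵥ y) := by
  rw [linBlock, if_neg (by simp), show (2 * l + 1) / 2 = l by omega]

/-- Rows of odd index say that consecutive even blocks differ by a factor `λ`. Rows of even index
are two steps of Horner's scheme for `W y`, starting from a zero shift and ending with `W y = 0`. -/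
theorem linVector_mem_ker {h : ℕ} {W : SkewPoly (2 * h + 1) m} {y : Fin m → ℂ[X]}
    (hy : polyMatrix W.1 *ᵥ y = 0) :
    pencilMatrix (linearization W) *ᵥ linVector W h y = 0 := by
  ext1 ⟨⟨a, ha⟩, i⟩
  unfold linVector
  rw [linearization_mulVec W (linBlock W h y)]
  rcases Nat.even_or_odd' a with ⟨l, rfl | rfl⟩
  · rw [if_pos (even_two_mul l)]
    obtain ⟨e, rfl⟩ : ∃ e, h = l + e := ⟨h - l, by omega⟩
    have t1 : (if 0 < 2 * l then X * linBlock W (l + e) y (2 * l - 1) i else 0) =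
        X ^ (e + 2) * (shiftMatrix W (2 * e + 2) *ᵥ y) i := by
      rcases Nat.eq_zero_or_pos l with rfl | hl
      · rw [if_neg (by omega), shiftMatrix_eq_zero W (by omega), zero_mulVec, Pi.zero_apply,
          mul_zero]
      · obtain ⟨l, rfl⟩ : ∃ t, l = t + 1 := ⟨l - 1, by omega⟩
        rw [if_pos (by omega), show 2 * (l + 1) - 1 = 2 * l + 1 by omega, linBlock_odd,
          show l + 1 + e - l = e + 1 by omega, Pi.smul_apply, smul_eq_mul,
          show 2 * (e + 1) = 2 * e + 2 by ring]
        ring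
    have t2 : (if 2 * l + 1 < 2 * (l + e) + 1 then linBlock W (l + e) y (2 * l + 1) i else 0) =
        X ^ e * (shiftMatrix W (2 * e) *ᵥ y) i := by
      rcases Nat.eq_zero_or_pos e with rfl | he
      · rw [if_neg (by omega), mul_zero, shiftMatrix_zero, hy, Pi.zero_apply, mul_zero]
      · rw [if_pos (by omega), linBlock_odd, Nat.add_sub_cancel_left, Pi.smul_apply, smul_eq_mul]
    simp only
    rw [t1, t2, shiftMatrix_mulVec_two W (2 * e), linBlock_even, mulVec_smul, mulVec_smul,
      Nat.add_sub_cancel_left, show 2 * (l + e) + 1 - 2 * l = 2 * e + 1 by omega,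
      show 2 * e + 1 - 1 = 2 * e by omega, Pi.smul_apply, Pi.smul_apply, smul_eq_mul, smul_eq_mul,
      Pi.zero_apply]
    ring
  · rw [if_neg (by simp), if_pos (by simp only; omega)]
    simp only [Nat.add_sub_cancel]
    rw [show 2 * l + 1 + 1 = 2 * (l + 1) by ring, linBlock_even, linBlock_even,
      show h - l = h - (l + 1) + 1 by omega, Pi.smul_apply, Pi.smul_apply, smul_eq_mul,
      smul_eq_mul, Pi.zero_apply]
    ring

/-- The odd rows determine the even blocks backwards from the last one; the even rows then determine
the odd blocks from the top, and the final row says `W y = 0`. -/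
theorem eq_linVector {h : ℕ} {W : SkewPoly (2 * h + 1) m} {z : Fin (2 * h + 1) × Fin m → ℂ[X]}
    (hz : pencilMatrix (linearization W) *ᵥ z = 0) :
    z = linVector W h (fun i => z (Fin.last _, i)) ∧
      polyMatrix W.1 *ᵥ (fun i => z (Fin.last _, i)) = 0 := by
  let Z : ℕ → Fin m → ℂ[X] := fun a i => if ha : a < 2 * h + 1 then z (⟨a, ha⟩, i) else 0
  have hZ : z = fun p => Z p.1 p.2 := by
    ext1 ⟨a, i⟩
    exact (dif_pos a.2 : Z a i = _).symm
  set y : Fin m → ℂ[X] := fun i => z (Fin.last _, i) with hydef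
  have hZy : Z (2 * h) = y := by
    ext1 i
    simp only [Z, y]
    rw [dif_pos (Nat.lt_succ_self _)]
    rfl
  have hrow : ∀ (a : Fin (2 * h + 1)) i, _ := fun a i => (linearization_mulVec W Z a i).symm.trans
    (congrFun (hZ ▸ hz) (a, i))
  have hodd : ∀ l < h, ∀ i, Z (2 * l) i = X * Z (2 * (l + 1)) i := by
    intro l hl i
    have := hrow ⟨2 * l + 1, by omega⟩ i
    rw [if_neg (by simp), if_pos (by simp only; omega)] at this
    exact sub_eq_zero.1 this
  have heven : ∀ e ≤ h, Z (2 * (h - e)) = (X : ℂ[X]) ^ e • y := by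
    intro e
    induction e with
    | zero => intro _; rw [pow_zero, one_smul, Nat.sub_zero, hZy]
    | succ e ih =>
      intro he
      ext1 i
      rw [hodd _ (by omega), show h - (e + 1) + 1 = h - e by omega, ih (by omega)]
      simp only [Pi.smul_apply, smul_eq_mul]
      ring
  have hstep : ∀ l e, l + e = h → (∀ i, (if 0 < 2 * l then X * Z (2 * l - 1) i else 0) =
      X ^ (e + 2) * (shiftMatrix W (2 * e + 2) *ᵥ y) i) →
      ∀ i, (if 2 * l + 1 < 2 * h + 1 then Z (2 * l + 1) i else 0) =
        X ^ e * (shiftMatrix W (2 * e) *ᵥ y) i := by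
    intro l e hle ht i
    have h1 := hrow ⟨2 * l, by omega⟩ i
    rw [if_pos (even_two_mul l)] at h1
    simp only [Pi.zero_apply] at h1
    have h2 := heven e (by omega)
    rw [show h - e = l by omega] at h2
    rw [ht, h2, mulVec_smul, mulVec_smul, show 2 * h + 1 - 2 * l = 2 * e + 1 by omega,
      show 2 * e + 1 - 1 = 2 * e by omega, Pi.smul_apply, Pi.smul_apply, smul_eq_mul,
      smul_eq_mul] at h1
    rw [shiftMatrix_mulVec_two]
    linear_combination -h1
  have hprev : ∀ l e, l + e = h → ∀ i, (if 0 < 2 * l then X * Z (2 * l - 1) i else 0) =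
      X ^ (e + 2) * (shiftMatrix W (2 * e + 2) *ᵥ y) i := by
    intro l
    induction l with
    | zero =>
      intro e he i
      rw [if_neg (by omega), shiftMatrix_eq_zero W (by omega), zero_mulVec, Pi.zero_apply,
        mul_zero]
    | succ l ih =>
      intro e he i
      have := hstep l (e + 1) (by omega) (ih (e + 1) (by omega)) i
      rw [if_pos (by omega)] at this
      rw [if_pos (by omega), show 2 * (l + 1) - 1 = 2 * l + 1 by omega, this,
        show 2 * (e + 1) = 2 * e + 2 by ring]
      ring
  have hout : ∀ l e, l + e = h → ∀ i, (if 2 * l + 1 < 2 * h + 1 then Z (2 * l + 1) i else 0) =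
      X ^ e * (shiftMatrix W (2 * e) *ᵥ y) i := fun l e hle => hstep l e hle (hprev l e hle)
  constructor
  · rw [hZ]
    ext1 ⟨⟨a, ha⟩, i⟩
    simp only [linVector]
    rcases Nat.even_or_odd' a with ⟨l, rfl | rfl⟩
    · have h2 := heven (h - l) (by omega)
      rw [show h - (h - l) = l by omega] at h2
      rw [h2, linBlock_even]
    · have h2 := hout l (h - l) (by omega) i
      rw [if_pos (by omega)] at h2
      rw [h2, linBlock_odd]
      rfl
  · ext1 i
    have h2 := hout h 0 (by omega) i
    rw [if_neg (by omega), pow_zero, one_mul, mul_zero, shiftMatrix_zero] at h2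
    exact h2.symm

/-- The linearization of a matrix polynomial of odd grade with a good kernel basis has a full set
of singular chains. -/
theorem GoodKernel.singularChains_linearization {h k : ℕ} {W : SkewPoly (2 * h + 1) m}
    {ε : Fin k → ℕ} {x : Fin k → Fin m → ℂ[X]} (hx : GoodKernel (polyMatrix W.1) (2 * h + 1) ε x) :
    SingularChains (linearization W) (fun j => ε j + h)
      (fun j s a => (linVector W h (x j) a).coeff s) := by
  have hzero : ∀ j i, linVector W h (x j) (0, i) = X ^ h * x j i := by
    intro j i
    exact congrFun (linBlock_even W h 0 (x j)) i
  have hlead0 : ∀ j i, (linVector W h (x j) (0, i)).coeff (ε j + h) = (x j i).coeff (ε j) := by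
    intro j i
    rw [hzero, coeff_X_pow_mul]
  -- The leading coefficient acts on `w` as the coefficient of `λ` in the row formula for a constant
  -- vector. All blocks except the first must vanish, and the first lies in the kernel of the
  -- leading coefficient of `W`.
  have hinf : ∀ w : Fin (2 * h + 1) × Fin m → ℂ, (linearization W).1.1 *ᵥ w = 0 →
      (∀ p, p.1 ≠ 0 → w p = 0) ∧
        coeffMatrix (polyMatrix W.1) (2 * h + 1) *ᵥ (fun i => w (0, i)) = 0 := by
    intro w hw
    let w' : ℕ → Fin m → ℂ := fun a i => if ha : a < 2 * h + 1 then w (⟨a, ha⟩, i) else 0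
    have hw' : ∀ (a : ℕ) (ha : a < 2 * h + 1) i, w (⟨a, ha⟩, i) = w' a i :=
      fun a ha i => (dif_pos ha : w' a i = _).symm
    have hrow : ∀ (a : Fin (2 * h + 1)) i, _ := fun a i =>
      congrArg (fun p : ℂ[X] => p.coeff 1) (linearization_mulVec W (fun a i => C (w' a i)) a i)
    have hleft : ∀ (a : Fin (2 * h + 1)) i, ((pencilMatrix (linearization W) *ᵥ
        fun p => C (w' p.1 p.2)) (a, i)).coeff 1 = 0 := by
      intro a i
      have h1 := congrFun (coeff_succ_pencilMatrix_mulVec (linearization W)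
        (fun p => C (w' p.1 p.2)) 0) (a, i)
      have h2 : (fun p : Fin (2 * h + 1) × Fin m => (C (w' p.1 p.2)).coeff 0) = w :=
        funext fun p => by rw [coeff_C_zero, ← hw' p.1 p.1.2]
      have h3 : (fun p : Fin (2 * h + 1) × Fin m => (C (w' p.1 p.2)).coeff (0 + 1)) = 0 :=
        funext fun p => coeff_C_succ
      rw [h2, h3, hw, mulVec_zero, sub_zero] at h1
      exact h1
    have hcc : ∀ q a i s, ((constCoeff W q *ᵥ fun i => C (w' a i)) i).coeff s =
        (coeffMatrix (polyMatrix W.1) q *ᵥ fun i => (C (w' a i)).coeff s) i := fun q a i s =>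
      congrFun (coeff_constCoeff_mulVec W q (fun i => C (w' a i)) s) i
    have hcc1 : ∀ q a i, ((constCoeff W q *ᵥ fun i => C (w' a i)) i).coeff 1 = 0 := by
      intro q a i
      rw [hcc, show (fun i => (C (w' a i)).coeff 1) = 0 from funext fun i => coeff_C_succ,
        mulVec_zero]
      rfl
    have hodd : ∀ l < h, w' (2 * (l + 1)) = 0 := by
      intro l hl
      ext1 i
      have := hrow ⟨2 * l + 1, by omega⟩ i
      rw [hleft, if_neg (by simp), if_pos (by simp only; omega), coeff_sub, coeff_X_mul,
        coeff_C_zero, coeff_C_succ, zero_sub, eq_comm, neg_eq_zero] at this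
      exact this
    have heven : ∀ l ≤ h, ∀ i,
        (coeffMatrix (polyMatrix W.1) (2 * h + 1 - 2 * l) *ᵥ w' (2 * l)) i +
          (if 0 < 2 * l then w' (2 * l - 1) i else 0) = 0 := by
      intro l hl i
      have := hrow ⟨2 * l, by omega⟩ i
      rw [hleft, if_pos (even_two_mul l), coeff_sub, coeff_add, coeff_add, coeff_X_mul, hcc,
        hcc1] at this
      simp only [coeff_C_zero, add_zero] at this
      rw [eq_comm, show (if 2 * l + 1 < 2 * h + 1 then C (w' (2 * l + 1) i) else (0 : ℂ[X])).coeff 1 = 0 by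
        split_ifs
        · exact coeff_C_succ
        · exact coeff_zero 1, sub_zero] at this
      refine Eq.trans ?_ this
      congr 1
      split_ifs
      · rw [coeff_X_mul, coeff_C_zero]
      · exact (coeff_zero (R := ℂ) 1).symm
    constructor
    · rintro ⟨⟨a, ha⟩, i⟩ hne
      have ha0 : a ≠ 0 := fun e => hne (Fin.ext e)
      rw [hw']
      rcases Nat.even_or_odd' a with ⟨l, rfl | rfl⟩
      · obtain ⟨l, rfl⟩ : ∃ t, l = t + 1 := ⟨l - 1, by omega⟩
        rw [hodd l (by omega)]
        rfl
      · have h1 := heven (l + 1) (by omega) i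
        rw [hodd l (by omega), mulVec_zero, if_pos (by omega), Pi.zero_apply, zero_add] at h1
        exact h1
    · ext1 i
      have h1 := heven 0 (by omega) i
      rw [if_neg (by omega), add_zero] at h1
      rw [show (fun i => w (0, i)) = w' 0 from funext fun i => hw' 0 (by omega) i]
      exact h1
  have hdeg : ∀ j a, (linVector W h (x j) a).natDegree ≤ ε j + h := by
    rintro j ⟨⟨a, ha⟩, i⟩
    rw [natDegree_le_iff_coeff_eq_zero]
    intro s hs
    simp only [linVector]
    rcases Nat.even_or_odd' a with ⟨l, rfl | rfl⟩
    · rw [linBlock_even, Pi.smul_apply, smul_eq_mul, coeff_X_pow_mul', if_pos (by omega)]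
      exact coeff_eq_zero_of_natDegree_le (hx.deg_basis j i) (by omega)
    · rw [linBlock_odd, Pi.smul_apply, smul_eq_mul, coeff_X_pow_mul', if_pos (by omega)]
      exact coeff_shiftMatrix_mulVec_eq_zero W (hx.ker j) (hx.deg_basis j) _ i _ (by omega)
  refine singularChains_of_kernel (fun j => linVector_mem_ker (hx.ker j)) hdeg ?_ ?_ ?_
  · refine LinearIndependent.of_comp
      (LinearMap.funLeft ℂ ℂ fun i : Fin m => ((0 : Fin (2 * h + 1)), i)) ?_
    convert hx.indep_lead using 1
    funext j i
    exact hlead0 j i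
  · intro z hz
    obtain ⟨h1, h2⟩ := eq_linVector hz
    obtain ⟨u, hu⟩ := hx.exists_eq_sum_smul h2
    exact ⟨u, by rw [← linVector_sum_smul, ← hu]; exact h1⟩
  · intro w hw
    obtain ⟨h1, h2⟩ := hinf w hw
    have hsk : (coeffMatrix (polyMatrix W.1) (2 * h + 1))ᵀ =
        -coeffMatrix (polyMatrix W.1) (2 * h + 1) := by
      ext1 a b
      have := congrArg (fun p : ℂ[X] => p.coeff (2 * h + 1)) (congrFun (congrFun hx.skew a) b)
      simpa [coeffMatrix] using this
    obtain ⟨e, he⟩ := exists_eq_sum_of_mulVec_eq_zero hsk hx.indep_lead hx.exact_lead h2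
    have hlast : ∀ j, (linearization W).1.1 *ᵥ
        (fun a => (linVector W h (x j) a).coeff (ε j + h)) = 0 := by
      intro j
      rw [((pencilMatrix_mulVec_eq_zero_iff _ _).1 (linVector_mem_ker (hx.ker j))).2,
        show (fun a => (linVector W h (x j) a).coeff (ε j + h + 1)) = 0 from
          funext fun a => coeff_eq_zero_of_natDegree_le (hdeg j a) (Nat.lt_succ_self _),
        mulVec_zero]
    refine ⟨e, ?_⟩
    ext1 ⟨a, i⟩
    simp only [Finset.sum_apply, Pi.smul_apply]
    by_cases ha : a = 0
    · subst ha
      simp only [hlead0]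
      simpa using congrFun he i
    · rw [h1 _ ha]
      refine (Finset.sum_eq_zero fun j _ => ?_).symm
      rw [(hinf _ (hlast j)).1 _ ha, smul_zero]

end Linearization

end

section

/-! ### The codimensions -/

theorem congCodim_eq_of_reindex {ι ι' : Type} [Fintype ι] [Fintype ι'] [DecidableEq ι]
    [DecidableEq ι'] (e : ι ≃ ι') {P : SkewPencil ι} {P' : SkewPencil ι'}
    (hA : P'.1.1 = reindex e e P.1.1) (hB : P'.1.2 = reindex e e P.1.2) :
    congCodim P' = congCodim P := by
  have hre : ∀ M : Matrix ι ι ℂ, reindex e e M =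
      ((1 : Matrix ι ι ℂ).submatrix id e.symm)ᵀ * M * (1 : Matrix ι ι ℂ).submatrix id e.symm := by
    intro M
    ext i j
    simp [Matrix.mul_apply, one_apply]
  refine congCodim_eq_of_congruent P P' ((1 : Matrix ι ι ℂ).submatrix id e.symm)
    ((1 : Matrix ι ι ℂ).submatrix e.symm id) ?_ ?_ (hA.trans (hre _)) (hB.trans (hre _))
  · rw [submatrix_mul_equiv, Matrix.one_mul, submatrix_id_id]
  · rw [← submatrix_mul _ _ _ _ _ Function.bijective_id, Matrix.one_mul, submatrix_one_equiv]

theorem congCodim_genericPencil (n w : ℕ) (h : 2 * w < n) :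
    (congCodim (genericPencil n w h) : ℤ) = ((n : ℤ) - 2 * w - 1) * ((n : ℤ) - w) := by
  have hbal : ∀ i j, blockIndex n w j ≤ blockIndex n w i + 1 := by
    intro i j
    unfold blockIndex
    split_ifs <;> omega
  have hsum : ∑ i, blockIndex n w i = w := by
    have := sum_blockIndex n w h
    rw [Finset.sum_add_distrib, Finset.sum_add_distrib, Finset.sum_const, Finset.card_univ,
      Fintype.card_fin, smul_eq_mul, mul_one] at this
    omega
  have hsum' : ∑ i, (blockIndex n w i : ℤ) = w := by exact_mod_cast hsum
  rw [congCodim_eq_of_reindex (P := canonicalPencil (blockIndex n w)) (blockOrder n w h) rfl rfl,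
    congCodim_canonicalPencil hbal]
  have h1 := card_eqIndex (d := 1) (blockIndex n w)
  have hk : ((n - 2 * w : ℕ) : ℤ) = n - 2 * w := by omega
  rw [hsum', hk] at h1
  push_cast at h1
  refine mul_left_cancel₀ (two_ne_zero : (2 : ℤ) ≠ 0) ?_
  linear_combination h1

theorem two_mul_congCodim_linearization (m r d : ℕ) (hd : Odd d) (hr : 2 * r < m) (W : SkewPoly d m)
    (hW : IsGenericPoly r W) :
    2 * (congCodim (linearization W) : ℤ) = ((m : ℤ) - 2 * r - 1) * (m * (d + 1) - 2 * r) := by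
  obtain ⟨h, rfl⟩ := hd
  obtain ⟨k, ε, x, hx, hε⟩ := hW.exists_goodKernel ⟨_, hW.2.2, hW.2.2⟩
  obtain ⟨hk, hsum, hbal⟩ := generic_indices hr hε
  have h2 : ∑ j, (ε j : ℤ) = r * (2 * h + 1) := by exact_mod_cast hsum
  have h3 : (k : ℤ) = m - 2 * r := by omega
  rw [hx.singularChains_linearization.congCodim_eq ?_,
    congCodim_canonicalPencil (fun i j => by have := hbal i j; omega)]
  · rw [card_eqIndex]
    push_cast
    rw [Finset.sum_add_distrib, Finset.sum_const, Finset.card_univ, Fintype.card_fin, h2,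
      nsmul_eq_mul, h3]
    ring
  -- The chains account for the whole size: `∑ (2(ε j + h) + 1) = 2rd + (m - 2r)d = md`.
  · rw [Fintype.card_prod, Fintype.card_fin, Fintype.card_fin]
    zify
    simp only [mul_add, Finset.sum_add_distrib, ← Finset.mul_sum, Finset.sum_const,
      Finset.card_univ, Fintype.card_fin, nsmul_eq_mul]
    rw [h2, h3]
    ring

end

end SkewGeneric

end

/-! ### Main theorem -/

open SkewGeneric in
theorem mainTheorem4 :
    (∀ (n w : ℕ), 2 ≤ n → 2 ≤ 2 * w → ∀ h : 2 * w < n,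
      (congCodim (genericPencil n w h) : ℤ) = ((n : ℤ) - 2 * w - 1) * ((n : ℤ) - w)) ∧
    (∀ (m r d : ℕ), 2 ≤ m → Odd d → 2 ≤ 2 * r → 2 * r < m →
      ∀ W : SkewPoly d m, IsGenericPoly r W →
        ∃ c : ℕ, (c : ℚ) = 1 / 2 * ((m : ℚ) - 2 * r - 1) * ((m : ℚ) * (d + 1) - 2 * r) ∧
          IsSubmanifoldOfCodim (polyOrbit W) c ∧
          congCodim (linearization W) = c) := by
  refine ⟨fun n w _ _ h => congCodim_genericPencil n w h, fun m r d _ hd _ hr W hW => ?_⟩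
  have hc := two_mul_congCodim_linearization m r d hd hr W hW
  -- Choosing `c` as a dimension makes it a natural number, so no parity argument is needed for the
  -- factor `1/2`.
  refine ⟨congCodim (linearization W), ?_, isSubmanifoldOfCodim_polyOrbit hd.pos hr hW hc, rfl⟩
  have hq : 2 * (congCodim (linearization W) : ℚ) =
      ((m : ℚ) - 2 * r - 1) * (m * (d + 1) - 2 * r) := by exact_mod_cast hc
  linear_combination (1 / 2 : ℚ) * hq
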